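/- Let $n>1$, let $B=\{z\in\mathbb{C}^n:|z|<1\}$ be the unit ball, and let $\sigma$ be $(2n-1)$-dimensional (Hausdorff, i.e. area) measure on $\partial B$. For $P\in\partial B$ and $\alpha>1$ put $$\Gamma_\alpha(P)=\{z\in B:|z-P|<\alpha(1-|z|)\},\qquad \mathcal{A}_\alpha(P)=\{z\in B:|1-z\cdot\overline{P}|<\alpha(1-|z|)\},$$ where $z\cdot\overline{P}=\sum_{j}z_j\overline{P}_j$. Let $f$ be a holomorphic function on $B$ and let $E\subseteq\partial B$ be a set with $\sigma(E)>0$. Assume that $f$ is nontangentially bounded at $\sigma$-almost every point of $E$; that is, for $\sigma$-almost every $P\in E$ there is an $\alpha=\alpha(P)>1$ such that $f$ is bounded on $\Gamma_\alpha(P)$ (with a bound that may depend on $P$). Then $f$ has admissible limits at $\sigma$-almost every point of $E$; that is, for $\sigma$-almost every $P\in E$ and for every $\alpha>1$, the limit $$\lim_{\mathcal{A}_\alpha(P)\ni z\to P}f(z)$$ exists in $\mathbb{C}$. -/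

import Mathlib

open MeasureTheory Filter Topology

namespace BallApproach

/-- The open unit ball `B` of `ℂⁿ`, with the Euclidean norm. -/
def unitBall (n : ℕ) : Set (EuclideanSpace ℂ (Fin n)) :=
  Metric.ball 0 1

/-- The unit sphere `∂B` of `ℂⁿ`. -/
def unitSphere (n : ℕ) : Set (EuclideanSpace ℂ (Fin n)) :=
  Metric.sphere 0 1

/-- The `(2n - 1)`-dimensional (Hausdorff) measure on `ℂⁿ`, which on `∂B` is the area measure
up to a positive constant factor. -/
noncomputable def areaMeasure (n : ℕ) : Measure (EuclideanSpace ℂ (Fin n)) :=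
  Measure.hausdorffMeasure (2 * (n : ℝ) - 1)

/-- The Hermitian pairing `z · P̄ = ∑ j, z_j P̄_j`. -/
noncomputable def dotConj {n : ℕ} (z P : EuclideanSpace ℂ (Fin n)) : ℂ :=
  ∑ j, z j * (starRingEnd ℂ) (P j)

/-- The nontangential (Stolz) approach region
`Γ_α(P) = {z ∈ B : |z - P| < α (1 - |z|)}`; here `1 - |z|` is the distance of `z` to `∂B`. -/
def stolzRegion {n : ℕ} (α : ℝ) (P : EuclideanSpace ℂ (Fin n)) :
    Set (EuclideanSpace ℂ (Fin n)) :=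
  {z | z ∈ unitBall n ∧ ‖z - P‖ < α * (1 - ‖z‖)}

/-- The admissible approach region `A_α(P) = {z ∈ B : |1 - z · P̄| < α (1 - |z|)}`. -/
def admissibleRegion {n : ℕ} (α : ℝ) (P : EuclideanSpace ℂ (Fin n)) :
    Set (EuclideanSpace ℂ (Fin n)) :=
  {z | z ∈ unitBall n ∧ ‖1 - dotConj z P‖ < α * (1 - ‖z‖)}

/-- `f` is nontangentially bounded at `P`: for some aperture `α > 1`, which may depend on `P`,
`f` is bounded on `Γ_α(P)`. -/
def NontangentiallyBoundedAt {n : ℕ} (f : EuclideanSpace ℂ (Fin n) → ℂ)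
    (P : EuclideanSpace ℂ (Fin n)) : Prop :=
  ∃ α : ℝ, 1 < α ∧ ∃ M : ℝ, ∀ z ∈ stolzRegion α P, ‖f z‖ ≤ M

/-- `f` has an admissible limit at `P`: for every aperture `α > 1` the (finite) limit of `f(z)`
as `z → P` inside `A_α(P)` exists. -/
def HasAdmissibleLimitAt {n : ℕ} (f : EuclideanSpace ℂ (Fin n) → ℂ)
    (P : EuclideanSpace ℂ (Fin n)) : Prop :=
  ∀ α : ℝ, 1 < α → ∃ l : ℂ, Tendsto f (𝓝[admissibleRegion α P] P) (𝓝 l)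

end BallApproach

/-! For fixed aperture `α` and bound `M`, the points of the sphere over whose Stolz region `f` is
bounded by `M` form a closed set `K`. Countably many such sets contain all points of nontangential
boundedness, so it suffices to find admissible limits almost everywhere on one `K`. Almost every
point of `K` is a density point with respect to boxes of size `r ^ 2` along `P` and `r` orthogonally
to it. Up to constants these boxes are shells over balls of the metric `√‖1 - ⟪P, Q⟫‖`, for which
the cone measure of the sphere is doubling (`ae_isAnisoDensityPt`).

Boundedness at a density point `P` (`exists_bound_admissible`). Let `z` lie in an admissible region
at height `t`, and look at discs in direction `P` centred near `z - t • P`. Those of radius `t / 4`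
stay at greater height, where a bound is already known. On most of those of radius `3 * t / 2` the
bound holds because they are covered by Stolz regions over `K`. The logarithm of the modulus of a
Taylor coefficient in direction `P` is subharmonic on complex lines, so averaging it over a box
yields a disc of intermediate radius, larger than `t` if few centres are bad (`norm_le_of_hartogs`).
Using all powers of `f` removes every multiplicative loss. The same bound thus passes from height `4
* t / 3` to height `t`, and induction reaches the whole region.

Convergence. On complex lines through the origin, the local Fatou theorem of the disc
(`ae_exists_radialLimit_disc`, a Calderón–Stein comparison of `f` with a Poisson integral plus
harmonic measure) gives radial limits; Fubini makes this almost everywhere on `K`. For each `ε`,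
countably many closed sets cover these points such that on each of them `f` is uniformly `ε`-close
to a constant `c` near the ends of the radii. At a density point of such a set, `log ‖f - c‖` is at
most `log ε` on most of a box about `z` and bounded above on the rest, whence `‖f z - c‖ ≤ 2 * ε`
(`exists_forall_norm_sub_le`).

Finally, sets that are null for the cone measure are null for the Hausdorff measure: a hyperplane
slice of the cone projects onto a spherical cap by a Lipschitz map
(`hausdorffMeasure_eq_zero_of_cone`). -/

namespace BallApproach
open Metric Real

/-! ### Poisson integrals on the disc and Fatou's theorem. -/

/-- A measure whose mass in the ball of radius `u` about `x` is at most `ε u` integrates the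
Poisson kernel of the half plane to at most `8 ε`. -/
lemma lintegral_cauchy_kernel_le {m : Measure ℝ} {x : ℝ} {ε : ENNReal}
    (hm : ∀ u : ℝ, 0 < u → m (closedBall x u) ≤ ε * ENNReal.ofReal u) {t : ℝ} (ht : 0 < t) :
    ∫⁻ s, ENNReal.ofReal (t / (t ^ 2 + (s - x) ^ 2)) ∂m ≤ 8 * ε := by
  -- Dyadic decomposition: for the least `k` with `|s - x| ≤ 2 ^ k * t`, the kernel at `s` is at
  -- most `4 * 4⁻ᵏ / t`. Against mass `ε * 2 ^ k * t` this sums to `8 * ε`.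
  have key : ∀ s : ℝ, ENNReal.ofReal (t / (t ^ 2 + (s - x) ^ 2)) ≤
      ∑' k : ℕ, (closedBall x (2 ^ k * t)).indicator
        (fun _ => ENNReal.ofReal (4 * (4 ^ k)⁻¹ / t)) s := by
    intro s
    have hex : ∃ k : ℕ, |s - x| ≤ 2 ^ k * t := by
      obtain ⟨k, hk⟩ := pow_unbounded_of_one_lt (|s - x| / t) (one_lt_two)
      exact ⟨k, by rw [div_lt_iff₀ ht] at hk; exact hk.le⟩
    classical
    have h1 := Nat.find_spec hex
    set k := Nat.find hex with hk
    refine le_trans ?_ (ENNReal.le_tsum k)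
    rw [Set.indicator_of_mem (by simpa [mem_closedBall, Real.dist_eq] using h1)]
    apply ENNReal.ofReal_le_ofReal
    rw [div_le_div_iff₀ (by positivity) ht]
    rcases Nat.eq_zero_or_pos k with h0 | hpos
    · rw [h0]; simp; nlinarith [sq_nonneg (s - x), sq_nonneg t]
    · have h2 := Nat.find_min hex (Nat.sub_lt hpos one_pos)
      rw [not_le] at h2
      have h3 : (2 : ℝ) ^ k = 2 * 2 ^ (k - 1) := by
        rw [← pow_succ']; congr 1; omega
      have h4 : (4 : ℝ) ^ k = (2 ^ k) ^ 2 := by rw [← pow_mul, mul_comm, pow_mul]; norm_num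
      have h5 : 2 ^ k * t ≤ 2 * |s - x| := by rw [h3]; linarith
      have h6 : (2 ^ k * t) ^ 2 ≤ 4 * (s - x) ^ 2 := by
        rw [← sq_abs (s - x)]
        have : (0:ℝ) ≤ 2 ^ k * t := by positivity
        nlinarith
      have h7 : (0:ℝ) < 4 ^ k := by positivity
      rw [mul_comm (4:ℝ), mul_assoc, ← div_eq_inv_mul, le_div_iff₀ h7, h4]
      nlinarith [sq_nonneg t]
  calc _ ≤ ∫⁻ s, ∑' k : ℕ, (closedBall x (2 ^ k * t)).indicator
        (fun _ => ENNReal.ofReal (4 * (4 ^ k)⁻¹ / t)) s ∂m := lintegral_mono key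
    _ = ∑' k : ℕ, ENNReal.ofReal (4 * (4 ^ k)⁻¹ / t) * m (closedBall x (2 ^ k * t)) := by
        rw [lintegral_tsum]
        · congr 1; ext k
          rw [lintegral_indicator_const measurableSet_closedBall]
        · intro k; exact (measurable_const.indicator measurableSet_closedBall).aemeasurable
    _ ≤ ∑' k : ℕ, ε * ENNReal.ofReal (4 * (1 / 2) ^ k) := by
        refine ENNReal.tsum_le_tsum fun k => ?_
        calc _ ≤ ENNReal.ofReal (4 * (4 ^ k)⁻¹ / t) * (ε * ENNReal.ofReal (2 ^ k * t)) := by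
              gcongr; exact hm _ (by positivity)
          _ = ε * (ENNReal.ofReal (4 * (4 ^ k)⁻¹ / t) * ENNReal.ofReal (2 ^ k * t)) := by ring
          _ = _ := by
              rw [← ENNReal.ofReal_mul (by positivity)]
              congr 2
              have : (4:ℝ) ^ k = 2 ^ k * 2 ^ k := by rw [← mul_pow]; norm_num
              rw [this, one_div, inv_pow]; field_simp
    _ = 8 * ε := by
        rw [ENNReal.tsum_mul_left, ← ENNReal.ofReal_tsum_of_nonneg (fun _ => by positivity)
          (summable_geometric_two.mul_left 4), tsum_mul_left, tsum_geometric_two, mul_comm]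
        norm_num

/-- The Poisson integral over the unit circle of a function of the angle. -/
noncomputable def poissonInt {E : Type*} [NormedAddCommGroup E] [NormedSpace ℝ E]
    (f : ℝ → E) (w : ℂ) : E :=
  (2 * π)⁻¹ • ∫ θ in 0..2 * π, poissonKernel 0 w (circleMap 0 1 θ) • f θ

lemma poissonKernel_nonneg {w z : ℂ} (hw : ‖w‖ ≤ ‖z‖) : 0 ≤ poissonKernel 0 w z := by
  rw [poissonKernel_def]
  simp only [sub_zero]
  apply div_nonneg _ (by positivity)
  have := norm_nonneg w
  nlinarith

lemma continuous_poissonKernel_circleMap {w : ℂ} (hw : ‖w‖ < 1) :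
    Continuous fun θ : ℝ => poissonKernel 0 w (circleMap 0 1 θ) := by
  simp only [poissonKernel_def]
  refine Continuous.div (by fun_prop) (by fun_prop) fun θ => ?_
  have : circleMap 0 1 θ ≠ w := circleMap_ne_mem_ball (by simpa using hw) θ
  simp only [sub_zero]
  exact pow_ne_zero _ (norm_ne_zero_iff.2 (sub_ne_zero.2 this))

lemma poissonInt_const {E : Type*} [NormedAddCommGroup E] [NormedSpace ℝ E] [CompleteSpace E]
    (a : E) {w : ℂ} (hw : ‖w‖ < 1) : poissonInt (fun _ => a) w = a := by
  have h : Real.circleAverage (poissonKernel 0 w • fun _ : ℂ => (1 : ℂ)) 0 1 = 1 :=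
    DiffContOnCl.circleAverage_poissonKernel_smul (f := fun _ => (1 : ℂ)) diffContOnCl_const
      (by simpa using hw)
  have h2 : ((2 * π)⁻¹ * ∫ θ in 0..2 * π, poissonKernel 0 w (circleMap 0 1 θ)) = 1 := by
    rw [Real.circleAverage_def] at h
    simp only [Pi.smul_apply', Complex.real_smul, mul_one, intervalIntegral.integral_ofReal] at h
    exact_mod_cast h
  rw [poissonInt, intervalIntegral.integral_smul_const, smul_smul, h2, one_smul]

lemma poissonInt_sub {E : Type*} [NormedAddCommGroup E] [NormedSpace ℝ E]
    {f g : ℝ → E} (hf : IntervalIntegrable f volume 0 (2 * π))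
    (hg : IntervalIntegrable g volume 0 (2 * π)) {w : ℂ} (hw : ‖w‖ < 1) :
    poissonInt (fun θ => f θ - g θ) w = poissonInt f w - poissonInt g w := by
  have hc := continuous_poissonKernel_circleMap hw
  simp only [poissonInt, smul_sub]
  rw [intervalIntegral.integral_sub, smul_sub]
  · exact hf.continuousOn_smul hc.continuousOn
  · exact hg.continuousOn_smul hc.continuousOn

lemma enorm_poissonInt_le {E : Type*} [NormedAddCommGroup E] [NormedSpace ℝ E]
    (f : ℝ → E) {w : ℂ} (hw : ‖w‖ < 1) :
    ‖poissonInt f w‖ₑ ≤ ∫⁻ θ in Set.Ioc 0 (2 * π),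
      ENNReal.ofReal (poissonKernel 0 w (circleMap 0 1 θ)) * ‖f θ‖ₑ := by
  have hpi : (0 : ℝ) ≤ 2 * π := by positivity
  rw [poissonInt, intervalIntegral.integral_of_le hpi, enorm_smul]
  calc _ ≤ 1 * ‖∫ θ in Set.Ioc 0 (2 * π), poissonKernel 0 w (circleMap 0 1 θ) • f θ‖ₑ := by
        gcongr
        rw [Real.enorm_eq_ofReal (by positivity), ENNReal.ofReal_le_one]
        exact inv_le_one_of_one_le₀ (by nlinarith [pi_gt_three])
    _ ≤ _ := by
        rw [one_mul]
        refine (enorm_integral_le_lintegral_enorm _).trans (lintegral_mono fun θ => ?_)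
        simp only
        rw [enorm_smul, Real.enorm_eq_ofReal (poissonKernel_nonneg (by simpa using hw.le))]

lemma norm_circleMap_sub_circleMap_sq (ρ s x : ℝ) :
    ‖circleMap 0 1 s - circleMap 0 ρ x‖ ^ 2 = (1 - ρ) ^ 2 + 2 * ρ * (1 - Real.cos (s - x)) := by
  rw [← Complex.normSq_eq_norm_sq, Complex.normSq_apply]
  simp only [circleMap, Complex.exp_mul_I, zero_add, Complex.ofReal_one, one_mul]
  simp only [← Complex.ofReal_cos, ← Complex.ofReal_sin, Complex.sub_re, Complex.add_re,
    Complex.mul_re, Complex.ofReal_re, Complex.ofReal_im, Complex.I_re, Complex.I_im,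
    Complex.sub_im, Complex.add_im, Complex.mul_im, Complex.add_re]
  rw [Real.cos_sub]
  linear_combination Real.sin_sq_add_cos_sq s + ρ ^ 2 * Real.sin_sq_add_cos_sq x

/-- The bound `1 - cos u ≥ 2 * u ^ 2 / π ^ 2` and `π ^ 2 ≤ 10` cost a factor `5` in the denominator;
the numerator `1 - ρ ^ 2 ≤ 2 * (1 - ρ)` costs the other `2`. -/
lemma poissonKernel_circleMap_le_of_near {ρ s x : ℝ} (h1 : 1 / 2 ≤ ρ) (h2 : ρ < 1)
    (hs : |s - x| ≤ 1) :
    poissonKernel 0 (circleMap 0 ρ x) (circleMap 0 1 s) ≤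
      10 * ((1 - ρ) / ((1 - ρ) ^ 2 + (s - x) ^ 2)) := by
  rw [poissonKernel_def]
  simp only [sub_zero, norm_circleMap_zero]
  rw [norm_circleMap_sub_circleMap_sq]
  have hc := Real.cos_le_one_sub_mul_cos_sq (x := s - x) (by linarith [pi_gt_three])
  have hpi2 : (1 : ℝ) / 10 ≤ 1 / π ^ 2 := by
    apply one_div_le_one_div_of_le (by positivity)
    nlinarith [pi_lt_d2, pi_gt_three]
  have hc' : (1 - Real.cos (s - x)) ≥ (s - x) ^ 2 / 5 := by
    have : 2 / π ^ 2 = 2 * (1 / π ^ 2) := by ring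
    nlinarith [sq_nonneg (s - x)]
  have ht : 0 < 1 - ρ := by linarith
  rw [← mul_div_assoc, div_le_div_iff₀ (by nlinarith [sq_nonneg (s - x), sq_pos_of_pos ht])
    (by positivity), abs_one, abs_of_pos (by linarith : 0 < ρ)]
  have : (1 - ρ) ^ 2 + 2 * ρ * (1 - Real.cos (s - x)) ≥ ((1 - ρ) ^ 2 + (s - x) ^ 2) / 5 := by
    nlinarith [sq_nonneg (s - x), sq_nonneg (1 - ρ)]
  nlinarith [mul_le_mul_of_nonneg_left this (by linarith : 0 ≤ 10 * (1 - ρ)),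
    sq_nonneg (s - x), sq_nonneg (1 - ρ), mul_nonneg ht.le
    (by positivity : 0 ≤ (1 - ρ) ^ 2 + (s - x) ^ 2)]

/-- Since `x` is interior, `|s - x| < 2 * π` on the closed interval, so `1 - cos (s - x)` vanishes
only at `s = x` and has a positive minimum away from it. -/
lemma exists_poissonKernel_circleMap_le_of_far {x : ℝ} (hx : x ∈ Set.Ioo 0 (2 * π)) {η : ℝ}
    (hη : 0 < η) : ∃ C : ℝ, 0 ≤ C ∧ ∀ ρ : ℝ, 1 / 2 ≤ ρ → ρ < 1 → ∀ s ∈ Set.Ioc 0 (2 * π),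
      η ≤ |s - x| → poissonKernel 0 (circleMap 0 ρ x) (circleMap 0 1 s) ≤ C * (1 - ρ) := by
  have hcomp : IsCompact (Set.Icc 0 (2 * π) ∩ {s | η ≤ |s - x|}) :=
    isCompact_Icc.inter_right (isClosed_le continuous_const (by fun_prop))
  obtain ⟨m, hm, hmle⟩ : ∃ m : ℝ, 0 < m ∧
      ∀ s ∈ Set.Icc 0 (2 * π) ∩ {s | η ≤ |s - x|}, m ≤ 1 - Real.cos (s - x) := by
    refine hcomp.exists_forall_le' (f := fun s => 1 - Real.cos (s - x)) (by fun_prop) ?_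
    rintro s ⟨⟨h0, h1⟩, h2⟩
    have : Real.cos (s - x) ≠ 1 := by
      intro h
      rw [Real.cos_eq_one_iff_of_lt_of_lt (by linarith [hx.2]) (by linarith [hx.1])] at h
      simp only [Set.mem_ofPred_eq, h, abs_zero] at h2
      linarith
    have := lt_of_le_of_ne (Real.cos_le_one _) this
    simp only [sub_pos]; exact this
  refine ⟨2 / m, by positivity, fun ρ h1 h2 s hs hη' => ?_⟩
  have hm' := hmle s ⟨⟨hs.1.le, hs.2⟩, hη'⟩
  rw [poissonKernel_def]
  simp only [sub_zero, norm_circleMap_zero]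
  rw [norm_circleMap_sub_circleMap_sq, abs_one, abs_of_pos (by linarith : 0 < ρ)]
  have hden : m ≤ (1 - ρ) ^ 2 + 2 * ρ * (1 - Real.cos (s - x)) := by
    nlinarith [sq_nonneg (1 - ρ)]
  rw [div_le_iff₀ (by linarith), div_mul_eq_mul_div, div_mul_eq_mul_div, le_div_iff₀ hm]
  nlinarith [mul_le_mul_of_nonneg_left hden (by linarith : 0 ≤ 2 * (1 - ρ)),
    mul_nonneg (by linarith : 0 ≤ 1 - ρ) hm.le]

/-- **Fatou's theorem** for Poisson integrals at a Lebesgue point. -/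
lemma tendsto_poissonInt_of_lebesguePoint {E : Type*} [NormedAddCommGroup E] [NormedSpace ℝ E]
    [CompleteSpace E] {f : ℝ → E} (hf : IntervalIntegrable f volume 0 (2 * π)) {x : ℝ}
    (hx : x ∈ Set.Ioo 0 (2 * π))
    (hleb : ∀ ε : ENNReal, 0 < ε → ∃ η > 0, ∀ u, 0 < u → u ≤ η →
      ∫⁻ s in closedBall x u, ‖f s - f x‖ₑ ≤ ε * ENNReal.ofReal u) :
    Tendsto (fun ρ : ℝ => poissonInt f (circleMap 0 ρ x)) (𝓝[<] 1) (𝓝 (f x)) := by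
  rw [EMetric.tendsto_nhds]
  intro δ hδ
  -- The factor `10` comes from `poissonKernel_circleMap_le_of_near`, the `8` from
  -- `lintegral_cauchy_kernel_le`.
  obtain ⟨ε, hε0, hε⟩ : ∃ ε : ENNReal, 0 < ε ∧ 10 * (8 * ε) < δ / 2 := by
    have : Tendsto (fun ε : ENNReal => 10 * (8 * ε)) (𝓝[>] 0) (𝓝 (10 * (8 * 0))) := by
      apply Tendsto.mono_left _ nhdsWithin_le_nhds
      exact ENNReal.Tendsto.const_mul (ENNReal.Tendsto.const_mul tendsto_id (by simp)) (by simp)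
    have h2 := this.eventually_lt_const (u := δ / 2) (by simpa using hδ.ne')
    exact (h2.and self_mem_nhdsWithin).exists.imp fun a h => ⟨h.2, h.1⟩
  obtain ⟨η₀, hη₀, hle⟩ := hleb ε hε0
  obtain ⟨η, hη, hη1, hηη, hsub⟩ : ∃ η, 0 < η ∧ η ≤ 1 ∧ η ≤ η₀ ∧
      closedBall x η ⊆ Set.Ioc 0 (2 * π) := by
    obtain ⟨r, hr, hr'⟩ := Metric.nhds_basis_closedBall.mem_iff.1 (isOpen_Ioo.mem_nhds hx)
    exact ⟨min r (min 1 η₀), by positivity, by simp, by simp,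
      (closedBall_subset_closedBall (min_le_left _ _)).trans (hr'.trans Set.Ioo_subset_Ioc_self)⟩
  obtain ⟨C, hC, hfar⟩ := exists_poissonKernel_circleMap_le_of_far hx hη
  have hfi : IntegrableOn f (Set.Ioc 0 (2 * π)) :=
    (intervalIntegrable_iff_integrableOn_Ioc_of_le (by positivity)).1 hf
  have hfd : IntegrableOn (fun s => f s - f x) (Set.Ioc 0 (2 * π)) :=
    hfi.sub continuous_const.integrableOn_Ioc
  set A : ENNReal := ∫⁻ s in Set.Ioc 0 (2 * π), ‖f s - f x‖ₑ with hA
  have hAfin : A ≠ ⊤ := hfd.2.ne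
  have hlim : Tendsto (fun ρ : ℝ => ENNReal.ofReal (C * (1 - ρ)) * A) (𝓝[<] 1) (𝓝 0) := by
    have h1 : Tendsto (fun ρ : ℝ => C * (1 - ρ)) (𝓝[<] 1) (𝓝 0) := by
      apply Tendsto.mono_left _ nhdsWithin_le_nhds
      have : Continuous fun ρ : ℝ => C * (1 - ρ) := by fun_prop
      simpa using this.tendsto 1
    simpa using ENNReal.Tendsto.mul_const (ENNReal.tendsto_ofReal h1) (Or.inr hAfin)
  have hlt := hlim.eventually_lt_const (u := δ / 2) (by simpa using hδ.ne')
  have hhalf : ∀ᶠ ρ : ℝ in 𝓝[<] 1, 1 / 2 ≤ ρ :=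
    nhdsWithin_le_nhds (Ici_mem_nhds (by norm_num))
  filter_upwards [hlt, hhalf, self_mem_nhdsWithin] with ρ h1 h2 h3
  have h3 : ρ < 1 := h3
  have hw : ‖circleMap 0 ρ x‖ < 1 := by
    rw [norm_circleMap_zero, abs_of_pos (by linarith)]; exact h3
  have hdiff : poissonInt f (circleMap 0 ρ x) - f x
      = poissonInt (fun s => f s - f x) (circleMap 0 ρ x) := by
    rw [poissonInt_sub hf (by simp) hw, poissonInt_const _ hw]
  rw [edist_eq_enorm_sub, hdiff]
  refine (enorm_poissonInt_le _ hw).trans_lt ?_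
  have hsplit : ∫⁻ θ in Set.Ioc 0 (2 * π),
        ENNReal.ofReal (poissonKernel 0 (circleMap 0 ρ x) (circleMap 0 1 θ)) * ‖f θ - f x‖ₑ
      ≤ 10 * (8 * ε) + ENNReal.ofReal (C * (1 - ρ)) * A := by
    rw [← lintegral_inter_add_sdiff _ _ (measurableSet_closedBall (x := x) (ε := η)),
      Set.inter_eq_self_of_subset_right hsub]
    have hqm : AEMeasurable (fun s => ‖f s - f x‖ₑ) (volume.restrict (closedBall x η)) :=
      (hfd.mono_set hsub).1.enorm
    gcongr
    -- The Lebesgue point condition says exactly that the measure `‖f s - f x‖ ds` near `x`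
    -- satisfies the growth hypothesis of the kernel estimate.
    · have hm := lintegral_cauchy_kernel_le
        (m := (volume.restrict (closedBall x η)).withDensity fun s => ‖f s - f x‖ₑ)
        (x := x) (ε := ε) (t := 1 - ρ) ?_ (by linarith)
      · rw [lintegral_withDensity_eq_lintegral_mul₀ hqm (by fun_prop)] at hm
        calc _ ≤ ∫⁻ s in closedBall x η, 10 * ((fun s => ‖f s - f x‖ₑ) *
                fun s => ENNReal.ofReal ((1 - ρ) / ((1 - ρ) ^ 2 + (s - x) ^ 2))) s := by
              refine setLIntegral_mono' measurableSet_closedBall fun s hs => ?_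
              have hk := poissonKernel_circleMap_le_of_near h2 h3 (s := s) (x := x)
                (by rw [mem_closedBall, Real.dist_eq] at hs; linarith)
              simp only [Pi.mul_apply]
              rw [mul_comm (‖f s - f x‖ₑ), ← mul_assoc]
              gcongr
              refine (ENNReal.ofReal_le_ofReal hk).trans ?_
              rw [ENNReal.ofReal_mul (by norm_num)]
              simp
          _ ≤ _ := by
              rw [lintegral_const_mul' _ _ (by simp)]
              gcongr
      · intro u hu
        rw [withDensity_apply _ measurableSet_closedBall,
          Measure.restrict_restrict measurableSet_closedBall]
        calc _ ≤ ∫⁻ s in closedBall x (min u η), ‖f s - f x‖ₑ := by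
              apply lintegral_mono_set
              rintro s ⟨ha, hb⟩
              rw [mem_closedBall] at *
              exact le_min ha hb
          _ ≤ ε * ENNReal.ofReal (min u η) := hle _ (by positivity) ((min_le_right _ _).trans hηη)
          _ ≤ _ := by gcongr; exact min_le_left _ _
    · calc _ ≤ ∫⁻ s in Set.Ioc 0 (2 * π) \ closedBall x η,
            ENNReal.ofReal (C * (1 - ρ)) * ‖f s - f x‖ₑ := by
            refine setLIntegral_mono' (measurableSet_Ioc.diff measurableSet_closedBall)
              fun s hs => ?_
            gcongr
            refine hfar ρ h2 h3 s hs.1 ?_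
            have := hs.2
            rw [mem_closedBall, Real.dist_eq, not_le] at this
            exact this.le
        _ ≤ ∫⁻ s in Set.Ioc 0 (2 * π), ENNReal.ofReal (C * (1 - ρ)) * ‖f s - f x‖ₑ :=
            lintegral_mono_set Set.sdiff_subset
        _ = _ := by rw [lintegral_const_mul' _ _ ENNReal.ofReal_ne_top]
  calc _ ≤ _ := hsplit
    _ < δ / 2 + δ / 2 := ENNReal.add_lt_add hε h1
    _ = δ := ENNReal.add_halves δ

/-- **Fatou's theorem** for Poisson integrals: radial limits exist almost everywhere. -/
theorem ae_tendsto_poissonInt {E : Type*} [NormedAddCommGroup E] [NormedSpace ℝ E]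
    [CompleteSpace E] {f : ℝ → E} (hf : IntervalIntegrable f volume 0 (2 * π)) :
    ∀ᵐ x ∂(volume.restrict (Set.Ioo 0 (2 * π))),
      Tendsto (fun ρ : ℝ => poissonInt f (circleMap 0 ρ x)) (𝓝[<] 1) (𝓝 (f x)) := by
  have hfi : IntegrableOn f (Set.Ioc 0 (2 * π)) :=
    (intervalIntegrable_iff_integrableOn_Ioc_of_le (by positivity)).1 hf
  -- Extension by zero makes `f` integrable on the line, where Lebesgue differentiation applies;
  -- only small intervals around interior points matter afterwards.
  set g : ℝ → E := (Set.Ioc 0 (2 * π)).indicator f with hg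
  have hgi : Integrable g := (integrable_indicator_iff measurableSet_Ioc).2 hfi
  have hae := IsUnifLocDoublingMeasure.ae_tendsto_average_norm_sub (μ := (volume : Measure ℝ))
    hgi.locallyIntegrable 1
  rw [ae_restrict_iff' measurableSet_Ioo]
  filter_upwards [hae] with x hx hxm
  have hx2 := hx (l := 𝓝[>] (0:ℝ)) (fun _ => x) id tendsto_id
    (by filter_upwards [self_mem_nhdsWithin] with r hr
        simpa using (le_of_lt hr))
  apply tendsto_poissonInt_of_lebesguePoint hf hxm
  intro ε hε
  obtain ⟨r, hr, hr'⟩ := Metric.nhds_basis_closedBall.mem_iff.1 (isOpen_Ioo.mem_nhds hxm)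
  obtain ⟨e, he0, he⟩ : ∃ e : ℝ, 0 < e ∧ ENNReal.ofReal (2 * e) ≤ ε := by
    rcases eq_or_ne ε ⊤ with h | h
    · exact ⟨1, one_pos, by simp [h]⟩
    · refine ⟨ε.toReal / 2, by have := ENNReal.toReal_pos hε.ne' h; positivity, ?_⟩
      rw [mul_div_cancel₀ _ two_ne_zero, ENNReal.ofReal_toReal h]
  have hev := hx2.eventually_lt_const he0
  rw [eventually_iff, mem_nhdsGT_iff_exists_Ioo_subset] at hev
  obtain ⟨d, hd, hdsub⟩ := hev
  refine ⟨min r (d / 2), by have : 0 < d := hd; positivity, fun u hu hule => ?_⟩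
  have hud : u < d := by
    have : 0 < d := hd
    have := hule.trans (min_le_right _ _); linarith
  have h3 := hdsub ⟨hu, hud⟩
  simp only [Set.mem_ofPred_eq, id] at h3
  have hsubI : closedBall x u ⊆ Set.Ioc 0 (2 * π) :=
    (closedBall_subset_closedBall (hule.trans (min_le_left _ _))).trans
      (hr'.trans Set.Ioo_subset_Ioc_self)
  have hgx : g x = f x := Set.indicator_of_mem (Set.Ioo_subset_Ioc_self hxm) _
  have hint : IntegrableOn (fun y => ‖g y - g x‖) (closedBall x u) :=
    (hgi.integrableOn.sub
      (continuousOn_const.integrableOn_compact (isCompact_closedBall x u))).norm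
  rw [setAverage_eq, smul_eq_mul, measureReal_def, Real.volume_closedBall,
    ENNReal.toReal_ofReal (by positivity), inv_mul_lt_iff₀ (by positivity)] at h3
  calc ∫⁻ s in closedBall x u, ‖f s - f x‖ₑ = ∫⁻ s in closedBall x u, ‖g s - g x‖ₑ := by
        refine setLIntegral_congr_fun measurableSet_closedBall fun s hs => ?_
        rw [hgx]; simp only [hg, Set.indicator_of_mem (hsubI hs)]
    _ = ENNReal.ofReal (∫ s in closedBall x u, ‖g s - g x‖) := by
        rw [ofReal_integral_eq_lintegral_ofReal hint (ae_of_all _ fun _ => norm_nonneg _)]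
        simp
    _ ≤ ENNReal.ofReal (2 * e * u) := by
        apply ENNReal.ofReal_le_ofReal; linarith
    _ = ENNReal.ofReal (2 * e) * ENNReal.ofReal u := ENNReal.ofReal_mul (by positivity)
    _ ≤ _ := by gcongr

lemma poissonInt_eq_circleAverage {E : Type*} [NormedAddCommGroup E] [NormedSpace ℝ E]
    (f : ℂ → E) (w : ℂ) :
    poissonInt (fun θ => f (circleMap 0 1 θ)) w = circleAverage (poissonKernel 0 w • f) 0 1 := by
  simp [poissonInt, circleAverage_def]

lemma norm_poissonInt_le {E : Type*} [NormedAddCommGroup E] [NormedSpace ℝ E]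
    (f : ℝ → E) {w : ℂ} (hw : ‖w‖ < 1) :
    ‖poissonInt f w‖ ≤ poissonInt (fun θ => ‖f θ‖) w := by
  rw [poissonInt, poissonInt, norm_smul, Real.norm_of_nonneg (by positivity), smul_eq_mul]
  gcongr
  refine (intervalIntegral.norm_integral_le_integral_norm (by positivity)).trans_eq ?_
  congr 1; ext θ
  rw [norm_smul, Real.norm_of_nonneg (poissonKernel_nonneg (by simpa using hw.le)), smul_eq_mul]

lemma poissonInt_mono {f g : ℝ → ℝ} (hf : IntervalIntegrable f volume 0 (2 * π))
    (hg : IntervalIntegrable g volume 0 (2 * π)) {w : ℂ} (hw : ‖w‖ < 1) (h : ∀ θ, f θ ≤ g θ) :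
    poissonInt f w ≤ poissonInt g w := by
  have hc := continuous_poissonKernel_circleMap hw
  simp only [poissonInt, smul_eq_mul]
  gcongr
  refine intervalIntegral.integral_mono (by positivity) (hf.continuousOn_mul hc.continuousOn)
    (hg.continuousOn_mul hc.continuousOn) fun θ => ?_
  exact mul_le_mul_of_nonneg_left (h θ) (poissonKernel_nonneg (by simpa using hw.le))

lemma intervalIntegrable_of_bounded {E : Type*} [NormedAddCommGroup E] {f : ℝ → E} {a b M : ℝ}
    (hf : AEStronglyMeasurable f volume) (hM : ∀ θ, ‖f θ‖ ≤ M) :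
    IntervalIntegrable f volume a b := by
  rw [intervalIntegrable_iff]
  exact IntegrableOn.of_bound (by simp) hf.restrict M (ae_of_all _ hM)

lemma norm_poissonInt_le_of_le {E : Type*} [NormedAddCommGroup E] [NormedSpace ℝ E]
    {f : ℝ → E} (hf : AEStronglyMeasurable f volume) {M : ℝ} (hM : ∀ θ, ‖f θ‖ ≤ M)
    {w : ℂ} (hw : ‖w‖ < 1) : ‖poissonInt f w‖ ≤ M := by
  refine (norm_poissonInt_le f hw).trans ?_
  conv_rhs => rw [← poissonInt_const M hw]
  exact poissonInt_mono (intervalIntegrable_of_bounded hf.norm (by simpa using hM)) (by simp) hw hM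

/-! ### Sawtooth regions, harmonic measure and the local Fatou theorem in the disc. -/

lemma infDist_sphere_zero {K : Set ℂ} (hne : K.Nonempty) (hKs : K ⊆ sphere 0 1) :
    infDist 0 K = 1 := by
  obtain ⟨ζ, hζ⟩ := hne
  refine le_antisymm ?_ ?_
  · refine (infDist_le_dist_of_mem hζ).trans_eq ?_
    simpa [dist_comm] using hKs hζ
  · rw [le_infDist ⟨ζ, hζ⟩]
    intro y hy
    have := hKs hy
    rw [mem_sphere, dist_comm] at this
    exact this.ge

/-- On the lateral boundary of the sawtooth region over `K`, the harmonic measure of the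
complement of `K` is bounded below. -/
lemma le_poissonInt_indicator_compl {K : Set ℂ} (hK : IsClosed K) {α : ℝ}
    (hα : 1 < α) {w : ℂ} (hw : ‖w‖ < 1) (hd : α * (1 - ‖w‖) ≤ infDist w K) :
    (2 * π)⁻¹ * (min (α - 1) π / α ^ 2) ≤
      poissonInt (fun θ => Kᶜ.indicator (fun _ => (1 : ℝ)) (circleMap 0 1 θ)) w := by
  set t := 1 - ‖w‖ with ht
  have ht0 : 0 < t := by linarith
  have ht1 : t ≤ 1 := by linarith [norm_nonneg w]
  set F : ℝ → ℝ := fun θ => poissonKernel 0 w (circleMap 0 1 θ) •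
    Kᶜ.indicator (fun _ => (1 : ℝ)) (circleMap 0 1 θ) with hF
  have hper : Function.Periodic F (2 * π) := by
    intro θ; simp only [hF, periodic_circleMap 0 1 θ]
  have hF0 : ∀ θ, 0 ≤ F θ := fun θ => by
    refine mul_nonneg (poissonKernel_nonneg (by simpa using hw.le)) ?_
    exact Set.indicator_nonneg (fun _ _ => zero_le_one) _
  have hFi : ∀ a b, IntervalIntegrable F volume a b := fun a b => by
    refine IntervalIntegrable.continuousOn_smul ?_ (continuous_poissonKernel_circleMap hw).continuousOn
    refine intervalIntegrable_of_bounded (M := 1) ?_ fun θ => ?_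
    · exact ((measurable_const.indicator hK.measurableSet.compl).comp
        (by fun_prop : Measurable (circleMap 0 1))).aestronglyMeasurable
    · by_cases h : circleMap 0 1 θ ∈ Kᶜ
      · simp [h]
      · simp [h]
  set φ := Complex.arg w
  have hwφ : w = circleMap 0 ‖w‖ φ := by
    simp [circleMap, φ]
  -- The radial projection of `w` is at distance `t` from `w`, so an arc of length `(α - 1) * t`
  -- starting there stays within `α * t` of `w` and misses `K`. The cap `π` keeps it inside one
  -- period.
  set η := min ((α - 1) * t) π with hη
  have hη0 : 0 < η := lt_min (by nlinarith) pi_pos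
  have hη2 : η ≤ 2 * π := (min_le_right _ _).trans (by linarith [pi_pos])
  have hlow : ∀ θ ∈ Set.Ioo φ (φ + η), (α ^ 2 * t)⁻¹ ≤ F θ := by
    intro θ hθ
    have hdist : ‖circleMap 0 1 θ - w‖ < α * t := by
      have h1 : ‖circleMap 0 1 θ - circleMap 0 1 φ‖ ≤ |θ - φ| := by
        rw [← Real.dist_eq, ← dist_eq_norm]
        simpa using (lipschitzWith_circleMap 0 1).dist_le_mul θ φ
      have h2 : ‖circleMap 0 1 φ - w‖ ≤ t := by
        conv_lhs => rw [hwφ]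
        have : circleMap 0 1 φ - circleMap 0 ‖w‖ φ = ((1 - ‖w‖ : ℝ) : ℂ) * circleMap 0 1 φ := by
          simp [circleMap]; ring
        rw [this, norm_mul, norm_circleMap_zero, Complex.norm_real, ← ht, Real.norm_of_nonneg ht0.le]
        simp
      have h3 : |θ - φ| < (α - 1) * t := by
        rw [abs_of_pos (by linarith [hθ.1])]
        linarith [hθ.2, min_le_left ((α - 1) * t) π]
      calc _ = ‖(circleMap 0 1 θ - circleMap 0 1 φ) + (circleMap 0 1 φ - w)‖ := by ring_nf
        _ ≤ _ := norm_add_le _ _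
        _ < _ := by linarith
    have hnot : circleMap 0 1 θ ∈ Kᶜ := fun hmem => by
      have := (infDist_le_dist_of_mem (x := w) hmem).trans_lt
        (by rwa [dist_comm, dist_eq_norm])
      linarith
    simp only [hF, Set.indicator_of_mem hnot, smul_eq_mul, mul_one]
    rw [poissonKernel_def]
    simp only [sub_zero, norm_circleMap_zero, abs_one, one_pow]
    have hpos : 0 < ‖circleMap 0 1 θ - w‖ :=
      norm_pos_iff.2 (sub_ne_zero.2 (circleMap_ne_mem_ball (by simpa using hw) θ))
    rw [le_div_iff₀ (by positivity), inv_mul_le_iff₀ (by positivity)]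
    have h1 : ‖circleMap 0 1 θ - w‖ ^ 2 ≤ (α * t) ^ 2 := by gcongr
    have h2 : t ≤ 1 - ‖w‖ ^ 2 := by nlinarith [norm_nonneg w]
    have h3 : 0 ≤ α ^ 2 * t := by positivity
    nlinarith [mul_le_mul_of_nonneg_left h2 h3]
  rw [poissonInt, smul_eq_mul]
  gcongr
  calc min (α - 1) π / α ^ 2 ≤ η * (α ^ 2 * t)⁻¹ := by
        have h5 : η * (α ^ 2 * t)⁻¹ = η / t / α ^ 2 := by
          rw [mul_inv, div_div, div_eq_mul_inv, mul_comm t, mul_inv]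
        rw [h5]
        gcongr
        rw [le_div_iff₀ ht0, hη]
        have h4 : 0 ≤ min (α - 1) π := le_min (by linarith) pi_pos.le
        refine le_min ?_ ?_
        · exact mul_le_mul_of_nonneg_right (min_le_left _ _) ht0.le
        · exact (mul_le_of_le_one_right h4 ht1).trans (min_le_right _ _)
    _ = ∫ θ in φ..φ + η, (α ^ 2 * t)⁻¹ := by
        rw [intervalIntegral.integral_const, add_sub_cancel_left, smul_eq_mul]
    _ ≤ ∫ θ in φ..φ + η, F θ :=
        intervalIntegral.integral_mono_on_of_le_Ioo (by linarith) (by simp) (hFi _ _) hlow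
    _ ≤ ∫ θ in φ..φ + 2 * π, F θ := by
        refine intervalIntegral.integral_mono_interval le_rfl (by linarith) (by linarith)
          (ae_of_all _ hF0) (hFi _ _)
    _ = ∫ θ in 0..2 * π, F θ := by
        rw [hper.intervalIntegral_add_eq φ 0, zero_add]

/-- Bounded sequences in a Hilbert space have weak limits along ultrafilters. -/
lemma exists_weak_limit {H : Type*} [NormedAddCommGroup H] [InnerProductSpace ℂ H]
    [CompleteSpace H] (u : ℕ → H) {R : ℝ} (hu : ∀ n, ‖u n‖ ≤ R) (𝒰 : Ultrafilter ℕ) :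
    ∃ φ : H, ∀ h : H, Tendsto (fun n => inner ℂ h (u n)) 𝒰 (𝓝 (inner ℂ h φ)) := by
  -- Banach–Alaoglu for the functionals that represent `u n`; an ultrafilter makes passing to a
  -- subsequence unnecessary.
  let T : ℕ → WeakDual ℂ H := fun n => StrongDual.toWeakDual (InnerProductSpace.toDual ℂ H (u n))
  have hmem : ∀ n, T n ∈ WeakDual.toStrongDual ⁻¹' closedBall (0 : StrongDual ℂ H) R := by
    intro n
    simp only [Set.mem_preimage, mem_closedBall, dist_zero_right]
    change ‖InnerProductSpace.toDual ℂ H (u n)‖ ≤ R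
    rw [LinearIsometryEquiv.norm_map]; exact hu n
  have hcomp := WeakDual.isCompact_closedBall (0 : StrongDual ℂ H) R
  obtain ⟨Λ, -, hΛ⟩ := hcomp.ultrafilter_le_nhds (𝒰.map T)
    (by
    rw [le_principal_iff]
    exact Ultrafilter.mem_map.2 (Filter.univ_mem' hmem))
  refine ⟨(InnerProductSpace.toDual ℂ H).symm (WeakDual.toStrongDual Λ), fun h => ?_⟩
  have h1 : Tendsto (fun n => T n h) 𝒰 (𝓝 (Λ h)) :=
    ((WeakDual.eval_continuous h).tendsto Λ).comp hΛ
  have h2 := (Complex.continuous_conj.tendsto _).comp h1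
  refine (h2.congr fun n => ?_).trans_eq ?_
  · simp only [Function.comp]
    rw [← inner_conj_symm]; rfl
  · congr 1
    rw [← inner_conj_symm, InnerProductSpace.toDual_symm_apply]; rfl

/-- Near the part of the circle where `φ` agrees with the boundary values of `h`, the Poisson
integral of `φ` is close to `h`. -/
lemma norm_sub_poissonInt_le_of_eqOn {h : ℂ → ℂ} (hh : DiffContOnCl ℂ h (ball 0 1)) {φ : ℂ → ℂ}
    (hφ : Measurable φ) {K : Set ℂ} {B η : ℝ} (hη : 0 < η)
    (hB : ∀ ζ ∈ sphere (0 : ℂ) 1, ‖h ζ - φ ζ‖ ≤ B) (hφB : ∀ ζ, ‖φ ζ‖ ≤ B)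
    (heq : ∀ ζ ∈ sphere (0 : ℂ) 1, infDist ζ K < η → φ ζ = h ζ) {w : ℂ} (hw : ‖w‖ < 1)
    (hwK : infDist w K ≤ η / 2) :
    ‖h w - poissonInt (fun θ => φ (circleMap 0 1 θ)) w‖ ≤ (1 - ‖w‖ ^ 2) / (η / 2) ^ 2 * B := by
  have hcirc : ∀ θ, circleMap 0 1 θ ∈ sphere (0 : ℂ) 1 := fun θ => by simp
  have hhi : IntervalIntegrable (fun θ => h (circleMap 0 1 θ)) volume 0 (2 * π) := by
    have hc : ContinuousOn h (closedBall 0 1) := by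
      rw [← closure_ball (0 : ℂ) one_ne_zero]; exact hh.2
    exact (hc.comp_continuous (continuous_circleMap 0 1)
      fun θ => sphere_subset_closedBall (hcirc θ)).intervalIntegrable _ _
  have hφi : IntervalIntegrable (fun θ => φ (circleMap 0 1 θ)) volume 0 (2 * π) :=
    intervalIntegrable_of_bounded
      (hφ.comp (by fun_prop : Measurable (circleMap 0 1))).aestronglyMeasurable fun θ => hφB _
  have hrep : h w = poissonInt (fun θ => h (circleMap 0 1 θ)) w := by
    rw [poissonInt_eq_circleAverage]
    exact (hh.circleAverage_poissonKernel_smul (by simpa using hw)).symm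
  rw [hrep, ← poissonInt_sub hhi hφi hw, poissonInt, norm_smul, Real.norm_of_nonneg (by positivity)]
  have hB0 : 0 ≤ B := (norm_nonneg _).trans (hφB 0)
  have hnum : 0 ≤ 1 - ‖w‖ ^ 2 := by nlinarith [norm_nonneg w]
  have hbound : ∀ θ ∈ Set.uIoc 0 (2 * π), ‖poissonKernel 0 w (circleMap 0 1 θ) •
      (h (circleMap 0 1 θ) - φ (circleMap 0 1 θ))‖ ≤ (1 - ‖w‖ ^ 2) / (η / 2) ^ 2 * B := by
    intro θ _
    by_cases hd : infDist (circleMap 0 1 θ) K < η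
    · rw [heq _ (hcirc θ) hd]
      simp only [sub_self, smul_zero, norm_zero]
      positivity
    -- Here the boundary point is at distance at least `η` from `K` and `w` at most `η / 2`, so they
    -- are at least `η / 2` apart.
    · rw [norm_smul]
      gcongr
      · rw [Real.norm_of_nonneg (poissonKernel_nonneg (by simpa using hw.le)), poissonKernel_def]
        simp only [sub_zero, norm_circleMap_zero, abs_one, one_pow]
        gcongr
        have := infDist_le_infDist_add_dist (s := K) (x := circleMap 0 1 θ) (y := w)
        rw [dist_eq_norm] at this
        linarith
      · exact hB _ (hcirc θ)
  have := intervalIntegral.norm_integral_le_of_norm_le_const hbound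
  rw [sub_zero, abs_of_pos (by positivity)] at this
  rw [inv_mul_le_iff₀ (by positivity)]
  linarith

/-- **Calderón–Stein comparison**: on the sawtooth region over `K`, a bounded holomorphic function
differs from the Poisson integral of its (truncated) boundary values by at most a multiple of the
harmonic measure of the complement of `K`. -/
lemma norm_sub_poissonInt_le {K : Set ℂ} (hK : IsClosed K) (hne : K.Nonempty)
    (hKs : K ⊆ sphere 0 1) {α M η : ℝ} (hα : 1 < α) (hη : 0 < η) {h : ℂ → ℂ}
    (hh : DiffContOnCl ℂ h (ball 0 1)) {φ : ℂ → ℂ} (hφ : Measurable φ) (hφM : ∀ ζ, ‖φ ζ‖ ≤ M)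
    (heq : ∀ ζ ∈ sphere (0 : ℂ) 1, infDist ζ K < η → φ ζ = h ζ)
    (hM : ∀ w : ℂ, w ≠ 0 → ‖w‖ < 1 → infDist w K ≤ α * (1 - ‖w‖) → ‖h w‖ ≤ M)
    {w : ℂ} (hw : ‖w‖ < 1) (hwK : infDist w K < α * (1 - ‖w‖)) :
    ‖h w - poissonInt (fun θ => φ (circleMap 0 1 θ)) w‖ ≤
      2 * M / ((2 * π)⁻¹ * (min (α - 1) π / α ^ 2)) *
        poissonInt (fun θ => Kᶜ.indicator (fun _ => (1 : ℝ)) (circleMap 0 1 θ)) w := by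
  have hM0 : 0 ≤ M := (norm_nonneg _).trans (hφM 0)
  have hα0 : 0 < min (α - 1) π := lt_min (by linarith) pi_pos
  set c := (2 * π)⁻¹ * (min (α - 1) π / α ^ 2) with hc
  have hc0 : 0 < c := by positivity
  set C := 2 * M / c with hC
  have hC0 : 0 ≤ C := by positivity
  set χ : ℂ → ℝ := Kᶜ.indicator (fun _ => (1 : ℝ)) with hχ
  have hχm : Measurable χ := measurable_const.indicator hK.measurableSet.compl
  have hχ0 : ∀ ζ, 0 ≤ χ ζ := fun ζ => Set.indicator_nonneg (fun _ _ => zero_le_one) _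
  have hχ1 : ∀ ζ, ‖χ ζ‖ ≤ 1 := fun ζ => by
    by_cases h : ζ ∈ Kᶜ
    · simp [hχ, h]
    · simp [hχ, h]
  have hcm : Measurable (circleMap 0 1) := by fun_prop
  -- rotate so that the difference is real
  obtain ⟨ω, hω, hωr⟩ : ∃ ω : ℂ, ‖ω‖ = 1 ∧
      (ω * (h w - poissonInt (fun θ => φ (circleMap 0 1 θ)) w)).re =
        ‖h w - poissonInt (fun θ => φ (circleMap 0 1 θ)) w‖ := by
    generalize h w - poissonInt (fun θ => φ (circleMap 0 1 θ)) w = z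
    rcases eq_or_ne z 0 with rfl | hz
    · exact ⟨1, by simp, by simp⟩
    · refine ⟨(starRingEnd ℂ) z / ‖z‖, ?_, ?_⟩
      · rw [norm_div, RCLike.norm_conj, Complex.norm_real, norm_norm,
          div_self (norm_ne_zero_iff.2 hz)]
      · rw [div_mul_eq_mul_div, Complex.conj_mul', ← Complex.ofReal_pow, ← Complex.ofReal_div,
          Complex.ofReal_re, pow_two, mul_div_assoc, div_self (norm_ne_zero_iff.2 hz), mul_one]
  rw [← hωr]
  set ψ : ℂ → ℝ := fun ζ => (ω * φ ζ).re + C * χ ζ with hψ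
  have hψm : Measurable ψ := (Complex.measurable_re.comp (hφ.const_mul ω)).add (hχm.const_mul C)
  have hψb : ∀ ζ, ‖ψ ζ‖ ≤ M + C := fun ζ => by
    refine (norm_add_le _ _).trans (add_le_add ?_ ?_)
    · refine (Complex.abs_re_le_norm _).trans ?_
      rw [norm_mul, hω, one_mul]; exact hφM ζ
    · rw [norm_mul, Real.norm_of_nonneg hC0]
      exact mul_le_of_le_one_right hC0 (hχ1 ζ)
  have hψci : CircleIntegrable ψ 0 1 :=
    intervalIntegrable_of_bounded (hψm.comp hcm).aestronglyMeasurable fun θ => hψb _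
  have hψci' : CircleIntegrable (fun ζ => (ψ ζ : ℂ)) 0 1 :=
    intervalIntegrable_of_bounded
      ((Complex.measurable_ofReal.comp (hψm.comp hcm)).aestronglyMeasurable) (M := M + C)
      fun θ => by rw [Complex.norm_real]; exact hψb _
  -- `G` is holomorphic, and its real part is the harmonic function that has to be shown
  -- nonpositive. The maximum modulus principle for `exp G` then serves as the maximum principle for
  -- `re G`.
  set G : ℂ → ℂ := fun z => ω * h z -
    circleAverage (fun ζ => herglotzRieszKernel 0 z ζ • (ψ ζ : ℂ)) 0 1 with hG
  have hGd : DifferentiableOn ℂ G (ball 0 1) :=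
    (hh.1.const_mul ω).sub (differentiableOn_circleAverage_herglotzRieszKernel_smul hψci')
  have hφi : IntervalIntegrable (fun θ => φ (circleMap 0 1 θ)) volume 0 (2 * π) :=
    intervalIntegrable_of_bounded (hφ.comp hcm).aestronglyMeasurable fun θ => hφM _
  have hχi : IntervalIntegrable (fun θ => χ (circleMap 0 1 θ)) volume 0 (2 * π) :=
    intervalIntegrable_of_bounded (hχm.comp hcm).aestronglyMeasurable fun θ => hχ1 _
  have hGre : ∀ z : ℂ, ‖z‖ < 1 → (G z).re =
      (ω * (h z - poissonInt (fun θ => φ (circleMap 0 1 θ)) z)).re -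
        C * poissonInt (fun θ => χ (circleMap 0 1 θ)) z := by
    intro z hz
    have hpk := continuous_poissonKernel_circleMap hz
    have h1 : poissonInt (fun θ => ψ (circleMap 0 1 θ)) z =
        (ω * poissonInt (fun θ => φ (circleMap 0 1 θ)) z).re +
          C * poissonInt (fun θ => χ (circleMap 0 1 θ)) z := by
      have h2 : IntervalIntegrable (fun θ => poissonKernel 0 z (circleMap 0 1 θ) •
          φ (circleMap 0 1 θ)) volume 0 (2 * π) := hφi.continuousOn_smul hpk.continuousOn
      have h3 : IntervalIntegrable (fun θ => poissonKernel 0 z (circleMap 0 1 θ) •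
          χ (circleMap 0 1 θ)) volume 0 (2 * π) := hχi.continuousOn_smul hpk.continuousOn
      let L : ℂ →L[ℝ] ℝ := Complex.reCLM ∘L
        ((ContinuousLinearMap.mul ℂ ℂ ω).restrictScalars ℝ)
      have hL : ∀ x, L x = (ω * x).re := fun x => rfl
      have h4 : (ω * poissonInt (fun θ => φ (circleMap 0 1 θ)) z).re =
          (2 * π)⁻¹ * ∫ θ in 0..2 * π, L (poissonKernel 0 z (circleMap 0 1 θ) •
            φ (circleMap 0 1 θ)) := by
        rw [← hL, poissonInt, map_smul, smul_eq_mul, L.intervalIntegral_comp_comm h2]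
      rw [h4]
      simp only [poissonInt]
      rw [smul_eq_mul, smul_eq_mul, mul_left_comm C, ← mul_add,
        ← intervalIntegral.integral_const_mul C, ← intervalIntegral.integral_add]
      · congr 2; ext θ
        rw [map_smul, hL]
        simp only [hψ, smul_eq_mul]; ring
      · have := L.integrable_comp (intervalIntegrable_iff.1 h2)
        exact intervalIntegrable_iff.2 this
      · exact h3.const_mul C
    rw [hG]
    simp only [Complex.sub_re]
    rw [re_circleAverage_herglotzRieszKernel_smul hψci (by simpa using hz),
      ← poissonKernel_eq_re_herglotzRieszKernel, ← poissonInt_eq_circleAverage, h1, mul_sub,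
      Complex.sub_re]
    ring
  have hχp : ∀ z : ℂ, ‖z‖ < 1 → 0 ≤ poissonInt (fun θ => χ (circleMap 0 1 θ)) z := by
    intro z hz
    rw [← poissonInt_const (0 : ℝ) hz]
    exact poissonInt_mono (by simp) hχi hz fun θ => hχ0 _
  have hωle : ∀ z : ℂ, (ω * z).re ≤ ‖z‖ := fun z => by
    refine (Complex.re_le_norm _).trans ?_
    rw [norm_mul, hω, one_mul]
  suffices hGw : (G w).re ≤ 0 by
    rw [hGre w hw] at hGw; linarith
  obtain ⟨B, hB⟩ : ∃ B, ∀ ζ ∈ closedBall (0 : ℂ) 1, ‖h ζ‖ ≤ B := by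
    have hc : ContinuousOn h (closedBall 0 1) := by
      rw [← closure_ball (0 : ℂ) one_ne_zero]; exact hh.2
    exact (isCompact_closedBall (0 : ℂ) 1).exists_bound_of_continuousOn hc
  have hB0 : 0 ≤ B := (norm_nonneg _).trans (hB 0 (by simp))
  refine le_of_forall_pos_le_add fun ε hε => ?_
  rw [zero_add]
  obtain ⟨ρ, hρ1, hwρ, hρη, hρε⟩ : ∃ ρ : ℝ, ρ < 1 ∧ ‖w‖ < ρ ∧ α * (1 - ρ) ≤ η / 2 ∧
      (1 - ρ ^ 2) / (η / 2) ^ 2 * (B + M) ≤ ε := by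
    have e1 : ∀ᶠ ρ : ℝ in 𝓝[<] 1, ‖w‖ < ρ := nhdsWithin_le_nhds (Ioi_mem_nhds hw)
    have e2 : ∀ᶠ ρ : ℝ in 𝓝[<] 1, α * (1 - ρ) ≤ η / 2 := by
      have : Tendsto (fun ρ : ℝ => α * (1 - ρ)) (𝓝[<] 1) (𝓝 (α * (1 - 1))) :=
        (Continuous.tendsto (by fun_prop) 1).mono_left nhdsWithin_le_nhds
      exact this.eventually_le_const (by simp only [sub_self, mul_zero]; positivity)
    have e3 : ∀ᶠ ρ : ℝ in 𝓝[<] 1, (1 - ρ ^ 2) / (η / 2) ^ 2 * (B + M) ≤ ε := by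
      have : Tendsto (fun ρ : ℝ => (1 - ρ ^ 2) / (η / 2) ^ 2 * (B + M)) (𝓝[<] 1)
          (𝓝 ((1 - 1 ^ 2) / (η / 2) ^ 2 * (B + M))) :=
        (Continuous.tendsto (by fun_prop) 1).mono_left nhdsWithin_le_nhds
      exact this.eventually_le_const (by simpa using hε)
    have e4 : ∀ᶠ ρ : ℝ in 𝓝[<] 1, ρ < 1 := self_mem_nhdsWithin
    obtain ⟨ρ, h1, h2, h3, h4⟩ := (e1.and (e2.and (e3.and e4))).exists
    exact ⟨ρ, h4, h1, h2, h3⟩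
  -- The sawtooth is truncated at radius `ρ`, because nothing is known about `exp G` on the unit
  -- circle itself; `ρ` tends to `1` as `ε` tends to `0`.
  set U : Set ℂ := {z | ‖z‖ < ρ ∧ infDist z K < α * (1 - ‖z‖)} with hU
  have hd1 : Continuous fun z : ℂ => α * (1 - ‖z‖) := by fun_prop
  have hUo : IsOpen U :=
    IsOpen.and (isOpen_lt continuous_norm continuous_const) (isOpen_lt (continuous_infDist_pt K) hd1)
  have hUcl : closure U ⊆ {z | ‖z‖ ≤ ρ ∧ infDist z K ≤ α * (1 - ‖z‖)} := by
    refine closure_minimal (fun z hz => ⟨hz.1.le, hz.2.le⟩) ?_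
    exact IsClosed.and (isClosed_le continuous_norm continuous_const)
      (isClosed_le (continuous_infDist_pt K) hd1)
  have hUb : Bornology.IsBounded U :=
    (isBounded_ball (x := (0 : ℂ)) (r := ρ)).subset fun z hz => by simpa using hz.1
  have hexp : DiffContOnCl ℂ (fun z => Complex.exp (G z)) U := by
    refine DifferentiableOn.diffContOnCl ?_
    refine (hGd.mono fun z hz => ?_).cexp
    have := (hUcl hz).1
    simpa using this.trans_lt hρ1
  have hfr : ∀ z ∈ frontier U, ‖Complex.exp (G z)‖ ≤ Real.exp ε := by
    intro z hz
    rw [Complex.norm_exp, Real.exp_le_exp]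
    have hzc := hUcl (frontier_subset_closure hz)
    have hz1 : ‖z‖ < 1 := hzc.1.trans_lt hρ1
    have hzn : z ∉ U := by
      have := hz.2; rwa [hUo.interior_eq] at this
    rw [hGre z hz1]
    have hPI := hχp z hz1
    -- On the lateral boundary both `h` and the Poisson integral are at most `M`, and `C` times the
    -- harmonic measure is at least `2 * M`. On the top `‖z‖ = ρ`, the boundary values of `h` and
    -- `φ` agree nearby, so the difference is at most `ε`.
    rcases lt_or_eq_of_le hzc.1 with hlt | heqρ
    · have hge : α * (1 - ‖z‖) ≤ infDist z K := by
        by_contra hcon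
        exact hzn ⟨hlt, not_le.1 hcon⟩
      -- `hM` excludes the origin: for a dilate of `g` its closed inequality becomes the strict one
      -- defining the sawtooth only when the point is moved. The origin is not on the lateral
      -- boundary, as its distance to `K` is `1 < α`.
      have hz0 : z ≠ 0 := by
        rintro rfl
        rw [infDist_sphere_zero hne hKs] at hge
        simp at hge; linarith
      have hl := le_poissonInt_indicator_compl hK hα hz1 hge
      have h1 := hωle (h z - poissonInt (fun θ => φ (circleMap 0 1 θ)) z)
      have h2 : ‖h z - poissonInt (fun θ => φ (circleMap 0 1 θ)) z‖ ≤ M + M :=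
        (norm_sub_le _ _).trans (add_le_add (hM z hz0 hz1 hzc.2)
          (norm_poissonInt_le_of_le (hφ.comp hcm).aestronglyMeasurable (fun θ => hφM _) hz1))
      have h3 : 2 * M ≤ C * poissonInt (fun θ => χ (circleMap 0 1 θ)) z := by
        calc 2 * M = C * c := by rw [hC]; field_simp
          _ ≤ _ := by gcongr
      linarith
    · have h1 := hωle (h z - poissonInt (fun θ => φ (circleMap 0 1 θ)) z)
      have h2 := norm_sub_poissonInt_le_of_eqOn hh hφ hη (B := B + M) (K := K) (fun ζ hζ =>
          (norm_sub_le _ _).trans (add_le_add (hB ζ (sphere_subset_closedBall hζ)) (hφM ζ)))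
        (fun ζ => (hφM ζ).trans (by linarith)) heq hz1
        (hzc.2.trans (by rw [heqρ]; exact hρη))
      rw [heqρ] at h2
      have h3 := mul_nonneg hC0 hPI
      linarith
  have := Complex.norm_le_of_forall_mem_frontier_norm_le hUb hexp hfr
    (subset_closure (⟨hwρ, hwK⟩ : w ∈ U))
  rwa [Complex.norm_exp, Real.exp_le_exp] at this

/-- **Local Fatou theorem** in the disc: a holomorphic function that is bounded on the union of the
Stolz regions over a closed subset `K` of the circle has radial limits almost everywhere on `K`. -/
theorem ae_exists_radialLimit_disc {g : ℂ → ℂ} (hg : DifferentiableOn ℂ g (ball 0 1)) {K : Set ℂ}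
    (hK : IsClosed K) (hKs : K ⊆ sphere 0 1) {α M : ℝ} (hα : 1 < α)
    (hb : ∀ ζ ∈ K, ∀ z : ℂ, ‖z‖ < 1 → ‖z - ζ‖ < α * (1 - ‖z‖) → ‖g z‖ ≤ M) :
    ∀ᵐ θ ∂(volume.restrict (Set.Ioo 0 (2 * π))), circleMap 0 1 θ ∈ K →
      ∃ l, Tendsto (fun ρ : ℝ => g (circleMap 0 ρ θ)) (𝓝[<] 1) (𝓝 l) := by
  rcases K.eq_empty_or_nonempty with rfl | hne
  · exact ae_of_all _ fun θ h => h.elim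
  have hbΩ : ∀ z : ℂ, ‖z‖ < 1 → infDist z K < α * (1 - ‖z‖) → ‖g z‖ ≤ M := by
    intro z hz h
    obtain ⟨ζ, hζ, hd⟩ := (infDist_lt_iff hne).1 h
    exact hb ζ hζ z hz (by rwa [← dist_eq_norm])
  have hM0 : 0 ≤ M := (norm_nonneg _).trans (hbΩ 0 (by simp) (by
    rw [infDist_sphere_zero hne hKs]; simpa using hα))
  set r : ℕ → ℝ := fun n => 1 - 1 / ((n : ℝ) + 2) with hr
  have hr0 : ∀ n, 0 < r n := fun n => by
    have : 1 / ((n : ℝ) + 2) < 1 := by rw [div_lt_one (by positivity)]; linarith [n.cast_nonneg (α := ℝ)]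
    simp only [hr]; linarith
  have hr1 : ∀ n, r n < 1 := fun n => by
    have : 0 < 1 / ((n : ℝ) + 2) := by positivity
    simp only [hr]; linarith
  have hrlim : Tendsto r atTop (𝓝 1) := by
    have h1 : Tendsto (fun n : ℕ => (n : ℝ) + 2) atTop atTop :=
      tendsto_atTop_add_const_right _ _ tendsto_natCast_atTop_atTop
    simpa [hr] using (h1.inv_tendsto_atTop).const_sub 1
  have hinf : ∀ (n : ℕ) (z : ℂ), infDist (r n * z) K ≤ infDist z K + (1 - r n) * ‖z‖ := by
    intro n z
    refine (infDist_le_infDist_add_dist (y := z)).trans_eq ?_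
    have : (r n : ℂ) * z - z = ((r n - 1 : ℝ) : ℂ) * z := by push_cast; ring
    rw [dist_eq_norm, this, norm_mul, Complex.norm_real, Real.norm_eq_abs,
      abs_of_neg (by linarith [hr1 n])]
    ring
  have hnr : ∀ (n : ℕ) (z : ℂ), ‖(r n : ℂ) * z‖ = r n * ‖z‖ := fun n z => by
    rw [norm_mul, Complex.norm_real, Real.norm_of_nonneg (hr0 n).le]
  set h : ℕ → ℂ → ℂ := fun n z => g (r n * z) with hh
  have hmaps : ∀ n, Set.MapsTo (fun z : ℂ => (r n : ℂ) * z) (closedBall 0 1) (ball 0 1) := by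
    intro n z hz
    rw [mem_closedBall_zero_iff] at hz
    rw [mem_ball_zero_iff, hnr]
    nlinarith [hr0 n, hr1 n, norm_nonneg z]
  have hhd : ∀ n, DifferentiableOn ℂ (h n) (closedBall 0 1) := fun n =>
    hg.comp (by fun_prop) (hmaps n)
  -- Shrinking by `r n` adds at most `1 - r n` to the distance from `K`, so the threshold `(α - 1) *
  -- (1 - r n)` is what places `r n * ζ` in the sawtooth, where `g` is bounded by `M`.
  set S : ℕ → Set ℂ := fun n => sphere 0 1 ∩ {ζ | infDist ζ K < (α - 1) * (1 - r n)} with hS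
  have hSm : ∀ n, MeasurableSet (S n) := fun n => isClosed_sphere.measurableSet.inter
    (isOpen_lt (continuous_infDist_pt K) continuous_const).measurableSet
  set φ : ℕ → ℂ → ℂ := fun n => (S n).indicator (h n) with hφ
  have hφm : ∀ n, Measurable (φ n) := by
    intro n
    classical
    have : φ n = (S n).piecewise (h n) (fun _ => 0) := by
      ext z; simp [hφ, Set.indicator, Set.piecewise]
    rw [this]
    refine ContinuousOn.measurable_piecewise ?_ continuousOn_const (hSm n)
    exact (hhd n).continuousOn.mono fun z hz => sphere_subset_closedBall hz.1
  have hφM : ∀ n ζ, ‖φ n ζ‖ ≤ M := by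
    intro n ζ
    by_cases hζ : ζ ∈ S n
    · simp only [hφ, Set.indicator_of_mem hζ, hh]
      have hζ1 : ‖ζ‖ = 1 := by simpa using hζ.1
      refine hbΩ _ (by rw [hnr, hζ1, mul_one]; exact hr1 n) ?_
      have h1 := hinf n ζ
      have h2 : infDist ζ K < (α - 1) * (1 - r n) := hζ.2
      rw [hnr, hζ1]
      rw [hζ1] at h1
      linarith
    · simp only [hφ, Set.indicator_of_notMem hζ, norm_zero]; exact hM0
  set χ : ℝ → ℝ := fun θ => Kᶜ.indicator (fun _ => (1 : ℝ)) (circleMap 0 1 θ) with hχ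
  set C := 2 * M / ((2 * π)⁻¹ * (min (α - 1) π / α ^ 2)) with hC
  have hcomp : ∀ n w, ‖w‖ < 1 → infDist w K < α * (1 - ‖w‖) →
      ‖h n w - poissonInt (fun θ => φ n (circleMap 0 1 θ)) w‖ ≤ C * poissonInt χ w := by
    intro n w hw hwK
    refine norm_sub_poissonInt_le hK hne hKs hα
      (mul_pos (by linarith) (by linarith [hr1 n]) : 0 < (α - 1) * (1 - r n)) ?_ (hφm n) (hφM n)
      (fun ζ hζ hd => Set.indicator_of_mem (s := S n) ⟨hζ, hd⟩ _) ?_ hw hwK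
    · exact DifferentiableOn.diffContOnCl (by rw [closure_ball _ one_ne_zero]; exact hhd n)
    · intro z hz0 hz1 hzK
      have hzpos := norm_pos_iff.2 hz0
      refine hbΩ _ (by rw [hnr]; nlinarith [hr0 n, hr1 n]) ?_
      have h1 := hinf n z
      rw [hnr]
      nlinarith [mul_pos (mul_pos (by linarith : 0 < α - 1) (by linarith [hr1 n] : 0 < 1 - r n))
        hzpos]
  -- weak limit of the truncated boundary values
  set μ := volume.restrict (Set.Ioc 0 (2 * π)) with hμ
  have hcm : Measurable (circleMap 0 1) := by fun_prop
  have hmem : ∀ n, MemLp (fun θ => φ n (circleMap 0 1 θ)) 2 μ := fun n =>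
    MemLp.of_bound ((hφm n).comp hcm).aestronglyMeasurable M (ae_of_all _ fun θ => hφM n _)
  obtain ⟨φ', hφ'⟩ := exists_weak_limit (fun n => (hmem n).toLp)
    (R := (μ Set.univ).toReal ^ (2 : ENNReal).toReal⁻¹ * M)
    (fun n => Lp.norm_le_of_ae_bound hM0 (by
      filter_upwards [(hmem n).coeFn_toLp] with θ hθ
      rw [hθ]; exact hφM n _)) (Filter.hyperfilter ℕ)
  have hle𝒰 : (Filter.hyperfilter ℕ : Filter ℕ) ≤ atTop := by
    rw [← Nat.cofinite_eq_atTop]; exact Filter.hyperfilter_le_cofinite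
  have hφ'i : IntervalIntegrable φ' volume 0 (2 * π) := by
    rw [intervalIntegrable_iff_integrableOn_Ioc_of_le (by positivity)]
    exact (Lp.memLp φ').integrable (by norm_num)
  have hPIlim : ∀ w : ℂ, ‖w‖ < 1 → Tendsto
      (fun n => poissonInt (fun θ => φ n (circleMap 0 1 θ)) w) (Filter.hyperfilter ℕ)
      (𝓝 (poissonInt φ' w)) := by
    intro w hw
    have hkc := continuous_poissonKernel_circleMap hw
    have hkm : MemLp (fun θ => ((poissonKernel 0 w (circleMap 0 1 θ) : ℝ) : ℂ)) 2 μ := by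
      obtain ⟨B, hB⟩ := (isCompact_Icc (a := 0) (b := 2 * π)).exists_bound_of_continuousOn
        hkc.continuousOn
      refine MemLp.of_bound (Complex.continuous_ofReal.comp hkc).aestronglyMeasurable B ?_
      refine (ae_restrict_iff' measurableSet_Ioc).2 (ae_of_all _ fun θ hθ => ?_)
      rw [Complex.norm_real]
      exact hB θ (Set.Ioc_subset_Icc_self hθ)
    have hin : ∀ (u : ℝ → ℂ) (v : Lp ℂ 2 μ), v =ᵐ[μ] u →
        poissonInt u w = ((2 * π)⁻¹ : ℝ) • inner ℂ hkm.toLp v := by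
      intro u v huv
      rw [poissonInt, intervalIntegral.integral_of_le (by positivity), L2.inner_def]
      congr 1
      refine integral_congr_ae ?_
      filter_upwards [huv, hkm.coeFn_toLp] with θ h1 h2
      rw [h1, h2]
      simp [mul_comm]
    rw [hin φ' φ' (ae_eq_refl _)]
    refine ((hφ' hkm.toLp).const_smul ((2 * π)⁻¹ : ℝ)).congr fun n => ?_
    rw [hin _ _ (hmem n).coeFn_toLp]
  have hmain : ∀ w : ℂ, ‖w‖ < 1 → infDist w K < α * (1 - ‖w‖) →
      ‖g w - poissonInt φ' w‖ ≤ C * poissonInt χ w := by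
    intro w hw hwK
    have h1 : Tendsto (fun n => h n w) atTop (𝓝 (g w)) := by
      have hc : ContinuousAt g w :=
        (hg.differentiableAt (isOpen_ball.mem_nhds (by simpa using hw))).continuousAt
      refine hc.tendsto.comp ?_
      have : Tendsto (fun n => ((r n : ℝ) : ℂ) * w) atTop (𝓝 (((1 : ℝ) : ℂ) * w)) :=
        ((Complex.continuous_ofReal.tendsto 1).comp hrlim).mul_const w
      simpa using this
    exact le_of_tendsto ((h1.mono_left hle𝒰).sub (hPIlim w hw)).norm
      (Filter.Eventually.of_forall fun n => hcomp n w hw hwK)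
  have hχi : IntervalIntegrable χ volume 0 (2 * π) :=
    intervalIntegrable_of_bounded (M := 1)
      ((measurable_const.indicator hK.measurableSet.compl).comp hcm).aestronglyMeasurable
      fun θ => by
        by_cases h : circleMap 0 1 θ ∈ Kᶜ
        · simp [hχ, h]
        · simp [hχ, h]
  filter_upwards [ae_tendsto_poissonInt hφ'i, ae_tendsto_poissonInt hχi] with θ h1 h2 hθ
  refine ⟨φ' θ, ?_⟩
  -- At almost every point of `K` the harmonic measure of the complement tends to `0`, so `g`
  -- inherits the radial limit of the Poisson integral of `φ'`.
  have hχθ : χ θ = 0 := by simp [hχ, hθ]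
  rw [hχθ] at h2
  have h3 : Tendsto (fun ρ : ℝ => g (circleMap 0 ρ θ) - poissonInt φ' (circleMap 0 ρ θ)) (𝓝[<] 1)
      (𝓝 0) := by
    refine squeeze_zero_norm' ?_ (by simpa using h2.const_mul C)
    have hpos : ∀ᶠ ρ : ℝ in 𝓝[<] 1, 0 < ρ := nhdsWithin_le_nhds (Ioi_mem_nhds one_pos)
    filter_upwards [hpos, self_mem_nhdsWithin] with ρ hρ0 hρ1
    have hρ1 : ρ < 1 := hρ1
    have hn : ‖circleMap 0 ρ θ‖ = ρ := by rw [norm_circleMap_zero, abs_of_pos hρ0]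
    refine hmain _ (by rw [hn]; exact hρ1) ?_
    refine (infDist_le_dist_of_mem hθ).trans_lt ?_
    have : circleMap 0 ρ θ - circleMap 0 1 θ = ((ρ - 1 : ℝ) : ℂ) * circleMap 0 1 θ := by
      simp [circleMap]; ring
    rw [dist_eq_norm, this, norm_mul, Complex.norm_real, hn, norm_circleMap_zero,
      Real.norm_of_nonpos (by linarith)]
    simp only [abs_one]
    nlinarith
  simpa using h3.add h1

/-! ### Jensen's inequality and sub-mean values over balanced sets. -/

lemma log_norm_le_circleAverage {g : ℂ → ℂ} (hg : AnalyticOnNhd ℂ g (closedBall 0 1))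
    (h0 : g 0 ≠ 0) : Real.log ‖g 0‖ ≤ circleAverage (fun z => Real.log ‖g z‖) 0 1 := by
  have hg' : AnalyticOnNhd ℂ g (closedBall 0 |(1 : ℝ)|) := by simpa using hg
  rw [hg'.circleAverage_log_norm one_ne_zero h0]
  -- In Jensen's formula every zero in the closed disc contributes a nonnegative term.
  refine le_add_of_nonneg_left (finsum_nonneg fun u => ?_)
  by_cases hu : u ∈ closedBall (0 : ℂ) |(1 : ℝ)|
  · refine mul_nonneg (mod_cast MeromorphicOn.AnalyticOnNhd.divisor_nonneg hg' u) ?_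
    rcases eq_or_ne u 0 with rfl | hu0
    · simp
    · apply Real.log_nonneg
      rw [one_mul, zero_sub, norm_neg]
      refine (one_le_inv₀ (norm_pos_iff.2 hu0)).2 ?_
      simpa using hu
  · simp [Function.locallyFinsuppWithin.apply_eq_zero_of_notMem _ hu]

section Haar

variable {E : Type*} [NormedAddCommGroup E] [InnerProductSpace ℂ E] [FiniteDimensional ℂ E]
  [MeasurableSpace E] [BorelSpace E]

variable (E) in
/-- Hausdorff measure of top dimension on a complex inner product space; an isometry invariant
Haar measure. -/
noncomputable abbrev haarVol : Measure E :=
  Measure.hausdorffMeasure (Module.finrank ℝ E)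

instance : Measure.IsAddHaarMeasure (haarVol E) := isAddHaarMeasure_hausdorffMeasure

omit [FiniteDimensional ℂ E] in
lemma measurePreserving_smul_of_norm_eq_one {c : ℂ} (hc : ‖c‖ = 1) :
    MeasurePreserving (fun v : E => c • v) (haarVol E) (haarVol E) := by
  let e : E ≃ᵢ E := IsometryEquiv.mk' (fun v => c • v) (fun v => c⁻¹ • v)
    (fun v => by
      have : c ≠ 0 := by rintro rfl; simp at hc
      simp [smul_smul, this])
    (Isometry.of_dist_eq fun x y => by rw [dist_smul₀, hc, one_mul])
  exact e.measurePreserving_hausdorffMeasure _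

/-- Sub-mean value property of `log ‖G‖` over a balanced set, for a function dominated by
`exp A`, and by `exp a` outside a set `Bad`. -/
theorem norm_le_exp_of_balanced {G : E → ℂ} {x : E} {S : Set E} (hS : MeasurableSet S)
    (hbal : ∀ c : ℂ, ‖c‖ ≤ 1 → ∀ v ∈ S, c • v ∈ S)
    (hG : ∀ v ∈ S, ∃ W : Set ℂ, IsOpen W ∧ closedBall 0 1 ⊆ W ∧
      DifferentiableOn ℂ (fun c : ℂ => G (x + c • v)) W)
    (hS0 : haarVol E S ≠ 0) (hSt : haarVol E S ≠ ⊤) {Bad : Set E} (hBad : MeasurableSet Bad)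
    {a A : ℝ} (haA : a ≤ A) (hA : ∀ v ∈ S, ‖G (x + v)‖ ≤ Real.exp A)
    (ha : ∀ v ∈ S, v ∉ Bad → ‖G (x + v)‖ ≤ Real.exp a) :
    ‖G x‖ ≤ Real.exp (a + (A - a) * ((haarVol E (S ∩ Bad)).toReal / (haarVol E S).toReal)) := by
  have hSpos : 0 < (haarVol E S).toReal := ENNReal.toReal_pos hS0 hSt
  rcases eq_or_ne (G x) 0 with h0 | h0
  · rw [h0, norm_zero]; positivity
  rw [← Real.log_le_iff_le_exp (norm_pos_iff.2 h0)]
  set L := Real.log ‖G x‖ - a with hL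
  rcases le_or_gt L 0 with hL0 | hL0
  · have : 0 ≤ (A - a) * ((haarVol E (S ∩ Bad)).toReal / (haarVol E S).toReal) :=
      mul_nonneg (by linarith) (by positivity)
    linarith
  -- circle averages
  have hcirc : ∀ v ∈ S, ENNReal.ofReal L * ENNReal.ofReal (2 * π) ≤ ENNReal.ofReal (A - a) *
      ∫⁻ θ in Set.Ioc 0 (2 * π), Bad.indicator 1 (circleMap 0 1 θ • v) := by
    intro v hv
    obtain ⟨W, hWo, hWs, hWd⟩ := hG v hv
    -- After this normalization `log ‖g‖` is at most `0` off `Bad` and at most `A - a` on it, so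
    -- Jensen bounds `L` by `A - a` times the fraction of the circle spent in `Bad`.
    set g : ℂ → ℂ := fun c => (Real.exp (-a) : ℂ) * G (x + c • v) with hg
    have hga : AnalyticOnNhd ℂ g (closedBall 0 1) :=
      ((hWd.const_mul _).analyticOnNhd hWo).mono hWs
    have hgn : ∀ c, ‖g c‖ = Real.exp (-a) * ‖G (x + c • v)‖ := fun c => by
      rw [hg]; simp only [norm_mul]
      rw [Complex.norm_real, Real.norm_of_nonneg (Real.exp_pos _).le]
    have hg0 : g 0 ≠ 0 := by
      rw [← norm_ne_zero_iff, hgn]; simp [h0]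
    have hlog0 : Real.log ‖g 0‖ = L := by
      rw [hgn, Real.log_mul (Real.exp_pos _).ne' (by simp [h0]), Real.log_exp]
      simp [hL]; ring
    have hbd : ∀ θ : ℝ, Real.log ‖g (circleMap 0 1 θ)‖ ≤
        (A - a) * Bad.indicator (fun _ => (1 : ℝ)) (circleMap 0 1 θ • v) := by
      intro θ
      have hmem : circleMap 0 1 θ • v ∈ S := hbal _ (by simp) v hv
      rcases eq_or_ne ‖g (circleMap 0 1 θ)‖ 0 with hz | hz
      · rw [hz, Real.log_zero]
        exact mul_nonneg (by linarith) (Set.indicator_nonneg (fun _ _ => zero_le_one) _)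
      · rw [Real.log_le_iff_le_exp (lt_of_le_of_ne (norm_nonneg _) hz.symm), hgn]
        by_cases hB : circleMap 0 1 θ • v ∈ Bad
        · rw [Set.indicator_of_mem hB, mul_one, sub_eq_neg_add, Real.exp_add]
          gcongr
          exact hA _ hmem
        · rw [Set.indicator_of_notMem hB, mul_zero, ← neg_add_cancel a, Real.exp_add]
          gcongr
          exact ha _ hmem hB
    have hmeas : Measurable fun θ : ℝ => Bad.indicator (fun _ => (1 : ℝ)) (circleMap 0 1 θ • v) :=
      (measurable_const.indicator hBad).comp
        (by fun_prop : Continuous fun θ : ℝ => circleMap 0 1 θ • v).measurable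
    have hind1 : ∀ θ : ℝ, ‖Bad.indicator (fun _ => (1 : ℝ)) (circleMap 0 1 θ • v)‖ ≤ 1 := by
      intro θ
      by_cases hB : circleMap 0 1 θ • v ∈ Bad
      · simp [hB]
      · simp [hB]
    have hle := log_norm_le_circleAverage hga hg0
    rw [hlog0, circleAverage_def, smul_eq_mul, le_inv_mul_iff₀ (by positivity)] at hle
    have hci : CircleIntegrable (fun z => Real.log ‖g z‖) 0 1 := by
      refine MeromorphicOn.circleIntegrable_log_norm (AnalyticOnNhd.meromorphicOn ?_)
      exact hga.mono (by simpa using sphere_subset_closedBall)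
    have hint : IntervalIntegrable (fun θ : ℝ => Bad.indicator (fun _ => (1 : ℝ))
        (circleMap 0 1 θ • v)) volume 0 (2 * π) :=
      intervalIntegrable_of_bounded hmeas.aestronglyMeasurable hind1
    have hle2 := hle.trans (intervalIntegral.integral_mono (by positivity) hci
      (hint.const_mul (A - a)) hbd)
    rw [intervalIntegral.integral_const_mul, intervalIntegral.integral_of_le (by positivity)] at hle2
    rw [← ENNReal.ofReal_mul hL0.le, mul_comm L]
    refine (ENNReal.ofReal_le_ofReal hle2).trans ?_
    rw [ENNReal.ofReal_mul (by linarith)]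
    gcongr
    rw [ofReal_integral_eq_lintegral_ofReal]
    · refine lintegral_mono fun θ => ?_
      by_cases hB : circleMap 0 1 θ • v ∈ Bad
      · simp [hB]
      · simp [hB]
    · rw [← IntegrableOn, ← intervalIntegrable_iff_integrableOn_Ioc_of_le (by positivity)]
      exact hint
    · exact ae_of_all _ fun θ => Set.indicator_nonneg (fun _ _ => zero_le_one) _
  have hjm : Measurable (Function.uncurry fun (v : E) (θ : ℝ) =>
      Bad.indicator (1 : E → ENNReal) (circleMap 0 1 θ • v)) :=
    (measurable_one.indicator hBad).comp
      (by fun_prop : Continuous fun p : E × ℝ => circleMap 0 1 p.2 • p.1).measurable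
  -- Multiplication by a unimodular scalar preserves both `S` and the volume, so for every angle the
  -- rotated centres meet `Bad` in the same volume.
  have hswap : ∫⁻ v in S, (∫⁻ θ in Set.Ioc (0 : ℝ) (2 * π),
      Bad.indicator (1 : E → ENNReal) (circleMap 0 1 θ • v)) ∂(haarVol E) = haarVol E (S ∩ Bad) * ENNReal.ofReal (2 * π) := by
    rw [lintegral_lintegral_swap hjm.aemeasurable]
    have : ∀ θ : ℝ, ∫⁻ v in S, Bad.indicator 1 (circleMap 0 1 θ • v) ∂(haarVol E)
        = haarVol E (S ∩ Bad) := by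
      intro θ
      have hn : ‖circleMap 0 1 θ‖ = 1 := by simp
      have hmp := measurePreserving_smul_of_norm_eq_one (E := E) hn
      have hpre : (fun v : E => circleMap 0 1 θ • v) ⁻¹' (S ∩ Bad) =
          S ∩ (fun v : E => circleMap 0 1 θ • v) ⁻¹' Bad := by
        ext v
        refine ⟨fun ⟨h1, h2⟩ => ⟨?_, h2⟩, fun ⟨h1, h2⟩ => ⟨hbal _ hn.le v h1, h2⟩⟩
        have h3 := hbal (circleMap 0 1 θ)⁻¹ (by rw [norm_inv, hn, inv_one]) _ h1
        have hne : circleMap 0 1 θ ≠ 0 := by rw [← norm_ne_zero_iff, hn]; exact one_ne_zero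
        rwa [smul_smul, inv_mul_cancel₀ hne, one_smul] at h3
      rw [← hmp.measure_preimage (hS.inter hBad).nullMeasurableSet, hpre, Set.inter_comm,
        ← Measure.restrict_apply (hmp.measurable hBad), ← lintegral_indicator_one
        (hmp.measurable hBad)]
      rfl
    simp_rw [this]
    simp
  have hfinal : ENNReal.ofReal L * ENNReal.ofReal (2 * π) * haarVol E S ≤
      ENNReal.ofReal (A - a) * (haarVol E (S ∩ Bad) * ENNReal.ofReal (2 * π)) := by
    rw [← hswap, ← lintegral_const_mul' _ _ ENNReal.ofReal_ne_top, ← setLIntegral_const]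
    exact setLIntegral_mono' hS fun v hv => hcirc v hv
  have hSBt : haarVol E (S ∩ Bad) ≠ ⊤ := measure_ne_top_of_subset Set.inter_subset_left hSt
  have hreal := ENNReal.toReal_mono (by finiteness) hfinal
  simp only [ENNReal.toReal_mul] at hreal
  rw [ENNReal.toReal_ofReal hL0.le, ENNReal.toReal_ofReal (by positivity),
    ENNReal.toReal_ofReal (by linarith)] at hreal
  have h2pi : 0 < 2 * π := by positivity
  have : L * (haarVol E S).toReal ≤ (A - a) * (haarVol E (S ∩ Bad)).toReal := by
    refine le_of_mul_le_mul_right ?_ h2pi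
    nlinarith
  have : L ≤ (A - a) * ((haarVol E (S ∩ Bad)).toReal / (haarVol E S).toReal) := by
    rw [← mul_div_assoc, le_div_iff₀ hSpos]; exact this
  linarith

end Haar

/-! ### A quantitative Hartogs lemma. -/

/-- Circle averages of functions depending holomorphically on a parameter. -/
lemma differentiableOn_circleAverage_of_param {F : ℂ → ℂ → ℂ} {V : Set ℂ} (hV : IsOpen V) {ρ : ℝ}
    (hF : ContinuousOn (Function.uncurry F) (V ×ˢ sphere 0 |ρ|))
    (hd : ∀ l ∈ sphere (0 : ℂ) |ρ|, DifferentiableOn ℂ (fun c => F c l) V) :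
    DifferentiableOn ℂ (fun c => circleAverage (F c) 0 ρ) V := by
  intro c₀ hc₀
  obtain ⟨δ', hδ', hball⟩ := Metric.nhds_basis_closedBall.mem_iff.1 (hV.mem_nhds hc₀)
  set δ := δ' / 2 with hδ
  have hδ0 : 0 < δ := by positivity
  obtain ⟨B, hB⟩ := ((isCompact_closedBall c₀ δ').prod (isCompact_sphere (0 : ℂ) |ρ|)
    ).exists_bound_of_continuousOn (hF.mono (Set.prod_mono hball subset_rfl))
  have hcirc : ∀ θ, circleMap 0 ρ θ ∈ sphere (0 : ℂ) |ρ| := fun θ => circleMap_mem_sphere' 0 ρ θ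
  have hθc : ∀ c ∈ V, Continuous fun θ : ℝ => F c (circleMap 0 ρ θ) := fun c hc =>
    hF.comp_continuous (f := fun θ : ℝ => (c, circleMap 0 ρ θ)) (by fun_prop)
      fun θ => ⟨hc, hcirc θ⟩
  have hsub : ball c₀ δ ⊆ V := (ball_subset_closedBall.trans
    (closedBall_subset_closedBall (by rw [hδ]; linarith))).trans hball
  have hder : ∀ c ∈ V, ∀ l ∈ sphere (0 : ℂ) |ρ|,
      HasDerivAt (fun c => F c l) (deriv (fun c => F c l) c) c := fun c hc l hl =>
    ((hd l hl).differentiableAt (hV.mem_nhds hc)).hasDerivAt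
  refine DifferentiableAt.differentiableWithinAt ?_
  simp only [circleAverage_def]
  refine DifferentiableAt.const_smul ?_ _
  refine (intervalIntegral.hasDerivAt_integral_of_dominated_loc_of_deriv_le
    (F' := fun c θ => deriv (fun c => F c (circleMap 0 ρ θ)) c) (bound := fun _ => B / δ)
    (ball_mem_nhds c₀ hδ0) ?_ ?_ ?_ ?_ ?_ ?_).2.differentiableAt
  · filter_upwards [hV.mem_nhds hc₀] with c hc
    exact (hθc c hc).aestronglyMeasurable
  · exact (hθc c₀ hc₀).intervalIntegrable _ _
  -- The derivative is measurable in `θ` as a pointwise limit of difference quotients.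
  · have hseq : Tendsto (fun n : ℕ => ((δ / (n + 1 : ℝ) : ℝ) : ℂ)) atTop (𝓝[≠] 0) := by
      rw [tendsto_nhdsWithin_iff]
      constructor
      · have : Tendsto (fun n : ℕ => δ / (n + 1 : ℝ)) atTop (𝓝 0) :=
          tendsto_const_nhds.div_atTop
            (tendsto_atTop_add_const_right _ _ tendsto_natCast_atTop_atTop)
        exact_mod_cast (Complex.continuous_ofReal.tendsto 0).comp this
      · refine Eventually.of_forall fun n => ?_
        simp only [Set.mem_compl_iff, Set.mem_singleton_iff, Complex.ofReal_eq_zero]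
        positivity
    refine aestronglyMeasurable_of_tendsto_ae atTop
      (f := fun (n : ℕ) (θ : ℝ) => ((δ / (n + 1 : ℝ) : ℝ) : ℂ)⁻¹ •
        (F (c₀ + ((δ / (n + 1 : ℝ) : ℝ) : ℂ)) (circleMap 0 ρ θ) - F c₀ (circleMap 0 ρ θ)))
      (fun n => ?_) (ae_of_all _ fun θ => ?_)
    · have hmem : c₀ + ((δ / (n + 1 : ℝ) : ℝ) : ℂ) ∈ V := by
        apply hball
        rw [mem_closedBall, dist_eq_norm, add_sub_cancel_left, Complex.norm_real,
          Real.norm_of_nonneg (by positivity)]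
        refine (div_le_self hδ0.le (by linarith [n.cast_nonneg (α := ℝ)])).trans ?_
        rw [hδ]; linarith
      exact (continuous_const.mul ((hθc _ hmem).sub (hθc c₀ hc₀))).aestronglyMeasurable
    · exact (hasDerivAt_iff_tendsto_slope_zero.1 (hder c₀ hc₀ _ (hcirc θ))).comp hseq
  -- Cauchy's estimate on the disc of radius `δ` about `c`, which stays in the disc of radius `δ' =
  -- 2 * δ` about `c₀` where `B` is a bound.
  · refine ae_of_all _ fun θ _ c hc => ?_
    have hcl : closedBall c δ ⊆ closedBall c₀ δ' := by
      refine closedBall_subset_closedBall' ?_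
      rw [mem_ball] at hc
      rw [hδ] at hc ⊢; linarith
    refine Complex.norm_deriv_le_of_forall_mem_sphere_norm_le hδ0 ?_ fun z hz => ?_
    · refine DifferentiableOn.diffContOnCl ?_
      rw [closure_ball _ hδ0.ne']
      exact (hd _ (hcirc θ)).mono (hcl.trans hball)
    · exact hB (z, circleMap 0 ρ θ) ⟨hcl (sphere_subset_closedBall hz), hcirc θ⟩
  · simp
  · exact ae_of_all _ fun θ _ c hc => hder c (hsub hc) _ (hcirc θ)

/-- Cauchy's formula; the averaging measure `dl / (2 * π * I * l)` absorbs one power of `l`, leaving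
`l ^ k` in place of `l ^ (k + 1)`. -/
lemma iteratedDeriv_eq_circleAverage {g : ℂ → ℂ} {ρ : ℝ} (hρ : 0 < ρ)
    (hg : DifferentiableOn ℂ g (closedBall 0 ρ)) (k : ℕ) :
    iteratedDeriv k g 0 = k.factorial * circleAverage (fun l => g l / l ^ k) 0 ρ := by
  have h := hg.circleIntegral_one_div_sub_center_pow_smul hρ k
  have h2 : circleAverage (fun l => g l / l ^ k) 0 ρ =
      (2 * π * Complex.I)⁻¹ * ∮ z in C(0, ρ), (1 / (z - 0) ^ (k + 1)) • g z := by
    rw [circleAverage_eq_circleIntegral hρ.ne', smul_eq_mul]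
    congr 1
    refine circleIntegral.integral_congr hρ.le fun z hz => ?_
    have hz0 : z ≠ 0 := by rintro rfl; simp at hz; linarith
    simp only [sub_zero, smul_eq_mul]
    rw [pow_succ]; field_simp
  rw [h2, h, smul_eq_mul]
  have hpi : (π : ℂ) ≠ 0 := by exact_mod_cast pi_ne_zero
  have hk : (k.factorial : ℂ) ≠ 0 := by exact_mod_cast k.factorial_ne_zero
  have hI := Complex.I_ne_zero
  field_simp

/-- If all Taylor coefficients at `0` of all powers of `g` satisfy the Cauchy estimates for the
bound `M` and the radius `R`, then `‖g‖ ≤ M` on the disc of radius `R`. -/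
lemma norm_le_of_forall_iteratedDeriv_pow_le {g : ℂ → ℂ} {M R R₀ : ℝ} (hM : 0 < M) (hR : 0 < R)
    (hRR : R ≤ R₀) (hg : DifferentiableOn ℂ g (ball 0 R₀))
    (hc : ∀ m k : ℕ, ‖iteratedDeriv k (fun l => g l ^ m) 0‖ ≤ k.factorial * (M ^ m * R⁻¹ ^ k))
    {l : ℂ} (hl : ‖l‖ < R) : ‖g l‖ ≤ M := by
  set q := R⁻¹ * ‖l‖ with hq
  have hq0 : 0 ≤ q := by positivity
  have hq1 : q < 1 := by rw [hq, inv_mul_lt_iff₀ hR, mul_one]; exact hl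
  -- Summing the Taylor series costs a factor `(1 - q)⁻¹` that does not depend on `m`; letting `m`
  -- grow removes it.
  have hpow : ∀ m : ℕ, (‖g l‖ / M) ^ m ≤ (1 - q)⁻¹ := by
    intro m
    have hs := Complex.hasSum_taylorSeries_on_ball (r := R₀) (c := 0)
      (f := fun l => g l ^ m) (hg.pow m) (z := l)
      (by rw [mem_ball_zero_iff]; exact hl.trans_le hRR)
    have hle : ‖g l ^ m‖ ≤ M ^ m * (1 - q)⁻¹ := by
      refine hs.norm_le_of_bounded ((hasSum_geometric_of_lt_one hq0 hq1).mul_left (M ^ m))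
        fun k => ?_
      rw [sub_zero, norm_smul, norm_smul, norm_inv, norm_pow, Complex.norm_natCast]
      have hk : (0 : ℝ) < k.factorial := by exact_mod_cast k.factorial_pos
      rw [inv_mul_le_iff₀ hk]
      calc _ ≤ ‖l‖ ^ k * (k.factorial * (M ^ m * R⁻¹ ^ k)) := by gcongr; exact hc m k
        _ = _ := by rw [hq, mul_pow]; ring
    rw [norm_pow] at hle
    rw [div_pow, div_le_iff₀ (by positivity), mul_comm]
    exact hle
  by_contra hcon
  rw [not_le] at hcon
  obtain ⟨m, hm⟩ := pow_unbounded_of_one_lt ((1 - q)⁻¹) ((one_lt_div hM).2 hcon)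
  exact absurd (hpow m) (not_le.2 hm)

section Hartogs

variable {E : Type*} [NormedAddCommGroup E] [InnerProductSpace ℂ E] [FiniteDimensional ℂ E]
  [MeasurableSpace E] [BorelSpace E]

omit [FiniteDimensional ℂ E] [MeasurableSpace E] [BorelSpace E] in
lemma differentiableOn_line {f : E → ℂ} {U : Set E} (hf : DifferentiableOn ℂ f U) (y e : E) :
    DifferentiableOn ℂ (fun l : ℂ => f (y + l • e)) ((fun l : ℂ => y + l • e) ⁻¹' U) :=
  hf.comp (by fun_prop) fun _ h => h

/-- A quantitative **Hartogs lemma**. Suppose `‖f‖ ≤ M` on all discs of radius `ρ₁` in direction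
`e` centred at points of `x + S`, and on the discs of radius `ρ₂` for all centres outside a
small set `Bad`. Then `‖f‖ ≤ M` on a disc about `x` of radius close to `ρ₂`. -/
theorem norm_le_of_hartogs {f : E → ℂ} {U : Set E} (hU : IsOpen U) (hf : DifferentiableOn ℂ f U)
    {x e : E} {S : Set E} (hS : MeasurableSet S)
    (hbal : ∀ c : ℂ, ‖c‖ ≤ 1 → ∀ v ∈ S, c • v ∈ S)
    (hS0 : haarVol E S ≠ 0) (hSt : haarVol E S ≠ ⊤) {Bad : Set E} (hBad : MeasurableSet Bad)
    {ρ₁ ρ₂ M : ℝ} (hρ₁ : 0 < ρ₁) (hρ : ρ₁ ≤ ρ₂) (hM : 0 < M)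
    (hdisc : ∀ v ∈ S, ∀ l : ℂ, ‖l‖ ≤ ρ₂ → x + v + l • e ∈ U)
    (h₁ : ∀ v ∈ S, ∀ l : ℂ, ‖l‖ ≤ ρ₁ → ‖f (x + v + l • e)‖ ≤ M)
    (h₂ : ∀ v ∈ S, v ∉ Bad → ∀ l : ℂ, ‖l‖ ≤ ρ₂ → ‖f (x + v + l • e)‖ ≤ M) {l : ℂ}
    (hl : ‖l‖ < ρ₂ * (ρ₁ / ρ₂) ^ ((haarVol E (S ∩ Bad)).toReal / (haarVol E S).toReal)) :
    ‖f (x + l • e)‖ ≤ M := by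
  have hρ₂ : 0 < ρ₂ := hρ₁.trans_le hρ
  set b := (haarVol E (S ∩ Bad)).toReal / (haarVol E S).toReal with hb
  have hb0 : 0 ≤ b := by positivity
  have hSne : S.Nonempty := nonempty_of_measure_ne_zero hS0
  have h0S : (0 : E) ∈ S := by
    obtain ⟨v, hv⟩ := hSne
    simpa using hbal 0 (by simp) v hv
  have hR : 0 < ρ₂ * (ρ₁ / ρ₂) ^ b := by positivity
  have hRle : ρ₂ * (ρ₁ / ρ₂) ^ b ≤ ρ₂ :=
    mul_le_of_le_one_right hρ₂.le (Real.rpow_le_one (by positivity) (div_le_one_of_le₀ hρ hρ₂.le) hb0)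
  have hxU : DifferentiableOn ℂ (fun l : ℂ => f (x + l • e)) (ball 0 ρ₂) := by
    refine (differentiableOn_line hf x e).mono fun l hl => ?_
    have := hdisc 0 h0S l (by simpa using (mem_ball_zero_iff.1 hl).le)
    rwa [add_zero] at this
  refine norm_le_of_forall_iteratedDeriv_pow_le hM hR hRle hxU (fun m k => ?_) hl
  set F : E → ℂ := fun y => f y ^ m with hF
  have hFU : DifferentiableOn ℂ F U := hf.pow m
  -- `G y` is the `k`-th Taylor coefficient of `f ^ m` at `y` in direction `e`. It is computed on
  -- the small circle because that is available for all centres, which makes `G` holomorphic along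
  -- `v`.
  set G : E → ℂ := fun y => circleAverage (fun l => F (y + l • e) / l ^ k) 0 ρ₁ with hG
  have hcl : ∀ v ∈ S, ∀ r, 0 < r → r ≤ ρ₂ → DifferentiableOn ℂ (fun l : ℂ => F (x + v + l • e))
      (closedBall 0 r) := fun v hv r _ hr2 =>
    (differentiableOn_line hFU (x + v) e).mono fun l hl =>
      hdisc v hv l ((mem_closedBall_zero_iff.1 hl).trans hr2)
  have hk : (0 : ℝ) < k.factorial := by exact_mod_cast k.factorial_pos
  have hGit : ∀ v ∈ S, iteratedDeriv k (fun l : ℂ => F (x + v + l • e)) 0 =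
      k.factorial * G (x + v) := fun v hv =>
    iteratedDeriv_eq_circleAverage hρ₁ (hcl v hv ρ₁ hρ₁ hρ) k
  have hcauchy : ∀ v ∈ S, ∀ r, 0 < r → r ≤ ρ₂ → (∀ l : ℂ, ‖l‖ ≤ r → ‖f (x + v + l • e)‖ ≤ M) →
      ‖G (x + v)‖ ≤ M ^ m / r ^ k := by
    intro v hv r hr hr2 hb
    have hd : DiffContOnCl ℂ (fun l : ℂ => F (x + v + l • e)) (ball 0 r) := by
      refine DifferentiableOn.diffContOnCl ?_
      rw [closure_ball _ hr.ne']
      exact hcl v hv r hr hr2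
    have := Complex.norm_iteratedDeriv_le_of_forall_mem_sphere_norm_le (C := M ^ m) k hr hd
      fun z hz => by
        rw [hF]; simp only [norm_pow]
        exact pow_le_pow_left₀ (norm_nonneg _) (hb z (mem_sphere_zero_iff_norm.1 hz).le) m
    rw [hGit v hv, norm_mul, Complex.norm_natCast, mul_div_assoc] at this
    exact le_of_mul_le_mul_left this hk
  have hexp : ∀ r, 0 < r → M ^ m / r ^ k = Real.exp (m * Real.log M - k * Real.log r) := by
    intro r hr
    rw [Real.exp_sub, mul_comm (m : ℝ), mul_comm (k : ℝ), Real.exp_mul, Real.exp_mul,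
      Real.exp_log hM, Real.exp_log hr, Real.rpow_natCast, Real.rpow_natCast]
  have hlog : Real.log ρ₁ ≤ Real.log ρ₂ := Real.log_le_log hρ₁ hρ
  -- Cauchy's estimates bound `log ‖G‖` by `m * log M - k * log ρ₂` off `Bad` and by the same
  -- expression with `ρ₁` on it. The weighted mean is `m * log M - k * log R`, where `R` is the
  -- radius in the conclusion.
  have hmain := norm_le_exp_of_balanced (G := G) (x := x) hS hbal ?_ hS0 hSt hBad
    (a := m * Real.log M - k * Real.log ρ₂) (A := m * Real.log M - k * Real.log ρ₁)
    (by have : (0 : ℝ) ≤ k := k.cast_nonneg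
        nlinarith)
    (fun v hv => by rw [← hexp ρ₁ hρ₁]; exact hcauchy v hv ρ₁ hρ₁ hρ (h₁ v hv))
    (fun v hv hvB => by rw [← hexp ρ₂ hρ₂]; exact hcauchy v hv ρ₂ hρ₂ le_rfl (h₂ v hv hvB))
  · have hit := hGit 0 h0S
    rw [add_zero] at hit
    change ‖iteratedDeriv k (fun l : ℂ => F (x + l • e)) 0‖ ≤ _
    rw [hit, norm_mul, Complex.norm_natCast]
    gcongr
    refine hmain.trans_eq ?_
    rw [inv_pow, ← div_eq_mul_inv, hexp _ hR, Real.log_mul hρ₂.ne' (by positivity),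
      Real.log_rpow (by positivity), Real.log_div hρ₁.ne' hρ₂.ne', ← hb]
    congr 1; ring
  · intro v hv
    -- The parameters for which the whole small disc stays in `U`; this set is open because the disc
    -- is compact.
    set V : Set ℂ := {c | ∀ l ∈ closedBall (0 : ℂ) ρ₁, x + c • v + l • e ∈ U} with hV
    have hVo : IsOpen V := by
      have hpre : IsOpen {p : ℂ × ℂ | x + p.1 • v + p.2 • e ∈ U} :=
        hU.preimage (by fun_prop)
      rw [isOpen_iff_mem_nhds]
      intro c hc
      exact (isCompact_closedBall (0 : ℂ) ρ₁).eventually_forall_of_forall_eventually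
        fun l hl => hpre.mem_nhds (hc l hl)
    refine ⟨V, hVo, fun c hc l hl => ?_, ?_⟩
    · exact hdisc _ (hbal c (by simpa using hc) v hv) l
        ((mem_closedBall_zero_iff.1 hl).trans hρ)
    · have hsph : sphere (0 : ℂ) |ρ₁| ⊆ closedBall 0 ρ₁ := by
        rw [abs_of_pos hρ₁]; exact sphere_subset_closedBall
      refine differentiableOn_circleAverage_of_param
        (F := fun c l => F (x + c • v + l • e) / l ^ k) hVo ?_ fun l hl => ?_
      · refine ContinuousOn.div ?_ (by fun_prop) fun p hp => ?_
        · exact hFU.continuousOn.comp (by fun_prop) fun p hp => hp.1 p.2 (hsph hp.2)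
        · refine pow_ne_zero _ ?_
          have := hp.2
          rw [mem_sphere_zero_iff_norm, abs_of_pos hρ₁] at this
          rw [← norm_ne_zero_iff, this]; exact hρ₁.ne'
      · have hmaps : Set.MapsTo (fun c : ℂ => x + c • v + l • e) V U :=
          fun c hc => hc l (hsph hl)
        exact (hFU.comp (by fun_prop) hmaps).div_const _

end Hartogs

/-! ### Nonisotropic geometry of admissible regions. -/

section Geometry

variable {E : Type*} [NormedAddCommGroup E] [InnerProductSpace ℂ E]

/-- The component of `z` orthogonal to the complex line through `P`. -/
noncomputable def perpPart (P z : E) : E := z - inner ℂ P z • P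

lemma perpPart_add (P z w : E) : perpPart P (z + w) = perpPart P z + perpPart P w := by
  simp only [perpPart, inner_add_right, add_smul]; abel

lemma perpPart_smul (P : E) (c : ℂ) (z : E) : perpPart P (c • z) = c • perpPart P z := by
  simp only [perpPart, inner_smul_right, smul_sub, mul_smul]

lemma inner_self_of_norm_one {P : E} (hP : ‖P‖ = 1) : inner ℂ P P = 1 := by
  rw [inner_self_eq_norm_sq_to_K, hP]; simp

lemma perpPart_self {P : E} (hP : ‖P‖ = 1) : perpPart P P = 0 := by
  rw [perpPart, inner_self_of_norm_one hP, one_smul, sub_self]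

lemma norm_sq_eq_inner_add_perpPart {P : E} (hP : ‖P‖ = 1) (z : E) :
    ‖z‖ ^ 2 = ‖inner ℂ P z‖ ^ 2 + ‖perpPart P z‖ ^ 2 := by
  have hz : z = inner ℂ P z • P + perpPart P z := by simp [perpPart]
  have horth : inner ℂ (inner ℂ P z • P) (perpPart P z) = 0 := by
    rw [inner_smul_left, perpPart, inner_sub_right, inner_smul_right, inner_self_of_norm_one hP]
    simp
  have := norm_add_sq_eq_norm_sq_add_norm_sq_of_inner_eq_zero (𝕜 := ℂ) _ _ horth
  rw [← hz, norm_smul, hP, mul_one] at this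
  rw [pow_two, pow_two, pow_two]; exact this

lemma norm_perpPart_le {P : E} (hP : ‖P‖ = 1) (z : E) : ‖perpPart P z‖ ≤ ‖z‖ := by
  have := norm_sq_eq_inner_add_perpPart hP z
  refine le_of_sq_le_sq ?_ (norm_nonneg _)
  nlinarith [sq_nonneg ‖inner ℂ P z‖]

lemma norm_inner_le_of_norm_one {P : E} (hP : ‖P‖ = 1) (z : E) : ‖inner ℂ P z‖ ≤ ‖z‖ := by
  simpa [hP] using norm_inner_le_norm (𝕜 := ℂ) P z

/-- The anisotropic polydisc of size `r ^ 2` in the direction of `P` and size `r` in the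
orthogonal directions. -/
def anisoBox (P : E) (r : ℝ) : Set E := {v | ‖inner ℂ P v‖ < r ^ 2 ∧ ‖perpPart P v‖ < r}

lemma isOpen_anisoBox (P : E) (r : ℝ) : IsOpen (anisoBox P r) := by
  unfold anisoBox perpPart
  exact IsOpen.and (isOpen_lt (by fun_prop) continuous_const)
    (isOpen_lt (by fun_prop) continuous_const)

lemma smul_mem_anisoBox {P v : E} {r : ℝ} {c : ℂ} (hc : ‖c‖ ≤ 1) (hv : v ∈ anisoBox P r) :
    c • v ∈ anisoBox P r := by
  refine ⟨?_, ?_⟩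
  · rw [inner_smul_right, norm_mul]
    exact (mul_le_of_le_one_left (norm_nonneg _) hc).trans_lt hv.1
  · rw [perpPart_smul, norm_smul]
    exact (mul_le_of_le_one_left (norm_nonneg _) hc).trans_lt hv.2

lemma zero_mem_anisoBox (P : E) {r : ℝ} (hr : 0 < r) : (0 : E) ∈ anisoBox P r := by
  refine ⟨?_, ?_⟩
  · simp; positivity
  · simp [perpPart, hr]

lemma norm_le_of_mem_anisoBox {P v : E} (hP : ‖P‖ = 1) {r : ℝ} (hv : v ∈ anisoBox P r) :
    ‖v‖ ≤ r ^ 2 + r := by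
  have hz : v = inner ℂ P v • P + perpPart P v := by simp [perpPart]
  rw [hz]
  refine (norm_add_le _ _).trans ?_
  rw [norm_smul, hP, mul_one]
  exact add_le_add hv.1.le hv.2.le

/-- The source of the parabolic scaling: if `⟪P, z⟫` is within `s` of `1`, the unit ball leaves only
`1 - (1 - s) ^ 2 ≤ 2 * s` for the squared orthogonal part. -/
lemma norm_perpPart_sq_le {P z : E} (hP : ‖P‖ = 1) (hz : ‖z‖ ≤ 1) {s : ℝ}
    (hs : ‖1 - inner ℂ P z‖ ≤ s) : ‖perpPart P z‖ ^ 2 ≤ 2 * s := by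
  have h1 := norm_sq_eq_inner_add_perpPart hP z
  have h2 : 1 - s ≤ ‖inner ℂ P z‖ := by
    have := norm_sub_norm_le (1 : ℂ) (1 - inner ℂ P z)
    rw [sub_sub_cancel, norm_one] at this
    linarith
  have h3 := norm_inner_le_of_norm_one hP z
  have h4 := norm_nonneg z
  have h5 := norm_nonneg (inner ℂ P z)
  nlinarith

variable {P z v : E} {β t r : ℝ}

/-- The assumption `4 ≤ β` lets `2 * β` be absorbed in `β ^ 2`. -/
lemma norm_perpPart_le_of_mem_admissible (hP : ‖P‖ = 1) (hβ : 4 ≤ β) (hr : 0 ≤ r)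
    (hrt : r ^ 2 = t) (hz : ‖z‖ ≤ 1) (hzA : ‖1 - inner ℂ P z‖ < β * t) :
    ‖perpPart P z‖ ≤ β * r := by
  refine le_of_sq_le_sq ?_ (by positivity)
  have := norm_perpPart_sq_le hP hz hzA.le
  rw [mul_pow, hrt]
  nlinarith [hrt ▸ sq_nonneg r]

/-- Translating a point of the admissible region by a small anisotropic vector changes the square
of the norm by little. -/
lemma norm_add_sq_le_of_mem_anisoBox (hP : ‖P‖ = 1) (hβ : 4 ≤ β) (hr : 0 < r) (hr1 : r ≤ 1)
    (hrt : r ^ 2 = t) {a : E} (ha : ‖a‖ ≤ 2) (haP : ‖perpPart P a‖ ≤ β * r)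
    (hv : v ∈ anisoBox P (1 / (32 * β) * r)) : ‖a + v‖ ^ 2 ≤ ‖a‖ ^ 2 + t / 8 := by
  -- With an orthogonal part as large as `β * r`, the cross term is `2 * (β * r) * (κ * r) = t /
  -- 16`; this value of `κ` keeps the total below `t / 8`.
  set κ := 1 / (32 * β) with hκ
  have hκ0 : 0 < κ := by positivity
  have hκβ : κ * β = 1 / 32 := by rw [hκ]; field_simp
  have hκ1 : κ ≤ 1 / 128 := by
    rw [hκ]; apply one_div_le_one_div_of_le <;> linarith
  have e1 := norm_sq_eq_inner_add_perpPart hP (a + v)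
  have e2 := norm_sq_eq_inner_add_perpPart hP a
  have h1 : ‖inner ℂ P (a + v)‖ ≤ ‖inner ℂ P a‖ + (κ * r) ^ 2 := by
    rw [inner_add_right]
    exact (norm_add_le _ _).trans (add_le_add le_rfl hv.1.le)
  have h2 : ‖perpPart P (a + v)‖ ≤ ‖perpPart P a‖ + κ * r := by
    rw [perpPart_add]
    exact (norm_add_le _ _).trans (add_le_add le_rfl hv.2.le)
  have h3 : ‖inner ℂ P a‖ ≤ 2 := (norm_inner_le_of_norm_one hP a).trans ha
  have ht : 0 < t := by rw [← hrt]; positivity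
  have ht1 : t ≤ 1 := by rw [← hrt]; nlinarith
  have hκr : (κ * r) ^ 2 = κ ^ 2 * t := by rw [mul_pow, hrt]
  have h5 : ‖inner ℂ P (a + v)‖ ^ 2 ≤ ‖inner ℂ P a‖ ^ 2 + t / 32 := by
    have := pow_le_pow_left₀ (norm_nonneg _) h1 2
    rw [hκr] at this
    have h6 : κ ^ 2 * t ≤ t / 256 := by
      have : κ ^ 2 ≤ 1 / 256 := by nlinarith
      nlinarith
    have h7 : 0 ≤ κ ^ 2 * t := by positivity
    nlinarith [norm_nonneg (inner ℂ P a)]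
  have h6 : ‖perpPart P (a + v)‖ ^ 2 ≤ ‖perpPart P a‖ ^ 2 + 3 * t / 32 := by
    have := pow_le_pow_left₀ (norm_nonneg _) h2 2
    have h7 : ‖perpPart P a‖ * (κ * r) ≤ β * r * (κ * r) := by gcongr
    have h8 : β * r * (κ * r) = t / 32 := by
      rw [← hrt]; linear_combination r ^ 2 * hκβ
    have h9 : (κ * r) ^ 2 ≤ t / 32 := by
      have : κ ^ 2 ≤ 1 / 256 := by nlinarith
      rw [hκr]; nlinarith
    nlinarith
  linarith

/-- Since `re ⟪P, z⟫ ≥ 1 - β * t`, moving inwards by `t` along `P` doubles the depth to first order.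
The quadratic error `2 * (1 + β) * t ^ 2` and the shift by `v` each cost at most `t / 8` in the
squared norm, leaving `1 - 15 / 4 * t`. -/
lemma norm_sub_smul_add_le (hP : ‖P‖ = 1) (hβ : 4 ≤ β) (hr : 0 < r) (hrt : r ^ 2 = t)
    (ht : t * (16 * (1 + β)) ≤ 1) (hzt : 1 - ‖z‖ = t) (hzA : ‖1 - inner ℂ P z‖ < β * t)
    (hv : v ∈ anisoBox P (1 / (32 * β) * r)) :
    ‖z - (t : ℂ) • P + v‖ ≤ 1 - 15 / 8 * t := by
  have ht0 : 0 < t := by rw [← hrt]; positivity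
  have ht1 : t ≤ 1 / 80 := by nlinarith
  have hr1 : r ≤ 1 := by nlinarith
  have hz1 : ‖z‖ ≤ 1 := by linarith
  set a := z - (t : ℂ) • P with ha
  have hperp : perpPart P a = perpPart P z := by
    have : a = z + (-(t : ℂ)) • P := by rw [ha, neg_smul, sub_eq_add_neg]
    rw [this, perpPart_add, perpPart_smul, perpPart_self hP, smul_zero, add_zero]
  have ha2 : ‖a‖ ≤ 2 := by
    refine (norm_sub_le _ _).trans ?_
    rw [norm_smul, hP, mul_one, Complex.norm_real, Real.norm_of_nonneg ht0.le]; linarith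
  have h1 := norm_add_sq_le_of_mem_anisoBox hP hβ hr hr1 hrt ha2
    (by rw [hperp]; exact norm_perpPart_le_of_mem_admissible hP hβ hr.le hrt hz1 hzA) hv
  have e1 := norm_sq_eq_inner_add_perpPart hP a
  have e2 := norm_sq_eq_inner_add_perpPart hP z
  have hin : inner ℂ P a = inner ℂ P z - t := by
    rw [ha, inner_sub_right, inner_smul_right, inner_self_of_norm_one hP, mul_one]
  have hre : 1 - β * t ≤ (inner ℂ P z).re := by
    have := (Complex.re_le_norm (1 - inner ℂ P z)).trans hzA.le
    simp only [Complex.sub_re, Complex.one_re] at this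
    linarith
  have h3 : ‖inner ℂ P a‖ ^ 2 = ‖inner ℂ P z‖ ^ 2 - 2 * t * (inner ℂ P z).re + t ^ 2 := by
    rw [hin, ← Complex.normSq_eq_norm_sq, ← Complex.normSq_eq_norm_sq, Complex.normSq_apply,
      Complex.normSq_apply]
    simp only [Complex.sub_re, Complex.ofReal_re, Complex.sub_im, Complex.ofReal_im]
    ring
  rw [hperp, h3] at e1
  have hz' : ‖z‖ = 1 - t := by linarith
  rw [hz'] at e2
  refine le_of_sq_le_sq ?_ (by linarith)
  have h4 : 2 * t * (1 - β * t) ≤ 2 * t * (inner ℂ P z).re := by gcongr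
  have h5 : t * t * (16 * (1 + β)) ≤ t := by nlinarith
  nlinarith [sq_nonneg t]

/-- Keeps the whole box about `z` at height comparable to `t`, so that sub-mean values at `z` itself
can be taken over it. -/
lemma norm_add_le_of_mem_admissible (hP : ‖P‖ = 1) (hβ : 4 ≤ β) (hr : 0 < r) (hrt : r ^ 2 = t)
    (ht : t ≤ 1 / 2) (hzt : 1 - ‖z‖ = t) (hzA : ‖1 - inner ℂ P z‖ < β * t)
    (hv : v ∈ anisoBox P (1 / (32 * β) * r)) : ‖z + v‖ ≤ 1 - t / 2 := by
  have ht0 : 0 < t := by rw [← hrt]; positivity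
  have hr1 : r ≤ 1 := by nlinarith
  have hz1 : ‖z‖ ≤ 1 := by linarith
  have h1 := norm_add_sq_le_of_mem_anisoBox hP hβ hr hr1 hrt (by linarith : ‖z‖ ≤ 2)
    (norm_perpPart_le_of_mem_admissible hP hβ hr.le hrt hz1 hzA) hv
  have hz' : ‖z‖ = 1 - t := by linarith
  rw [hz'] at h1
  refine le_of_sq_le_sq ?_ (by linarith)
  nlinarith

/-- Points close to the admissible region over `P` at height `t` lie in an anisotropic box of size
comparable to `√t` about `P`. -/
lemma sub_mem_anisoBox (hP : ‖P‖ = 1) (hβ : 4 ≤ β) (hr : 0 < r) (hr1 : r ≤ 1) (hrt : r ^ 2 = t)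
    (hz : ‖z‖ ≤ 1) (hzA : ‖1 - inner ℂ P z‖ < β * t) (hv : v ∈ anisoBox P (1 / (32 * β) * r))
    {s : ℝ} (hs0 : 0 ≤ s) (hs : s ≤ t) {y : E} (hy : ‖y - (z - (s : ℂ) • P + v)‖ ≤ 2 * t) :
    y - P ∈ anisoBox P ((β + 4) * r) := by
  have ht0 : 0 < t := by rw [← hrt]; positivity
  have htr : t ≤ r := by rw [← hrt]; nlinarith
  set κ := 1 / (32 * β) with hκ
  have hκ0 : 0 < κ := by positivity
  have hκ1 : κ ≤ 1 / 128 := by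
    rw [hκ]; apply one_div_le_one_div_of_le <;> linarith
  set u := y - (z - (s : ℂ) • P + v) with hu
  have hyu : y - P = z + (-((s : ℂ) + 1)) • P + v + u := by
    rw [hu, neg_smul, add_smul, one_smul]; abel
  have h0 : ‖inner ℂ P v‖ < (κ * r) ^ 2 := hv.1
  have h0' : ‖perpPart P v‖ < κ * r := hv.2
  refine ⟨?_, ?_⟩
  · have : inner ℂ P (y - P) = -(1 - inner ℂ P z) - s + inner ℂ P v + inner ℂ P u := by
      rw [hyu, inner_add_right, inner_add_right, inner_add_right, inner_smul_right,
        inner_self_of_norm_one hP]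
      ring
    rw [this]
    have h1 : ‖-(1 - inner ℂ P z) - (s : ℂ) + inner ℂ P v + inner ℂ P u‖ ≤
        ‖1 - inner ℂ P z‖ + s + ‖inner ℂ P v‖ + ‖inner ℂ P u‖ := by
      refine (norm_add_le _ _).trans (add_le_add ((norm_add_le _ _).trans (add_le_add
        ((norm_sub_le _ _).trans_eq ?_) le_rfl)) le_rfl)
      rw [norm_neg, Complex.norm_real, Real.norm_of_nonneg hs0]
    have h2 := (norm_inner_le_of_norm_one hP u).trans hy
    have h3 : (κ * r) ^ 2 ≤ t := by
      have : κ ^ 2 ≤ 1 := by nlinarith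
      rw [mul_pow, hrt]; nlinarith
    have h4 : ((β + 4) * r) ^ 2 = (β + 4) ^ 2 * t := by rw [mul_pow, hrt]
    rw [h4]
    nlinarith
  · rw [hyu, perpPart_add, perpPart_add, perpPart_add, perpPart_smul, perpPart_self hP, smul_zero,
      add_zero]
    refine (norm_add_le _ _).trans_lt ?_
    have h1 := norm_add_le (perpPart P z) (perpPart P v)
    have h2 := (norm_perpPart_le hP u).trans hy
    have h3 := norm_perpPart_le_of_mem_admissible hP hβ hr.le hrt hz hzA
    nlinarith

end Geometry

/-! ### Density points with respect to anisotropic boxes, and exceptional centres. -/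

section Density

variable {E : Type*} [NormedAddCommGroup E] [InnerProductSpace ℂ E] [FiniteDimensional ℂ E]
  [MeasurableSpace E] [BorelSpace E]

lemma haarVol_anisoBox_ne_zero (P : E) {r : ℝ} (hr : 0 < r) : haarVol E (anisoBox P r) ≠ 0 :=
  ((isOpen_anisoBox P r).measure_pos _ ⟨0, zero_mem_anisoBox P hr⟩).ne'

lemma haarVol_anisoBox_ne_top {P : E} (hP : ‖P‖ = 1) (r : ℝ) : haarVol E (anisoBox P r) ≠ ⊤ := by
  have hprop : ProperSpace E := FiniteDimensional.proper ℂ E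
  have hsub : anisoBox P r ⊆ closedBall 0 (r ^ 2 + r) := fun v hv => by
    rw [mem_closedBall_zero_iff]; exact norm_le_of_mem_anisoBox hP hv
  exact measure_ne_top_of_subset hsub measure_closedBall_lt_top.ne

/-- `P` is a point of density, with respect to anisotropic boxes, of the cone over `K`. -/
def IsAnisoDensityPt (K : Set E) (P : E) : Prop :=
  ∀ R > 0, ∀ ε > 0, ∃ r₀ > 0, ∀ r, 0 < r → r < r₀ →
    haarVol E {y | y - P ∈ anisoBox P (R * r) ∧ (‖y‖⁻¹ : ℝ) • y ∉ K} ≤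
      ENNReal.ofReal ε * haarVol E (anisoBox P r)

lemma measurableSet_offCone {K : Set E} (hK : IsClosed K) :
    MeasurableSet {y : E | (‖y‖⁻¹ : ℝ) • y ∉ K} := by
  have : Measurable fun y : E => (‖y‖⁻¹ : ℝ) • y := by fun_prop
  exact this hK.measurableSet.compl

lemma measurable_measure_inter_ball {N : Set E} (hN : MeasurableSet N) (x : E) (ρ : ℝ) :
    Measurable fun v : E => haarVol E (N ∩ ball (x + v) ρ) := by
  have hs : MeasurableSet {p : E × E | p.2 ∈ N ∧ dist p.2 (x + p.1) < ρ} :=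
    (measurable_snd hN).inter
        (isOpen_lt (continuous_snd.dist (continuous_const.add continuous_fst))
          continuous_const).measurableSet
  exact measurable_measure_prodMk_left hs

/-- The set of centres `v ∈ S` for which `N` occupies a fixed part of the ball of radius `ρ`
about `x + v` is small if `N` is. -/
lemma haarVol_inter_le_of_ball {N S : Set E} (hN : MeasurableSet N) (hS : MeasurableSet S) (x : E)
    {q δ : ℝ} (hq : 0 < q) (hδ : 0 < δ) {Y : Set E}
    (hY : ∀ v ∈ S, ∀ y ∈ ball (x + v) (q * δ), y ∈ Y) :
    haarVol E (S ∩ {v | haarVol E (ball 0 δ) ≤ haarVol E (N ∩ ball (x + v) (q * δ))}) ≤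
      ENNReal.ofReal (q ^ Module.finrank ℝ E) * haarVol E (N ∩ Y) := by
  have hprop : ProperSpace E := FiniteDimensional.proper ℂ E
  have hm := measurable_measure_inter_ball hN x (q * δ)
  have hball : ∀ y : E, haarVol E (ball y (q * δ)) =
      ENNReal.ofReal (q ^ Module.finrank ℝ E) * haarVol E (ball 0 δ) := fun y =>
    Measure.addHaar_ball_mul_of_pos _ y hq δ
  have hc0 : haarVol E (ball (0 : E) δ) ≠ 0 := (measure_ball_pos _ _ hδ).ne'
  have hct : haarVol E (ball (0 : E) δ) ≠ ⊤ := measure_ball_lt_top.ne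
  -- Markov's inequality for the volume of `N` in the ball about `x + v`.
  have h1 := mul_meas_ge_le_lintegral (μ := (haarVol E).restrict S) hm (haarVol E (ball 0 δ))
  rw [Measure.restrict_apply (measurableSet_le measurable_const hm), Set.inter_comm] at h1
  -- By Tonelli, each `y` is counted by centres `v` in the ball of radius `q * δ` about `y - x`,
  -- whose volume is the dilation factor times that of `ball 0 δ`.
  have h2 : ∫⁻ v in S, haarVol E (N ∩ ball (x + v) (q * δ)) ∂(haarVol E) ≤
      haarVol E (N ∩ Y) * (ENNReal.ofReal (q ^ Module.finrank ℝ E) * haarVol E (ball 0 δ)) := by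
    set g : E → E → ENNReal := fun v y =>
      {p : E × E | p.2 ∈ N ∧ dist p.2 (x + p.1) < q * δ}.indicator 1 (v, y) with hg
    have hs : MeasurableSet {p : E × E | p.2 ∈ N ∧ dist p.2 (x + p.1) < q * δ} :=
      (measurable_snd hN).inter
        (isOpen_lt (continuous_snd.dist (continuous_const.add continuous_fst))
          continuous_const).measurableSet
    have hgm : Measurable (Function.uncurry g) := measurable_one.indicator hs
    have h3 : ∀ v, haarVol E (N ∩ ball (x + v) (q * δ)) = ∫⁻ y, g v y ∂(haarVol E) := by
      intro v
      rw [← lintegral_indicator_one (hN.inter measurableSet_ball)]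
      rfl
    simp_rw [h3]
    rw [lintegral_lintegral_swap hgm.aemeasurable]
    -- `Y` is an arbitrary set, so a measurable hull of `N ∩ Y` replaces it at no cost in measure.
    set T := toMeasurable (haarVol E) (N ∩ Y) with hT
    have hTs : N ∩ Y ⊆ T := subset_toMeasurable _ _
    have h4 : ∀ y, ∫⁻ v in S, g v y ∂(haarVol E) ≤
        T.indicator (fun _ => ENNReal.ofReal (q ^ Module.finrank ℝ E) * haarVol E (ball 0 δ)) y := by
      intro y
      by_cases hyT : y ∈ T
      · rw [Set.indicator_of_mem hyT, ← hball (y - x),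
          ← lintegral_indicator_one measurableSet_ball]
        refine (setLIntegral_le_lintegral _ _).trans (lintegral_mono fun v => ?_)
        by_cases h5 : (v, y) ∈ {p : E × E | p.2 ∈ N ∧ dist p.2 (x + p.1) < q * δ}
        · have h6 : v ∈ ball (y - x) (q * δ) := by
            have := h5.2
            rw [dist_eq_norm, ← norm_neg] at this
            rw [mem_ball, dist_eq_norm]
            have h7 : v - (y - x) = -(y - (x + v)) := by abel
            rw [h7]; exact this
          simp only [hg]
          rw [Set.indicator_of_mem h5, Set.indicator_of_mem h6]
          exact le_rfl
        · simp only [hg]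
          rw [Set.indicator_of_notMem h5]
          exact zero_le
      · rw [Set.indicator_of_notMem hyT, nonpos_iff_eq_zero]
        rw [setLIntegral_congr_fun (g := fun _ => 0) hS, lintegral_zero]
        intro v hv
        simp only [hg]
        refine Set.indicator_of_notMem (fun h => hyT (hTs ⟨h.1, hY v hv y h.2⟩)) _
    refine (lintegral_mono h4).trans ?_
    rw [lintegral_indicator_const (measurableSet_toMeasurable _ _), measure_toMeasurable, mul_comm]
  refine (ENNReal.mul_le_mul_iff_right hc0 hct).1 ?_
  refine (h1.trans h2).trans_eq ?_
  ring

end Density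

/-! ### Estimates in the admissible regions at density points. -/

section Boundedness

variable {E : Type*} [NormedAddCommGroup E] [InnerProductSpace ℂ E] [FiniteDimensional ℂ E]
  [MeasurableSpace E] [BorelSpace E] {f : E → ℂ} {K : Set E} {P : E} {α β M : ℝ}

lemma toReal_div_le_of_le_ofReal_mul {a b : ENNReal} {c : ℝ} (hc : 0 ≤ c) (hb0 : b ≠ 0)
    (hb : b ≠ ⊤) (h : a ≤ ENNReal.ofReal c * b) : a.toReal / b.toReal ≤ c := by
  have h1 : a.toReal ≤ c * b.toReal := by
    have := ENNReal.toReal_mono (ENNReal.mul_ne_top ENNReal.ofReal_ne_top hb) h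
    rwa [ENNReal.toReal_mul, ENNReal.toReal_ofReal hc] at this
  exact (div_le_iff₀ (ENNReal.toReal_pos hb0 hb)).2 h1

omit [FiniteDimensional ℂ E] [MeasurableSpace E] [BorelSpace E] in
/-- A point `w` of the ball such that no Stolz region with vertex in `K` contains `w` is far from
the cone over `K`. -/
lemma ball_subset_offCone (hKs : K ⊆ sphere 0 1) {w : E} {δ : ℝ} (hδw : ‖w‖ + δ ≤ 1)
    (hδ : 2 * δ ≤ (α - 1) * (1 - ‖w‖))
    (hw : ∀ Q ∈ K, ¬ ‖w - Q‖ < α * (1 - ‖w‖)) :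
    ball w δ ⊆ {y : E | (‖y‖⁻¹ : ℝ) • y ∉ K} := by
  intro y hy hyK
  rw [mem_ball, dist_eq_norm] at hy
  have hQ := mem_sphere_zero_iff_norm.1 (hKs hyK)
  have hy0 : ‖y‖ ≠ 0 := by
    intro h0
    rw [h0, inv_zero, zero_smul, norm_zero] at hQ
    exact zero_ne_one hQ
  have hy1 : ‖y‖ ≤ ‖w‖ + δ := by
    have := norm_le_norm_add_norm_sub' y w
    linarith
  have hy2 : ‖w‖ - δ ≤ ‖y‖ := by
    have := norm_le_norm_add_norm_sub y w
    linarith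
  have hyQ : ‖y - (‖y‖⁻¹ : ℝ) • y‖ = 1 - ‖y‖ := by
    have : y - (‖y‖⁻¹ : ℝ) • y = (1 - ‖y‖⁻¹ : ℝ) • y := by rw [sub_smul, one_smul]
    have hpos : 0 < ‖y‖ := (norm_nonneg y).lt_of_ne' hy0
    have hinv : 1 ≤ ‖y‖⁻¹ := (one_le_inv₀ hpos).2 (hy1.trans hδw)
    rw [this, norm_smul, Real.norm_eq_abs, abs_of_nonpos (by linarith), neg_mul, sub_mul,
      inv_mul_cancel₀ hy0]
    ring
  -- If `y` projected to a point `Q` of `K`, then `‖w - Q‖ ≤ ‖w - y‖ + (1 - ‖y‖) < 2 * δ + (1 -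
  -- ‖w‖)`, which puts `w` in the Stolz region at `Q`.
  refine hw _ hyK ?_
  have h1 := norm_sub_le_norm_sub_add_norm_sub w y ((‖y‖⁻¹ : ℝ) • y)
  rw [norm_sub_rev w y] at h1
  nlinarith

/-- The radii `t / 4` and `3 / 2 * t` have ratio `1 / 6`, and `(2 / 3) ^ 5 < 1 / 6`. So with at most
a fifth of the centres bad, the Hartogs radius exceeds `t`, the distance from the shifted centre
back to `z`. -/
lemma lt_mul_one_sixth_rpow {t b : ℝ} (ht : 0 < t) (hb : b ≤ 1 / 5) :
    t < 3 / 2 * t * ((t / 4) / (3 / 2 * t)) ^ b := by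
  have h1 : (t / 4) / (3 / 2 * t) = 1 / 6 := by field_simp; norm_num
  rw [h1]
  have h2 : (1 / 6 : ℝ) ^ (1 / 5 : ℝ) ≤ (1 / 6 : ℝ) ^ b :=
    Real.rpow_le_rpow_of_exponent_ge (by norm_num) (by norm_num) hb
  have h3 : (2 / 3 : ℝ) < (1 / 6 : ℝ) ^ (1 / 5 : ℝ) := by
    have h4 : (2 / 3 : ℝ) = ((2 / 3 : ℝ) ^ (5 : ℝ)) ^ (1 / 5 : ℝ) := by
      rw [← Real.rpow_mul (by norm_num)]; norm_num
    rw [h4]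
    refine Real.rpow_lt_rpow (by positivity) ?_ (by norm_num)
    norm_num
  nlinarith

/-- The step of the induction on the height: a bound at height at least `4 t / 3` propagates to
height `t`. -/
lemma norm_le_of_bound_above (hf : DifferentiableOn ℂ f (ball 0 1)) (hK : IsClosed K)
    (hKs : K ⊆ sphere 0 1) (hα : 1 < α) (hM : 0 < M)
    (hb : ∀ Q ∈ K, ∀ z, ‖z‖ < 1 → ‖z - Q‖ < α * (1 - ‖z‖) → ‖f z‖ ≤ M)
    (hP : ‖P‖ = 1) (hβ : 4 ≤ β) {r t : ℝ} (hr : 0 < r) (hrt : r ^ 2 = t)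
    (ht : t * (16 * (1 + β)) ≤ 1) {z : E} (hzt : 1 - ‖z‖ = t)
    (hzA : ‖1 - inner ℂ P z‖ < β * t)
    (habove : ∀ w, ‖w‖ < 1 → ‖1 - inner ℂ P w‖ < β * (1 - ‖w‖) → 4 / 3 * t ≤ 1 - ‖w‖ → ‖f w‖ ≤ M)
    {q : ℝ} (hq : q * min (α - 1) 1 = 16)
    (hdens : haarVol E {y | y - P ∈ anisoBox P ((β + 4) * r) ∧ (‖y‖⁻¹ : ℝ) • y ∉ K} ≤
      ENNReal.ofReal (1 / (5 * q ^ Module.finrank ℝ E)) *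
        haarVol E (anisoBox P (1 / (32 * β) * r))) : ‖f z‖ ≤ M := by
  have ht0 : 0 < t := by rw [← hrt]; positivity
  have ht1 : t ≤ 1 / 80 := by nlinarith
  have hr1 : r ≤ 1 := by nlinarith
  have hz1 : ‖z‖ ≤ 1 := by linarith
  set m := min (α - 1) 1 with hm
  have hm0 : 0 < m := lt_min (by linarith) one_pos
  have hmα : m ≤ α - 1 := min_le_left _ _
  have hm1 : m ≤ 1 := min_le_right _ _
  have hq0 : 0 < q := by
    by_contra h
    nlinarith
  -- On discs of radius `3 / 2 * t` the remaining depth is at least `3 / 8 * t`, so `2 * δ` fits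
  -- into `(α - 1)` times it. The `δ`-ball about a point of such a disc lies in the ball of radius
  -- `q * δ = 2 * t` about the centre.
  set δ := m * t / 8 with hδ
  have hδ0 : 0 < δ := by positivity
  have hqδ : q * δ = 2 * t := by rw [hδ]; linear_combination t / 8 * hq
  set S := anisoBox P (1 / (32 * β) * r) with hS
  have hκr : 0 < 1 / (32 * β) * r := by positivity
  have hS0 : haarVol E S ≠ 0 := haarVol_anisoBox_ne_zero P hκr
  have hSt : haarVol E S ≠ ⊤ := haarVol_anisoBox_ne_top hP _
  have hSm : MeasurableSet S := (isOpen_anisoBox _ _).measurableSet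
  set x := z - (t : ℂ) • P with hx
  set N : Set E := {y : E | (‖y‖⁻¹ : ℝ) • y ∉ K} with hN
  have hNm : MeasurableSet N := measurableSet_offCone hK
  set Bad : Set E := {v | haarVol E (ball 0 δ) ≤ haarVol E (N ∩ ball (x + v) (q * δ))} with hBad
  have hBadm : MeasurableSet Bad :=
    measurableSet_le measurable_const (measurable_measure_inter_ball hNm x _)
  have hnorm : ∀ v ∈ S, ‖x + v‖ ≤ 1 - 15 / 8 * t := fun v hv =>
    norm_sub_smul_add_le hP hβ hr hrt ht hzt hzA hv
  have hnorml : ∀ v ∈ S, ∀ l : ℂ, ‖x + v + l • P‖ ≤ 1 - 15 / 8 * t + ‖l‖ := fun v hv l => by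
    refine (norm_add_le _ _).trans (add_le_add (hnorm v hv) ?_)
    rw [norm_smul, hP, mul_one]
  have hratio : (haarVol E (S ∩ Bad)).toReal / (haarVol E S).toReal ≤ 1 / 5 := by
    refine toReal_div_le_of_le_ofReal_mul (by norm_num) hS0 hSt ?_
    refine (haarVol_inter_le_of_ball hNm hSm x hq0 hδ0
      (Y := {y | y - P ∈ anisoBox P ((β + 4) * r)}) ?_).trans ?_
    · intro v hv y hy
      rw [hqδ, mem_ball, dist_eq_norm] at hy
      exact sub_mem_anisoBox hP hβ hr hr1 hrt hz1 hzA hv ht0.le le_rfl hy.le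
    · have hset : N ∩ {y | y - P ∈ anisoBox P ((β + 4) * r)} =
          {y | y - P ∈ anisoBox P ((β + 4) * r) ∧ (‖y‖⁻¹ : ℝ) • y ∉ K} := by
        ext y; exact and_comm
      rw [hset]
      refine (mul_le_mul_right hdens _).trans_eq ?_
      rw [← mul_assoc, ← ENNReal.ofReal_mul (by positivity)]
      congr 2
      field_simp
  have hzx : z = x + (t : ℂ) • P := by rw [hx]; abel
  rw [hzx]
  refine norm_le_of_hartogs isOpen_ball hf hSm (fun c hc v hv => smul_mem_anisoBox hc hv) hS0 hSt
    hBadm (ρ₁ := t / 4) (ρ₂ := 3 / 2 * t) (by positivity) (by linarith) hM ?_ ?_ ?_ ?_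
  · intro v hv l hl
    rw [mem_ball_zero_iff]
    have := hnorml v hv l
    linarith
  -- The small discs have depth at least `15 / 8 * t - t / 4 = 13 / 8 * t`. This exceeds `4 / 3 *
  -- t`, and the extra `5 / 8 * β * t` pays for the displacement in direction `P`, as `4 ≤ β`.
  · intro v hv l hl
    have h1 := hnorml v hv l
    refine habove _ (by linarith) ?_ (by linarith)
    have h2 : (1 : ℂ) - inner ℂ P (x + v + l • P) =
        (1 - inner ℂ P z) + t - inner ℂ P v - l := by
      rw [hx, inner_add_right, inner_add_right, inner_sub_right, inner_smul_right,
        inner_smul_right, inner_self_of_norm_one hP]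
      ring
    have h3 : ‖(1 - inner ℂ P z) + t - inner ℂ P v - l‖ ≤
        ‖1 - inner ℂ P z‖ + t + ‖inner ℂ P v‖ + ‖l‖ := by
      refine (norm_sub_le _ _).trans (add_le_add ((norm_sub_le _ _).trans (add_le_add
        ((norm_add_le _ _).trans (add_le_add le_rfl ?_)) le_rfl)) le_rfl)
      rw [Complex.norm_real, Real.norm_of_nonneg ht0.le]
    have h4 : ‖inner ℂ P v‖ < (1 / (32 * β) * r) ^ 2 := hv.1
    have h5 : (1 / (32 * β) * r) ^ 2 ≤ t / 256 := by
      have h6 : 1 / (32 * β) ≤ 1 / 16 := by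
        apply one_div_le_one_div_of_le <;> linarith
      have h7 : 0 < 1 / (32 * β) := by positivity
      rw [mul_pow, hrt]
      have h8 : (1 / (32 * β)) ^ 2 ≤ (1 / 16) ^ 2 := pow_le_pow_left₀ h7.le h6 2
      nlinarith
    rw [h2]
    have h9 : β * (13 / 8 * t) ≤ β * (1 - ‖x + v + l • P‖) := by
      gcongr; linarith
    have h10 : 4 * t ≤ β * t := by gcongr
    linarith
  · intro v hv hvB l hl
    have h1 := hnorml v hv l
    -- If the bound failed at a point, that point would lie in no Stolz region over `K`. A whole
    -- `δ`-ball around it would then miss the cone over `K`, making the centre bad.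
    by_contra hcon
    have hw1 : ‖x + v + l • P‖ < 1 := by linarith
    have hno : ∀ Q ∈ K, ¬ ‖x + v + l • P - Q‖ < α * (1 - ‖x + v + l • P‖) :=
      fun Q hQ hlt => hcon (hb Q hQ _ hw1 hlt)
    have hδt : δ ≤ t / 8 := by rw [hδ]; nlinarith
    have hsub := ball_subset_offCone hKs (w := x + v + l • P) (δ := δ) (by linarith)
      (by
        have h2 : m * (3 / 8 * t) ≤ (α - 1) * (1 - ‖x + v + l • P‖) := by
          gcongr; linarith
        have h3 : 0 < m * t := by positivity
        rw [hδ]; linarith) hno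
    refine hvB ?_
    change haarVol E (ball 0 δ) ≤ haarVol E (N ∩ ball (x + v) (q * δ))
    rw [← Measure.addHaar_ball_center (haarVol E) (x + v + l • P)]
    refine measure_mono (Set.subset_inter hsub ?_)
    refine ball_subset_ball' ?_
    rw [dist_eq_norm, add_sub_cancel_left, norm_smul, hP, mul_one, hqδ]
    linarith
  · rw [Complex.norm_real, Real.norm_of_nonneg ht0.le]
    exact lt_mul_one_sixth_rpow ht0 hratio

/-- A function that is bounded on the Stolz regions with vertices in `K` is bounded on the
admissible regions at the points of density of `K`. -/
theorem exists_bound_admissible (hf : DifferentiableOn ℂ f (ball 0 1)) (hK : IsClosed K)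
    (hKs : K ⊆ sphere 0 1) (hα : 1 < α)
    (hb : ∀ Q ∈ K, ∀ z, ‖z‖ < 1 → ‖z - Q‖ < α * (1 - ‖z‖) → ‖f z‖ ≤ M)
    (hP : ‖P‖ = 1) (hd : IsAnisoDensityPt K P) (hβ : 4 ≤ β) :
    ∃ M', ∀ z, ‖z‖ < 1 → ‖1 - inner ℂ P z‖ < β * (1 - ‖z‖) → ‖f z‖ ≤ M' := by
  have hprop : ProperSpace E := FiniteDimensional.proper ℂ E
  set m := min (α - 1) 1 with hm
  have hm0 : 0 < m := lt_min (by linarith) one_pos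
  set κ := 1 / (32 * β) with hκ
  have hκ0 : 0 < κ := by positivity
  set q := 16 / m with hq
  have hq0 : 0 < q := by positivity
  obtain ⟨r₀, hr₀, hdens⟩ := hd ((β + 4) / κ) (by positivity)
    (1 / (5 * q ^ Module.finrank ℝ E)) (by positivity)
  set t₀ := min ((r₀ / κ) ^ 2 / 2) (1 / (16 * (1 + β))) with ht₀
  have ht₀0 : 0 < t₀ := by rw [ht₀]; positivity
  obtain ⟨C, hC⟩ := (isCompact_closedBall (0 : E) (1 - t₀)).exists_bound_of_continuousOn
    (hf.continuousOn.mono (closedBall_subset_ball (by linarith)))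
  -- One constant serves all heights: `M` on Stolz regions, `C` on the compact part, and `1` for the
  -- positivity that the Hartogs lemma requires.
  set M' := max (max M C) 1 with hM'
  have hMM' : M ≤ M' := (le_max_left _ _).trans (le_max_left _ _)
  have hCM' : C ≤ M' := (le_max_right _ _).trans (le_max_left _ _)
  have hM'0 : 0 < M' := one_pos.trans_le (le_max_right _ _)
  have hbase : ∀ z, t₀ ≤ 1 - ‖z‖ → ‖f z‖ ≤ M' := fun z hz =>
    (hC z (by rw [mem_closedBall_zero_iff]; linarith)).trans hCM'
  -- Each step lowers the height by the factor `3 / 4`, the inverse of the `4 / 3` in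
  -- `norm_le_of_bound_above`, without enlarging `M'`.
  have key : ∀ k : ℕ, ∀ z, ‖z‖ < 1 → ‖1 - inner ℂ P z‖ < β * (1 - ‖z‖) →
      (3 / 4 : ℝ) ^ k * t₀ ≤ 1 - ‖z‖ → ‖f z‖ ≤ M' := by
    intro k
    induction k with
    | zero => intro z _ _ hz; exact hbase z (by simpa using hz)
    | succ k ih =>
      intro z hz1 hzA hzk
      rcases le_or_gt t₀ (1 - ‖z‖) with h | h
      · exact hbase z h
      have ht0 : 0 < 1 - ‖z‖ := by linarith
      have hr0 : 0 < √(1 - ‖z‖) := Real.sqrt_pos.2 ht0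
      have hκr : κ * √(1 - ‖z‖) < r₀ := by
        have : √(1 - ‖z‖) < r₀ / κ := by
          rw [Real.sqrt_lt' (by positivity)]
          have h1 : t₀ ≤ (r₀ / κ) ^ 2 / 2 := min_le_left _ _
          have h2 : 0 < (r₀ / κ) ^ 2 := by positivity
          linarith
        rw [lt_div_iff₀ hκ0] at this
        linarith
      have hd' := hdens (κ * √(1 - ‖z‖)) (by positivity) hκr
      have hR : (β + 4) / κ * (κ * √(1 - ‖z‖)) = (β + 4) * √(1 - ‖z‖) := by
        field_simp
      rw [hR] at hd'
      refine norm_le_of_bound_above hf hK hKs hα hM'0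
        (fun Q hQ z hz hzQ => (hb Q hQ z hz hzQ).trans hMM') hP hβ hr0 (Real.sq_sqrt ht0.le) ?_ rfl
        hzA ?_ (q := q) ?_ hd'
      · have h1 : t₀ ≤ 1 / (16 * (1 + β)) := min_le_right _ _
        rw [← le_div_iff₀ (by positivity)]
        linarith
      · intro w hw hwA hwt
        refine ih w hw hwA ?_
        rw [pow_succ] at hzk
        linarith
      · rw [hq, ← hm]; field_simp
  refine ⟨M', fun z hz hzA => ?_⟩
  obtain ⟨k, hk⟩ := exists_pow_lt_of_lt_one (show 0 < (1 - ‖z‖) / t₀ by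
    have : 0 < 1 - ‖z‖ := by linarith
    positivity) (by norm_num : (3 / 4 : ℝ) < 1)
  exact key k z hz hzA ((lt_div_iff₀ ht₀0).1 hk).le

set_option maxHeartbeats 800000 in
/-- If `f` is bounded on admissible regions at `P` and `f` is close to `c` along the radii that end
in a set for which `P` is a point of density, then `f` is close to `c` in the admissible regions
at `P`. -/
theorem exists_forall_norm_sub_le (hf : DifferentiableOn ℂ f (ball 0 1)) (hK : IsClosed K)
    {c : ℂ} {ε ρ₀ : ℝ} (hε : 0 < ε) (hρ₀ : ρ₀ < 1)
    (hc : ∀ Q ∈ K, ∀ ρ : ℝ, ρ₀ < ρ → ρ < 1 → ‖f ((ρ : ℂ) • Q) - c‖ ≤ ε)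
    (hP : ‖P‖ = 1) (hd : IsAnisoDensityPt K P) (hβ : 4 ≤ β)
    (hb : ∀ z, ‖z‖ < 1 → ‖1 - inner ℂ P z‖ < (2 * β + 2) * (1 - ‖z‖) → ‖f z‖ ≤ M) :
    ∃ t₀ > 0, ∀ z, ‖z‖ < 1 → ‖1 - inner ℂ P z‖ < β * (1 - ‖z‖) → 1 - ‖z‖ < t₀ →
      ‖f z - c‖ ≤ 2 * ε := by
  set κ := 1 / (32 * β) with hκ
  have hκ0 : 0 < κ := by positivity
  have hκ1 : κ ≤ 1 / 16 := by rw [hκ]; apply one_div_le_one_div_of_le <;> linarith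
  set a := Real.log ε with ha
  set A := Real.log (max ε (M + ‖c‖)) with hA
  have haA : a ≤ A := Real.log_le_log hε (le_max_left _ _)
  -- A bad proportion `η` raises the logarithmic mean by at most `(A - a) * η ≤ log 2`, hence the
  -- final factor `2`. The summand `1` avoids a zero denominator.
  set η := Real.log 2 / (A - a + 1) with hη
  have hlog2 : 0 < Real.log 2 := Real.log_pos one_lt_two
  have hAa : 0 < A - a + 1 := by linarith
  have hη0 : 0 < η := by positivity
  obtain ⟨r₀, hr₀, hdens⟩ := hd ((β + 4) / κ) (by positivity) η hη0
  -- The third bound ensures `‖z + v‖ > ρ₀`: for `r = √t`, both the depth of `z` and the size of the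
  -- box are at most `r`, and `2 * r < 1 - ρ₀`.
  set s := min (min (r₀ / κ) (1 / 2)) ((1 - ρ₀) / 3) with hs
  have hs0 : 0 < s := by
    have : 0 < 1 - ρ₀ := by linarith
    rw [hs]; positivity
  refine ⟨s ^ 2, by positivity, fun z hz hzA hzs => ?_⟩
  set t := 1 - ‖z‖ with ht
  have ht0 : 0 < t := by linarith
  set r := √t with hr
  have hr0 : 0 < r := Real.sqrt_pos.2 ht0
  have hrt : r ^ 2 = t := Real.sq_sqrt ht0.le
  have hrs : r < s := (Real.sqrt_lt' hs0).2 hzs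
  have hs1 : s ≤ r₀ / κ := (min_le_left _ _).trans (min_le_left _ _)
  have hs2 : s ≤ 1 / 2 := (min_le_left _ _).trans (min_le_right _ _)
  have hs3 : s ≤ (1 - ρ₀) / 3 := min_le_right _ _
  have hr1 : r ≤ 1 := by linarith
  have ht2 : t ≤ 1 / 2 := by nlinarith
  have hκr : κ * r < r₀ := by
    have := (lt_div_iff₀ hκ0).1 (hrs.trans_le hs1)
    linarith
  have hd' := hdens (κ * r) (by positivity) hκr
  have hR : (β + 4) / κ * (κ * r) = (β + 4) * r := by field_simp
  rw [hR] at hd'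
  set S := anisoBox P (κ * r) with hS
  have hS0 : haarVol E S ≠ 0 := haarVol_anisoBox_ne_zero P (by positivity)
  have hSt : haarVol E S ≠ ⊤ := haarVol_anisoBox_ne_top hP _
  have hbal : ∀ c : ℂ, ‖c‖ ≤ 1 → ∀ v ∈ S, c • v ∈ S := fun c hc v hv => smul_mem_anisoBox hc hv
  have hnorm : ∀ v ∈ S, ‖z + v‖ ≤ 1 - t / 2 := fun v hv =>
    norm_add_le_of_mem_admissible hP hβ hr0 hrt ht2 rfl hzA hv
  set N : Set E := {y : E | (‖y‖⁻¹ : ℝ) • y ∉ K} with hN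
  have hNm : MeasurableSet N := measurableSet_offCone hK
  have hratio : (haarVol E (S ∩ (fun v => z + v) ⁻¹' N)).toReal / (haarVol E S).toReal ≤ η := by
    refine toReal_div_le_of_le_ofReal_mul hη0.le hS0 hSt (le_trans ?_ hd')
    rw [← measure_preimage_add (haarVol E) z
      {y | y - P ∈ anisoBox P ((β + 4) * r) ∧ (‖y‖⁻¹ : ℝ) • y ∉ K}]
    refine measure_mono fun v hv => ⟨?_, hv.2⟩
    refine sub_mem_anisoBox hP hβ hr0 hr1 hrt hz.le hzA hv.1 le_rfl ht0.le ?_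
    simpa using ht0.le
  have hexpA : Real.exp A = max ε (M + ‖c‖) := Real.exp_log (lt_max_of_lt_left hε)
  have hexpa : Real.exp a = ε := Real.exp_log hε
  have key := norm_le_exp_of_balanced (G := fun w => f w - c) (x := z)
    (isOpen_anisoBox P (κ * r)).measurableSet hbal ?_ hS0 hSt
    (hNm.preimage (measurable_const_add z)) haA ?_ ?_
  · refine key.trans ?_
    have h1 : (A - a) * ((haarVol E (S ∩ (fun v => z + v) ⁻¹' N)).toReal / (haarVol E S).toReal) ≤
        Real.log 2 := by
      refine (mul_le_mul_of_nonneg_left hratio (by linarith)).trans ?_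
      rw [hη, mul_div_assoc', div_le_iff₀ hAa]
      nlinarith
    refine (Real.exp_le_exp.2 (add_le_add_right h1 a)).trans_eq ?_
    rw [Real.exp_add, hexpa, Real.exp_log two_pos, mul_comm]
  · intro v hv
    have hcont : Continuous fun l : ℂ => z + l • v := by fun_prop
    refine ⟨(fun l : ℂ => z + l • v) ⁻¹' ball 0 1, isOpen_ball.preimage hcont, ?_, ?_⟩
    · intro l hl
      rw [Set.mem_preimage, mem_ball_zero_iff]
      have := hnorm _ (hbal l (by simpa using hl) v hv)
      linarith
    · refine DifferentiableOn.sub_const ?_ _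
      exact hf.comp (by fun_prop) (Set.mapsTo_preimage _ _)
  · intro v hv
    rw [hexpA]
    refine (norm_sub_le _ _).trans (le_max_of_le_right (add_le_add ?_ le_rfl))
    have h1 := hnorm v hv
    refine hb _ (by linarith) ?_
    -- The shift adds at most `t` to `‖1 - ⟪P, z⟫‖ < β * t`, while the depth may drop to `t / 2`;
    -- this is why aperture `2 * β + 2` is needed.
    have h2 : (1 : ℂ) - inner ℂ P (z + v) = (1 - inner ℂ P z) - inner ℂ P v := by
      rw [inner_add_right]; ring
    have h4 : ‖inner ℂ P v‖ < (κ * r) ^ 2 := hv.1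
    have h5 : (κ * r) ^ 2 ≤ t := by
      rw [mul_pow, hrt]
      have : κ ^ 2 ≤ 1 := by nlinarith
      nlinarith
    have h6 := norm_sub_le (1 - inner ℂ P z) (inner ℂ P v)
    have h7 : (2 * β + 2) * (t / 2) ≤ (2 * β + 2) * (1 - ‖z + v‖) := by gcongr; linarith
    rw [h2]
    linarith
  · intro v hv hvN
    have hQ : (‖z + v‖⁻¹ : ℝ) • (z + v) ∈ K := not_not.1 hvN
    have h1 := hnorm v hv
    have h2 := norm_le_of_mem_anisoBox hP hv
    have h3 : ‖z‖ - ‖v‖ ≤ ‖z + v‖ := by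
      have := norm_sub_le (z + v) v
      rw [add_sub_cancel_right] at this
      linarith
    have h5 : (κ * r) ^ 2 + κ * r ≤ r := by
      have h6 : κ * r ≤ r / 16 := by nlinarith
      have h7 : 0 < κ * r := by positivity
      nlinarith
    have h8 : t ≤ r := by rw [← hrt]; nlinarith
    have h9 : ‖z‖ = 1 - t := by linarith
    have h10 := hc _ hQ ‖z + v‖ (by linarith) (by linarith)
    have h11 : ‖z + v‖ ≠ 0 := by
      have : t + r < 1 := by nlinarith
      linarith
    have h12 : ((‖z + v‖ : ℝ) : ℂ) • ((‖z + v‖⁻¹ : ℝ) • (z + v)) = z + v := by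
      rw [Complex.coe_smul, smul_smul, mul_inv_cancel₀ h11, one_smul]
    rw [h12] at h10
    rw [hexpa]
    exact h10

end Boundedness

/-! ### The nonisotropic metric on the sphere. -/

/-- The unit sphere, to be equipped with the nonisotropic metric `√‖1 - ⟪P, Q⟫‖`. -/
@[ext]
structure AnisoSphere (E : Type*) [NormedAddCommGroup E] where
  /-- The underlying unit vector. -/
  val : E
  norm_val : ‖val‖ = 1

section Metric

variable {E : Type*} [NormedAddCommGroup E] [InnerProductSpace ℂ E]

lemma norm_one_sub_inner_comm (a b : E) : ‖1 - inner ℂ a b‖ = ‖1 - inner ℂ b a‖ := by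
  rw [← inner_conj_symm a b, ← RCLike.norm_conj (1 - inner ℂ b a)]
  simp

/-- Splitting `a` and `c` along `b` bounds `‖1 - ⟪a, c⟫‖` by `x ^ 2 + y ^ 2` plus the product of the
orthogonal parts. By `norm_perpPart_sq_le` that product is at most `2 * x * y`, which completes the
square. -/
lemma sqrt_norm_one_sub_inner_triangle {a b c : E} (ha : ‖a‖ = 1) (hb : ‖b‖ = 1) (hc : ‖c‖ = 1) :
    √‖1 - inner ℂ a c‖ ≤ √‖1 - inner ℂ a b‖ + √‖1 - inner ℂ b c‖ := by
  refine Real.sqrt_le_iff.2 ⟨by positivity, ?_⟩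
  have hx := Real.sq_sqrt (norm_nonneg (1 - inner ℂ a b))
  have hy := Real.sq_sqrt (norm_nonneg (1 - inner ℂ b c))
  set x := √‖1 - inner ℂ a b‖
  set y := √‖1 - inner ℂ b c‖
  have hx0 : 0 ≤ x := Real.sqrt_nonneg _
  have hy0 : 0 ≤ y := Real.sqrt_nonneg _
  have h1 : ‖perpPart b a‖ ^ 2 ≤ 2 * x ^ 2 :=
    norm_perpPart_sq_le hb ha.le (by rw [norm_one_sub_inner_comm, hx])
  have h2 : ‖perpPart b c‖ ^ 2 ≤ 2 * y ^ 2 := norm_perpPart_sq_le hb hc.le hy.ge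
  have h3 : ‖perpPart b a‖ * ‖perpPart b c‖ ≤ 2 * (x * y) := by
    refine le_of_sq_le_sq ?_ (by positivity)
    calc (‖perpPart b a‖ * ‖perpPart b c‖) ^ 2 = ‖perpPart b a‖ ^ 2 * ‖perpPart b c‖ ^ 2 := by ring
      _ ≤ (2 * x ^ 2) * (2 * y ^ 2) := by gcongr
      _ = (2 * (x * y)) ^ 2 := by ring
  have h4 : 1 - inner ℂ a c =
      (1 - inner ℂ a b) + inner ℂ a b * (1 - inner ℂ b c) -
        inner ℂ (perpPart b a) (perpPart b c) := by
    simp only [perpPart, inner_sub_left, inner_sub_right, inner_smul_left, inner_smul_right,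
      inner_conj_symm, inner_self_of_norm_one hb]
    ring
  have h5 : ‖inner ℂ a b‖ ≤ 1 := by simpa [hb] using norm_inner_le_of_norm_one ha b
  have h6 := norm_inner_le_norm (𝕜 := ℂ) (perpPart b a) (perpPart b c)
  have h7 : ‖1 - inner ℂ a c‖ ≤ ‖1 - inner ℂ a b‖ + ‖1 - inner ℂ b c‖ +
      ‖inner ℂ (perpPart b a) (perpPart b c)‖ := by
    rw [h4]
    refine (norm_sub_le _ _).trans (add_le_add ((norm_add_le _ _).trans
      (add_le_add le_rfl ?_)) le_rfl)
    rw [norm_mul]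
    exact mul_le_of_le_one_left (norm_nonneg _) h5
  nlinarith

namespace AnisoSphere

noncomputable instance : PseudoMetricSpace (AnisoSphere E) where
  dist P Q := √‖1 - inner ℂ P.1 Q.1‖
  dist_self P := by rw [inner_self_of_norm_one P.2]; simp
  dist_comm P Q := by rw [norm_one_sub_inner_comm]
  dist_triangle P Q R := sqrt_norm_one_sub_inner_triangle P.2 Q.2 R.2

lemma dist_def (P Q : AnisoSphere E) : dist P Q = √‖1 - inner ℂ P.1 Q.1‖ := rfl

lemma mem_closedBall_iff {P Q : AnisoSphere E} {r : ℝ} (hr : 0 ≤ r) :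
    Q ∈ closedBall P r ↔ ‖1 - inner ℂ P.1 Q.1‖ ≤ r ^ 2 := by
  rw [mem_closedBall, dist_comm, dist_def, Real.sqrt_le_iff]
  exact and_iff_right hr

/-- On unit vectors `‖P - Q‖ ^ 2 = 2 * re (1 - ⟪P, Q⟫)`. Together with `continuous_mk` this shows
that the metric induces the Euclidean topology, so closed sets and Borel sets are the usual ones. -/
lemma continuous_val : Continuous (fun P : AnisoSphere E => P.1) := by
  have hlip : ∀ P Q : AnisoSphere E, dist P.1 Q.1 ≤ 2 * dist P Q := by
    intro P Q
    have h1 : ‖P.1 - Q.1‖ ^ 2 = 2 * (1 - inner ℂ P.1 Q.1).re := by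
      rw [@norm_sub_sq ℂ, P.2, Q.2]; simp; ring
    have h2 := Complex.re_le_norm (1 - inner ℂ P.1 Q.1)
    rw [dist_eq_norm, dist_def]
    refine le_of_sq_le_sq ?_ (by positivity)
    rw [mul_pow, Real.sq_sqrt (norm_nonneg _), h1]
    nlinarith [norm_nonneg (1 - inner ℂ P.1 Q.1)]
  exact (LipschitzWith.of_dist_le_mul (K := 2) (by simpa using hlip)).continuous

lemma continuous_mk {X : Type*} [TopologicalSpace X] {g : X → E} (hg : Continuous g)
    (h : ∀ x, ‖g x‖ = 1) : Continuous (fun x => (⟨g x, h x⟩ : AnisoSphere E)) := by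
  rw [continuous_iff_continuousAt]
  intro x
  rw [ContinuousAt, tendsto_iff_dist_tendsto_zero]
  simp only [dist_def]
  have : Continuous fun y => √‖1 - inner ℂ (g y) (g x)‖ := by fun_prop
  have h2 := this.tendsto x
  rw [inner_self_of_norm_one (h x), sub_self, norm_zero, Real.sqrt_zero] at h2
  exact h2

instance [FiniteDimensional ℂ E] : SecondCountableTopology (AnisoSphere E) := by
  have hprop : ProperSpace E := FiniteDimensional.proper ℂ E
  have hc : Continuous (fun x : sphere (0 : E) 1 =>
      (⟨x.1, mem_sphere_zero_iff_norm.1 x.2⟩ : AnisoSphere E)) :=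
    continuous_mk continuous_subtype_val _
  have hsep : TopologicalSpace.SeparableSpace (AnisoSphere E) := by
    have := TopologicalSpace.isSeparable_range hc
    rw [← TopologicalSpace.isSeparable_univ_iff]
    convert this
    exact (Set.range_eq_univ.2 fun P : AnisoSphere E =>
      ⟨⟨P.1, mem_sphere_zero_iff_norm.2 P.2⟩, rfl⟩).symm
  exact UniformSpace.secondCountable_of_separable _

noncomputable instance : MeasurableSpace (AnisoSphere E) := borel _

instance : BorelSpace (AnisoSphere E) := ⟨rfl⟩

variable [Nontrivial E]

instance : Nonempty (AnisoSphere E) := by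
  obtain ⟨x, hx⟩ := exists_ne (0 : E)
  exact ⟨⟨((‖x‖⁻¹ : ℝ) : ℂ) • x, by
    rw [norm_smul, Complex.norm_real, norm_inv, norm_norm, inv_mul_cancel₀ (norm_ne_zero_iff.2 hx)]⟩⟩

open Classical in
/-- The radial projection to the sphere. -/
noncomputable def proj (y : E) : AnisoSphere E :=
  if h : y = 0 then Classical.arbitrary _ else ⟨(‖y‖⁻¹ : ℝ) • y, by
    rw [norm_smul, norm_inv, norm_norm, inv_mul_cancel₀ (norm_ne_zero_iff.2 h)]⟩

lemma proj_val {y : E} (hy : y ≠ 0) : (proj y).1 = (‖y‖⁻¹ : ℝ) • y := by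
  rw [proj, dif_neg hy]

lemma norm_smul_proj (y : E) : (‖y‖ : ℝ) • (proj y).1 = y := by
  rcases eq_or_ne y 0 with rfl | hy
  · simp
  · rw [proj_val hy, smul_smul, mul_inv_cancel₀ (norm_ne_zero_iff.2 hy), one_smul]

lemma proj_smul {t : ℝ} (ht : 0 < t) (y : E) : proj (t • y) = proj y := by
  rcases eq_or_ne y 0 with rfl | hy
  · simp
  · apply AnisoSphere.ext
    rw [proj_val hy, proj_val (smul_ne_zero ht.ne' hy), norm_smul, Real.norm_of_nonneg ht.le,
      smul_smul, mul_inv, mul_comm t⁻¹, mul_assoc, inv_mul_cancel₀ ht.ne', mul_one]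

lemma measurable_proj [MeasurableSpace E] [BorelSpace E] : Measurable (proj : E → AnisoSphere E) := by
  refine measurable_of_continuousOn_compl_singleton 0 ?_
  rw [continuousOn_iff_continuous_domRestrict]
  have hc : Continuous fun y : ({0}ᶜ : Set E) => (‖y.1‖⁻¹ : ℝ) • y.1 := by
    have h1 : Continuous fun y : ({0}ᶜ : Set E) => ‖y.1‖⁻¹ :=
      (continuous_norm.comp continuous_subtype_val).inv₀ fun y => norm_ne_zero_iff.2 y.2
    exact h1.smul continuous_subtype_val
  have hn : ∀ y : ({0}ᶜ : Set E), ‖(‖y.1‖⁻¹ : ℝ) • y.1‖ = 1 := fun y => by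
    rw [norm_smul, norm_inv, norm_norm, inv_mul_cancel₀ (norm_ne_zero_iff.2 y.2)]
  convert continuous_mk hc hn using 1
  funext y
  exact AnisoSphere.ext (proj_val y.2)

end AnisoSphere

end Metric

/-! ### Volumes of boxes compared with the cone measure of balls. -/

section Measure

variable {E : Type*} [NormedAddCommGroup E] [InnerProductSpace ℂ E] [FiniteDimensional ℂ E]
  [MeasurableSpace E] [BorelSpace E]

open Module

/-- Dilating an anisotropic box multiplies its volume at most by a fixed factor. -/
lemma haarVol_anisoBox_mul_le {P : E} (hP : ‖P‖ = 1) {s : ℝ} (hs : 0 < s) (r : ℝ) :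
    haarVol E (anisoBox P (s * r)) ≤
      ENNReal.ofReal ((s ^ 2 + s) ^ finrank ℝ E) * haarVol E (anisoBox P r) := by
  have hprop : ProperSpace E := FiniteDimensional.proper ℂ E
  -- The nonisotropic dilation, by `s ^ 2` along `P` and by `s` on the orthogonal complement.
  have hlin : ∃ T : E →ₗ[ℝ] E, ∀ v, T v = (((s ^ 2 : ℝ) : ℂ) * inner ℂ P v) • P +
      (s : ℂ) • perpPart P v := by
    refine ⟨{ toFun := fun v => (((s ^ 2 : ℝ) : ℂ) * inner ℂ P v) • P + (s : ℂ) • perpPart P v,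
               map_add' := ?_, map_smul' := ?_ }, fun v => rfl⟩
    · intro v w
      rw [perpPart_add, inner_add_right, mul_add, add_smul, smul_add]; abel
    · intro c v
      rw [← Complex.coe_smul, perpPart_smul, inner_smul_right, smul_comm (s : ℂ), RingHom.id_apply,
        ← Complex.coe_smul, smul_add, smul_smul, mul_left_comm, smul_smul]
  obtain ⟨T, hT⟩ := hlin
  have hsub1 : anisoBox P (s * r) ⊆ T '' anisoBox P r := by
    intro w hw
    have h1 : inner ℂ P (perpPart P w) = 0 := by
      rw [perpPart, inner_sub_right, inner_smul_right, inner_self_of_norm_one hP]; simp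
    have h2 : perpPart P (perpPart P w) = perpPart P w := by
      rw [perpPart, h1, zero_smul, sub_zero]
    have h3 : ‖inner ℂ P w‖ < (s * r) ^ 2 := hw.1
    have h4 : ‖perpPart P w‖ < s * r := hw.2
    set v := (((s ^ 2 : ℝ) : ℂ)⁻¹ * inner ℂ P w) • P + (s : ℂ)⁻¹ • perpPart P w with hv
    have h5 : inner ℂ P v = ((s ^ 2 : ℝ) : ℂ)⁻¹ * inner ℂ P w := by
      rw [hv, inner_add_right, inner_smul_right, inner_smul_right, inner_self_of_norm_one hP, h1,
          mul_one, mul_zero, add_zero]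
    have h6 : perpPart P v = (s : ℂ)⁻¹ • perpPart P w := by
      rw [hv, perpPart_add, perpPart_smul, perpPart_self hP, smul_zero, zero_add, perpPart_smul, h2]
    refine ⟨v, ⟨?_, ?_⟩, ?_⟩
    · rw [h5, norm_mul, norm_inv, Complex.norm_real, Real.norm_of_nonneg (by positivity),
        inv_mul_lt_iff₀ (by positivity), ← mul_pow]
      exact h3
    · rw [h6, norm_smul, norm_inv, Complex.norm_real, Real.norm_of_nonneg hs.le,
        inv_mul_lt_iff₀ hs]
      exact h4
    · have h7 : ((s ^ 2 : ℝ) : ℂ) ≠ 0 := Complex.ofReal_ne_zero.2 (by positivity)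
      have h8 : (s : ℂ) ≠ 0 := Complex.ofReal_ne_zero.2 hs.ne'
      rw [hT, h5, h6, smul_smul, mul_inv_cancel_left₀ h7, mul_inv_cancel₀ h8, one_smul, perpPart]
      abel
  -- A crude determinant bound: `T` maps the unit ball into the ball of radius `s ^ 2 + s`.
  have hdet : ENNReal.ofReal |LinearMap.det T| ≤ ENNReal.ofReal ((s ^ 2 + s) ^ finrank ℝ E) := by
    have hb0 : haarVol E (ball (0 : E) 1) ≠ 0 := (measure_ball_pos _ _ one_pos).ne'
    have hbt : haarVol E (ball (0 : E) 1) ≠ ⊤ := measure_ball_lt_top.ne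
    refine (ENNReal.mul_le_mul_iff_left hb0 hbt).1 ?_
    rw [← Measure.addHaar_image_linearMap,
      ← Measure.addHaar_ball_mul_of_pos _ (0 : E) (by positivity) 1, mul_one]
    refine measure_mono ?_
    rintro _ ⟨v, hv, rfl⟩
    rw [mem_ball_zero_iff] at hv ⊢
    rw [hT]
    refine (norm_add_le _ _).trans_lt ?_
    rw [norm_smul, norm_smul, norm_mul, hP, Complex.norm_real, Complex.norm_real,
      Real.norm_of_nonneg hs.le, Real.norm_of_nonneg (by positivity), mul_one]
    have h1 := norm_inner_le_of_norm_one hP v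
    have h2 := norm_perpPart_le hP v
    have h3 : s ^ 2 * ‖inner ℂ P v‖ ≤ s ^ 2 * ‖v‖ := by gcongr
    have h4 : s * ‖perpPart P v‖ ≤ s * ‖v‖ := by gcongr
    have h5 : (s ^ 2 + s) * ‖v‖ < (s ^ 2 + s) * 1 := by gcongr
    linarith
  refine (measure_mono hsub1).trans ?_
  rw [Measure.addHaar_image_linearMap]
  gcongr

variable [Nontrivial E]

variable (E) in
/-- The cone measure of the sphere. -/
noncomputable def coneMeasure : Measure (AnisoSphere E) :=
  ((haarVol E).restrict (ball 0 1)).map AnisoSphere.proj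

instance : IsFiniteMeasure (coneMeasure E) := by
  have hprop : ProperSpace E := FiniteDimensional.proper ℂ E
  have : IsFiniteMeasure ((haarVol E).restrict (ball (0 : E) 1)) :=
    ⟨by rw [Measure.restrict_apply_univ]; exact measure_ball_lt_top⟩
  unfold coneMeasure
  infer_instance

lemma haarVol_cone {A : Set (AnisoSphere E)} (hA : MeasurableSet A) {ρ : ℝ} (hρ : 0 < ρ) :
    haarVol E {y | ‖y‖ < ρ ∧ AnisoSphere.proj y ∈ A} =
      ENNReal.ofReal (ρ ^ finrank ℝ E) * coneMeasure E A := by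
  rw [coneMeasure, Measure.map_apply AnisoSphere.measurable_proj hA,
    Measure.restrict_apply (AnisoSphere.measurable_proj hA),
    ← abs_of_pos (pow_pos hρ (finrank ℝ E)), ← Measure.addHaar_smul]
  congr 1
  ext y
  rw [Set.mem_smul_set_iff_inv_smul_mem₀ hρ.ne', Set.mem_inter_iff, Set.mem_preimage,
    AnisoSphere.proj_smul (inv_pos.2 hρ), mem_ball_zero_iff, norm_smul, norm_inv,
    Real.norm_of_nonneg hρ.le, inv_mul_lt_iff₀ hρ, mul_one, and_comm]
  rfl

lemma haarVol_shell {A : Set (AnisoSphere E)} (hA : MeasurableSet A) {ρ₁ ρ₂ : ℝ} (hρ₁ : 0 < ρ₁)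
    (hρ : ρ₁ ≤ ρ₂) : haarVol E {y | ρ₁ ≤ ‖y‖ ∧ ‖y‖ < ρ₂ ∧ AnisoSphere.proj y ∈ A} =
      ENNReal.ofReal (ρ₂ ^ finrank ℝ E - ρ₁ ^ finrank ℝ E) * coneMeasure E A := by
  have hset : {y : E | ρ₁ ≤ ‖y‖ ∧ ‖y‖ < ρ₂ ∧ AnisoSphere.proj y ∈ A} =
      {y | ‖y‖ < ρ₂ ∧ AnisoSphere.proj y ∈ A} \ {y | ‖y‖ < ρ₁ ∧ AnisoSphere.proj y ∈ A} := by
    ext y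
    simp only [Set.mem_ofPred_eq, Set.mem_sdiff, not_and]
    constructor
    · rintro ⟨h1, h2, h3⟩
      exact ⟨⟨h2, h3⟩, fun h => absurd h h1.not_gt⟩
    · rintro ⟨⟨h2, h3⟩, h⟩
      exact ⟨not_lt.1 fun h1 => h h1 h3, h2, h3⟩
  have hm : MeasurableSet {y : E | ‖y‖ < ρ₁ ∧ AnisoSphere.proj y ∈ A} :=
    (measurableSet_lt measurable_norm measurable_const).inter (AnisoSphere.measurable_proj hA)
  have hfin : coneMeasure E A ≠ ⊤ := measure_ne_top _ _
  rw [hset, measure_sdiff (Set.ofPred_subset_ofPred.2 fun y hy => ⟨hy.1.trans_le hρ, hy.2⟩) hm.nullMeasurableSet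
    (by rw [haarVol_cone hA hρ₁]; exact ENNReal.mul_ne_top ENNReal.ofReal_ne_top hfin),
    haarVol_cone hA hρ₁, haarVol_cone hA (hρ₁.trans_le hρ), ENNReal.ofReal_sub _ (by positivity),
    ENNReal.sub_mul fun _ _ => hfin]

/-- The shell of thickness `r ^ 2` over the ball of radius `r` has volume at least `r ^ 2` times the
cone measure and fits into the box of size `3 * r` about `P`. -/
lemma coneMeasure_closedBall_le (P : AnisoSphere E) {r : ℝ} (hr : 0 < r) (hr1 : r < 1) :
    ENNReal.ofReal (r ^ 2) * coneMeasure E (closedBall P r) ≤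
      haarVol E (anisoBox P.1 (3 * r)) := by
  have hr2 : 0 < r ^ 2 := by positivity
  have hr3 : r ^ 2 < 1 := by nlinarith
  have h1 : ENNReal.ofReal (r ^ 2) * coneMeasure E (closedBall P r) ≤
      haarVol E {y | 1 - r ^ 2 ≤ ‖y‖ ∧ ‖y‖ < 1 ∧ AnisoSphere.proj y ∈ closedBall P r} := by
    rw [haarVol_shell isClosed_closedBall.measurableSet (by linarith) (by linarith), one_pow]
    gcongr
    have : (1 - r ^ 2) ^ finrank ℝ E ≤ 1 - r ^ 2 :=
      pow_le_of_le_one (by linarith) (by linarith)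
        (Module.finrank_pos (R := ℝ) (M := E)).ne'
    linarith
  refine h1.trans ?_
  rw [← measure_preimage_add_right (haarVol E) (-P.1) (anisoBox P.1 (3 * r))]
  simp only [← sub_eq_add_neg]
  refine measure_mono ?_
  rintro y ⟨hy1, hy2, hy3⟩
  rw [AnisoSphere.mem_closedBall_iff hr.le] at hy3
  have hy : y = (‖y‖ : ℂ) • (AnisoSphere.proj y).1 := by
    rw [Complex.coe_smul, AnisoSphere.norm_smul_proj]
  set Q := AnisoSphere.proj y
  set ρ := ‖y‖ with hρ
  have hρ0 : 0 ≤ ρ := norm_nonneg _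
  refine ⟨?_, ?_⟩
  · have h2 : inner ℂ P.1 (y - P.1) = -((ρ : ℂ) * (1 - inner ℂ P.1 Q.1)) - ((1 - ρ : ℝ) : ℂ) := by
      rw [hy, inner_sub_right, inner_smul_right, inner_self_of_norm_one P.2]
      push_cast; ring
    rw [h2]
    refine (norm_sub_le _ _).trans_lt ?_
    rw [norm_neg, norm_mul, Complex.norm_real, Complex.norm_real, Real.norm_of_nonneg hρ0,
      Real.norm_of_nonneg (by linarith)]
    nlinarith [norm_nonneg (1 - inner ℂ P.1 Q.1)]
  · have h2 : perpPart P.1 (y - P.1) = (ρ : ℂ) • perpPart P.1 Q.1 := by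
      rw [sub_eq_add_neg, perpPart_add, hy, perpPart_smul, ← neg_one_smul ℂ P.1, perpPart_smul,
        perpPart_self P.2, smul_zero, add_zero]
    rw [h2, norm_smul, Complex.norm_real, Real.norm_of_nonneg hρ0]
    have h3 := norm_perpPart_sq_le P.2 Q.2.le hy3
    refine (mul_le_of_le_one_left (norm_nonneg _) hy2.le).trans_lt ?_
    refine lt_of_pow_lt_pow_left₀ 2 (by positivity) ?_
    nlinarith

lemma one_add_pow_sub_one_sub_pow_le {x : ℝ} (hx0 : 0 ≤ x) (hx1 : x ≤ 1 / 2) (d : ℕ) :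
    (1 + 2 * x) ^ d - (1 - x) ^ d ≤ (2 * 3 ^ d + d) * x := by
  have h1 : (1 + 2 * x) ^ d ≤ 1 + 3 ^ d * (2 * x) := by
    induction d with
    | zero => simp; linarith
    | succ d ih =>
      have h3 : (1 : ℝ) ≤ 3 ^ d := one_le_pow₀ (by norm_num)
      calc (1 + 2 * x) ^ (d + 1) = (1 + 2 * x) ^ d * (1 + 2 * x) := pow_succ _ _
        _ ≤ (1 + 3 ^ d * (2 * x)) * (1 + 2 * x) := by gcongr
        _ ≤ 1 + 3 ^ (d + 1) * (2 * x) := by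
          rw [pow_succ]
          nlinarith [mul_nonneg (mul_nonneg (by positivity : (0 : ℝ) ≤ 3 ^ d) hx0)
            (by linarith : 0 ≤ 1 / 2 - x), mul_le_mul_of_nonneg_right h3 hx0]
  have h2 := one_add_mul_le_pow (a := -x) (by linarith) d
  rw [← sub_eq_add_neg] at h2
  linarith

/-- The constant in the comparison of anisotropic boxes with cones. -/
noncomputable def shellConst (d : ℕ) : ℝ := 2 * 3 ^ d + d

/-- The reverse inclusion: the box about `P` lies between radii `1 - r ^ 2` and `1 + 2 * r ^ 2`, and
projects into the ball of radius `2 * r` because `3 * r ^ 2 / ‖y‖ ≤ 4 * r ^ 2`. -/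
lemma haarVol_anisoBox_inter_cone_le (P : AnisoSphere E) {A : Set (AnisoSphere E)}
    (hA : MeasurableSet A) {r : ℝ} (hr : 0 < r) (hr1 : r ≤ 1 / 2) :
    haarVol E {y | y - P.1 ∈ anisoBox P.1 r ∧ AnisoSphere.proj y ∈ A} ≤
      ENNReal.ofReal (shellConst (finrank ℝ E) * r ^ 2) *
        coneMeasure E (A ∩ closedBall P (2 * r)) := by
  have hr2 : 0 < r ^ 2 := by positivity
  have hr4 : r ^ 2 ≤ 1 / 4 := by nlinarith
  have h1 : haarVol E {y | 1 - r ^ 2 ≤ ‖y‖ ∧ ‖y‖ < 1 + 2 * r ^ 2 ∧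
      AnisoSphere.proj y ∈ A ∩ closedBall P (2 * r)} ≤
      ENNReal.ofReal (shellConst (finrank ℝ E) * r ^ 2) *
        coneMeasure E (A ∩ closedBall P (2 * r)) := by
    rw [haarVol_shell (hA.inter isClosed_closedBall.measurableSet) (by linarith) (by linarith)]
    gcongr
    exact one_add_pow_sub_one_sub_pow_le hr2.le (by linarith) _
  refine le_trans (measure_mono ?_) h1
  rintro y ⟨⟨hy1, hy2⟩, hyA⟩
  rw [inner_sub_right, inner_self_of_norm_one P.2] at hy1
  have hperp : perpPart P.1 (y - P.1) = perpPart P.1 y := by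
    rw [sub_eq_add_neg, perpPart_add, ← neg_one_smul ℂ P.1, perpPart_smul,
      perpPart_self P.2, smul_zero, add_zero]
  rw [hperp] at hy2
  have e := norm_sq_eq_inner_add_perpPart P.2 y
  have hin : ‖inner ℂ P.1 y‖ ≤ 1 + r ^ 2 := by
    have := norm_le_norm_add_norm_sub' (inner ℂ P.1 y) 1
    rw [norm_one] at this
    linarith
  have hlow : 1 - r ^ 2 ≤ ‖y‖ := by
    have h2 := norm_le_norm_add_norm_sub (inner ℂ P.1 y) 1
    rw [norm_one] at h2
    have := norm_inner_le_of_norm_one P.2 y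
    linarith
  have hup : ‖y‖ < 1 + 2 * r ^ 2 := by
    refine lt_of_pow_lt_pow_left₀ 2 (by positivity) ?_
    have h2 : ‖inner ℂ P.1 y‖ ^ 2 ≤ (1 + r ^ 2) ^ 2 := by gcongr
    have h3 : ‖perpPart P.1 y‖ ^ 2 ≤ r ^ 2 := by gcongr
    nlinarith
  refine ⟨hlow, hup, hyA, ?_⟩
  rw [AnisoSphere.mem_closedBall_iff (by positivity)]
  have hy : y = (‖y‖ : ℂ) • (AnisoSphere.proj y).1 := by
    rw [Complex.coe_smul, AnisoSphere.norm_smul_proj]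
  have h2 : (‖y‖ : ℂ) * (1 - inner ℂ P.1 (AnisoSphere.proj y).1) =
      ((‖y‖ - 1 : ℝ) : ℂ) - (inner ℂ P.1 y - 1) := by
    have : inner ℂ P.1 y = (‖y‖ : ℂ) * inner ℂ P.1 (AnisoSphere.proj y).1 := by
      conv_lhs => rw [hy]
      rw [inner_smul_right]
    rw [this]; push_cast; ring
  have h3 : ‖y‖ * ‖1 - inner ℂ P.1 (AnisoSphere.proj y).1‖ ≤ 3 * r ^ 2 := by
    have h4 := congrArg norm h2
    rw [norm_mul, Complex.norm_real, norm_norm] at h4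
    rw [h4]
    refine (norm_sub_le _ _).trans ?_
    rw [Complex.norm_real, Real.norm_eq_abs]
    have : |‖y‖ - 1| ≤ 2 * r ^ 2 := abs_le.2 ⟨by linarith, by linarith⟩
    linarith
  nlinarith [norm_nonneg (1 - inner ℂ P.1 (AnisoSphere.proj y).1)]

end Measure

/-! ### Doubling and the density theorem. -/

section Doubling

variable {E : Type*} [NormedAddCommGroup E] [InnerProductSpace ℂ E] [FiniteDimensional ℂ E]
  [MeasurableSpace E] [BorelSpace E] [Nontrivial E]

open Module

lemma haarVol_anisoBox_le_coneMeasure (P : AnisoSphere E) {r : ℝ} (hr : 0 < r) (hr1 : r ≤ 1 / 2) :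
    haarVol E (anisoBox P.1 r) ≤
      ENNReal.ofReal (shellConst (finrank ℝ E) * r ^ 2) * coneMeasure E (closedBall P (2 * r)) := by
  have h := haarVol_anisoBox_inter_cone_le P MeasurableSet.univ hr hr1
  rw [Set.univ_inter] at h
  refine le_trans (le_of_eq ?_) h
  rw [← measure_preimage_add_right (haarVol E) (-P.1) (anisoBox P.1 r)]
  congr 1
  ext y
  simp [← sub_eq_add_neg]

lemma shellConst_nonneg (d : ℕ) : 0 ≤ shellConst d := by unfold shellConst; positivity

/-- The cone measure is doubling for the nonisotropic metric. -/
lemma coneMeasure_closedBall_mul_le (P : AnisoSphere E) {r : ℝ} (hr : 0 < r) (hr1 : r < 1 / 2) :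
    coneMeasure E (closedBall P (2 * r)) ≤
      ENNReal.ofReal (((12 : ℝ) ^ 2 + 12) ^ finrank ℝ E * shellConst (finrank ℝ E)) *
        coneMeasure E (closedBall P r) := by
  have h1 := coneMeasure_closedBall_le P (r := 2 * r) (by linarith) (by linarith)
  -- The chain is: ball of radius `2 * r`, box of size `6 * r = 12 * (r / 2)`, box of size `r / 2`,
  -- ball of radius `r`.
  have h2 := haarVol_anisoBox_mul_le P.2 (s := 12) (by norm_num) (r / 2)
  have h3 := haarVol_anisoBox_le_coneMeasure P (r := r / 2) (by linarith) (by linarith)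
  have e1 : (12 : ℝ) * (r / 2) = 3 * (2 * r) := by ring
  have e2 : 2 * (r / 2) = r := by ring
  rw [e1] at h2
  rw [e2] at h3
  have h4 := h1.trans (h2.trans (mul_le_mul_right h3 _))
  have hpos : 0 < (2 * r) ^ 2 := by positivity
  refine (ENNReal.mul_le_mul_iff_right (ENNReal.ofReal_pos.2 hpos).ne' ENNReal.ofReal_ne_top).1
    (h4.trans ?_)
  have hs := shellConst_nonneg (finrank ℝ E)
  rw [← mul_assoc, ← mul_assoc, ← ENNReal.ofReal_mul (by positivity),
    ← ENNReal.ofReal_mul (by positivity)]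
  refine mul_le_mul_left (ENNReal.ofReal_le_ofReal ?_) _
  have hB : (0 : ℝ) ≤ (12 ^ 2 + 12) ^ finrank ℝ E := by positivity
  generalize ((12 : ℝ) ^ 2 + 12) ^ finrank ℝ E = B at hB
  have : 0 ≤ B * shellConst (finrank ℝ E) * r ^ 2 := by positivity
  nlinarith

instance : IsUnifLocDoublingMeasure (coneMeasure E) where
  exists_measure_closedBall_le_mul'' := by
    refine ⟨(((12 : ℝ) ^ 2 + 12) ^ finrank ℝ E * shellConst (finrank ℝ E)).toNNReal, ?_⟩
    have : Set.Ioo (0 : ℝ) (1 / 2) ∈ 𝓝[>] (0 : ℝ) := Ioo_mem_nhdsGT (by norm_num)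
    filter_upwards [this] with r hr P
    exact coneMeasure_closedBall_mul_le P hr.1 hr.2

/-- Almost every point of a closed subset of the sphere is a point of density with respect to
anisotropic boxes. -/
theorem ae_isAnisoDensityPt {K : Set E} (hK : IsClosed K) :
    ∀ᵐ P ∂(coneMeasure E), P.1 ∈ K → IsAnisoDensityPt K P.1 := by
  set A : Set (AnisoSphere E) := {P | P.1 ∈ K} with hA
  have hAc : IsClosed A := hK.preimage AnisoSphere.continuous_val
  have hAm : MeasurableSet A := hAc.measurableSet
  have h := IsUnifLocDoublingMeasure.ae_tendsto_measure_inter_div (coneMeasure E) A 1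
  rw [ae_restrict_iff' hAm] at h
  filter_upwards [h] with P hP hPK R hR ε hε
  set d := finrank ℝ E
  have hlim := hP hPK (fun _ => P) (fun ρ : ℝ => ρ) (l := 𝓝[>] 0) tendsto_id
    (eventually_mem_nhdsWithin.mono fun ρ (hρ : 0 < ρ) => mem_closedBall_self (by linarith))
  -- The cost of passing from the box of size `R * r` to a ball of radius `2 * R * r`, and back to a
  -- box of size `6 * R * r`, compared with size `r`.
  set C := shellConst d * ((6 * R) ^ 2 + 6 * R) ^ d with hC
  have hC0 : 0 ≤ C := mul_nonneg (shellConst_nonneg _) (by positivity)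
  set η := min (ε / (C + 1)) 1 with hη
  have hη0 : 0 < η := lt_min (by positivity) one_pos
  have hη1 : η ≤ 1 := min_le_right _ _
  have hηC : C * η ≤ ε := by
    have h1 : η ≤ ε / (C + 1) := min_le_left _ _
    rw [le_div_iff₀ (by positivity)] at h1
    linarith
  have hev := hlim.eventually (lt_mem_nhds (show ENNReal.ofReal (1 - η) < 1 by
    rw [ENNReal.ofReal_lt_one]; linarith))
  obtain ⟨s, hs0, hs⟩ := mem_nhdsGT_iff_exists_Ioo_subset.1 hev
  have hs0' : 0 < s := hs0
  refine ⟨min (s / (2 * R)) (min (1 / (4 * R)) 1), by positivity, fun r hr hrs => ?_⟩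
  have hr1 : 2 * (R * r) < s := by
    have := (lt_div_iff₀ (by positivity)).1 (hrs.trans_le (min_le_left _ _))
    linarith
  have hr2 : R * r < 1 / 4 := by
    have := (lt_div_iff₀ (by positivity)).1
      (hrs.trans_le ((min_le_right _ _).trans (min_le_left _ _)))
    linarith
  have hRr : 0 < R * r := by positivity
  have hdens : ENNReal.ofReal (1 - η) <
      coneMeasure E (A ∩ closedBall P (2 * (R * r))) / coneMeasure E (closedBall P (2 * (R * r))) :=
    hs ⟨by positivity, hr1⟩
  set Q := closedBall P (2 * (R * r)) with hQ
  have hcompl : coneMeasure E (Aᶜ ∩ Q) ≤ ENNReal.ofReal η * coneMeasure E Q := by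
    have h1 : ENNReal.ofReal (1 - η) * coneMeasure E Q ≤ coneMeasure E (A ∩ Q) :=
      ENNReal.mul_le_of_le_div hdens.le
    have h2 : coneMeasure E (A ∩ Q) + coneMeasure E (Aᶜ ∩ Q) = coneMeasure E Q := by
      rw [Set.inter_comm A, Set.inter_comm Aᶜ]
      exact measure_inter_add_sdiff Q hAm
    have h3 : coneMeasure E Q = ENNReal.ofReal (1 - η) * coneMeasure E Q +
        ENNReal.ofReal η * coneMeasure E Q := by
      rw [← add_mul, ← ENNReal.ofReal_add (by linarith) hη0.le]
      simp
    have hfin : ENNReal.ofReal (1 - η) * coneMeasure E Q ≠ ⊤ :=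
      ENNReal.mul_ne_top ENNReal.ofReal_ne_top (measure_ne_top _ _)
    refine (ENNReal.add_le_add_iff_left hfin).1 ?_
    rw [← h3, ← h2]
    gcongr
    rw [h2]; exact h1
  have h1 : haarVol E {y | y - P.1 ∈ anisoBox P.1 (R * r) ∧ (‖y‖⁻¹ : ℝ) • y ∉ K} ≤
      haarVol E {y | y - P.1 ∈ anisoBox P.1 (R * r) ∧ AnisoSphere.proj y ∈ Aᶜ} := by
    refine measure_mono_ae ?_
    have h0 : ∀ᵐ y ∂(haarVol E), y ≠ 0 := by
      simp [ae_iff]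
    filter_upwards [h0] with y hy hy2
    refine ⟨hy2.1, ?_⟩
    change ¬ (AnisoSphere.proj y).1 ∈ K
    rw [AnisoSphere.proj_val hy]
    exact hy2.2
  have h2 := haarVol_anisoBox_inter_cone_le P hAm.compl hRr (by linarith)
  have h3 := coneMeasure_closedBall_le P (r := 2 * (R * r)) (by positivity) (by linarith)
  have h4 := haarVol_anisoBox_mul_le P.2 (s := 6 * R) (by positivity) r
  have e1 : 3 * (2 * (R * r)) = 6 * R * r := by ring
  rw [e1] at h3
  have hs := shellConst_nonneg d
  calc haarVol E {y | y - P.1 ∈ anisoBox P.1 (R * r) ∧ (‖y‖⁻¹ : ℝ) • y ∉ K}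
      ≤ ENNReal.ofReal (shellConst d * (R * r) ^ 2) * (ENNReal.ofReal η * coneMeasure E Q) :=
        h1.trans (h2.trans (mul_le_mul_right hcompl _))
    _ ≤ ENNReal.ofReal (shellConst d * η) *
          (ENNReal.ofReal ((2 * (R * r)) ^ 2) * coneMeasure E Q) := by
        rw [← mul_assoc, ← mul_assoc, ← ENNReal.ofReal_mul (by positivity),
          ← ENNReal.ofReal_mul (by positivity)]
        refine mul_le_mul_left (ENNReal.ofReal_le_ofReal ?_) _
        have : 0 ≤ shellConst d * η * (R * r) ^ 2 := by positivity
        nlinarith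
    _ ≤ ENNReal.ofReal (shellConst d * η) *
          (ENNReal.ofReal (((6 * R) ^ 2 + 6 * R) ^ d) * haarVol E (anisoBox P.1 r)) := by
        exact mul_le_mul_right (h3.trans h4) _
    _ ≤ ENNReal.ofReal ε * haarVol E (anisoBox P.1 r) := by
        rw [← mul_assoc, ← ENNReal.ofReal_mul (by positivity)]
        gcongr
        rw [hC] at hηC
        linarith

end Doubling

/-! ### From slices to radial limits, and from radial to admissible limits. -/

section Radial

/-- The Cauchy criterion with countable quantifiers outside. For fixed `k` and `N` the inner
condition is closed in the endpoint of the radius, which gives measurability of the set of radial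
convergence. -/
lemma exists_tendsto_left_iff {h : ℝ → ℂ} :
    (∃ l, Tendsto h (𝓝[<] 1) (𝓝 l)) ↔ ∀ k : ℕ, ∃ N : ℕ, ∀ ρ ρ' : ℝ,
      1 - 1 / ((N : ℝ) + 1) < ρ → ρ < 1 → 1 - 1 / ((N : ℝ) + 1) < ρ' → ρ' < 1 →
        dist (h ρ) (h ρ') ≤ 1 / ((k : ℝ) + 1) := by
  rw [← cauchy_map_iff_exists_tendsto, Metric.cauchy_iff]
  constructor
  · rintro ⟨-, hc⟩ k
    obtain ⟨t, ht, htd⟩ := hc (1 / ((k : ℝ) + 1)) (by positivity)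
    obtain ⟨s, hs1, hs⟩ := mem_nhdsLT_iff_exists_Ioo_subset.1 (mem_map.1 ht)
    have hs1' : s < 1 := hs1
    obtain ⟨N, hN⟩ := exists_nat_one_div_lt (show 0 < 1 - s by linarith)
    refine ⟨N, fun ρ ρ' h1 h2 h3 h4 => (htd _ (hs ⟨?_, h2⟩) _ (hs ⟨?_, h4⟩)).le⟩ <;> linarith
  · refine fun H => ⟨inferInstance, fun ε hε => ?_⟩
    obtain ⟨k, hk⟩ := exists_nat_one_div_lt hε
    obtain ⟨N, hN⟩ := H k
    have hpos : (0 : ℝ) < 1 / ((N : ℝ) + 1) := by positivity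
    refine ⟨h '' Set.Ioo (1 - 1 / ((N : ℝ) + 1)) 1,
      image_mem_map (Ioo_mem_nhdsLT (by linarith)), ?_⟩
    rintro _ ⟨ρ, hρ, rfl⟩ _ ⟨ρ', hρ', rfl⟩
    exact (hN ρ ρ' hρ.1 hρ.2 hρ'.1 hρ'.2).trans_lt hk

variable {E : Type*} [NormedAddCommGroup E] [InnerProductSpace ℂ E] {f : E → ℂ} {K : Set E}

lemma abs_lt_one_of_mem {N : ℕ} {ρ : ℝ} (h1 : 1 - 1 / ((N : ℝ) + 1) < ρ) (h2 : ρ < 1) :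
    |ρ| < 1 := by
  have : 1 / ((N : ℝ) + 1) ≤ 1 := by
    rw [div_le_one (by positivity)]
    linarith [(N.cast_nonneg : (0 : ℝ) ≤ N)]
  exact abs_lt.2 ⟨by linarith, h2⟩

lemma continuousOn_comp_smul_sphere (hf : ContinuousOn f (ball 0 1)) {ρ : ℝ} (hρ : |ρ| < 1) :
    ContinuousOn (fun Q : E => f ((ρ : ℂ) • Q)) (sphere 0 1) := by
  refine hf.comp (by fun_prop) fun Q hQ => ?_
  rw [mem_ball_zero_iff, norm_smul, mem_sphere_zero_iff_norm.1 hQ, mul_one, Complex.norm_real,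
    Real.norm_eq_abs]
  exact hρ

lemma continuous_comp_smul_val (hf : ContinuousOn f (ball 0 1)) {ρ : ℝ} (hρ : |ρ| < 1) :
    Continuous (fun P : AnisoSphere E => f ((ρ : ℂ) • P.1)) :=
  (continuousOn_comp_smul_sphere hf hρ).comp_continuous AnisoSphere.continuous_val
    fun P => mem_sphere_zero_iff_norm.2 P.2

lemma measurableSet_exists_radialLimit (hf : ContinuousOn f (ball 0 1)) :
    MeasurableSet {P : AnisoSphere E |
      ∃ l, Tendsto (fun ρ : ℝ => f ((ρ : ℂ) • P.1)) (𝓝[<] 1) (𝓝 l)} := by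
  simp_rw [exists_tendsto_left_iff, Set.ofPred_forall, Set.ofPred_exists]
  refine MeasurableSet.iInter fun k => MeasurableSet.iUnion fun N => IsClosed.measurableSet ?_
  simp only [Set.ofPred_forall]
  refine isClosed_iInter fun ρ => isClosed_iInter fun ρ' => isClosed_iInter fun h1 =>
    isClosed_iInter fun h2 => isClosed_iInter fun h3 => isClosed_iInter fun h4 => ?_
  exact isClosed_le ((continuous_comp_smul_val hf (abs_lt_one_of_mem h1 h2)).dist
    (continuous_comp_smul_val hf (abs_lt_one_of_mem h3 h4))) continuous_const

lemma AnisoSphere.proj_smul_val [Nontrivial E] {c : ℂ} (hc : ‖c‖ = 1) {y : E} (hy : y ≠ 0) :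
    (proj (c • y)).1 = c • (proj y).1 := by
  have hc0 : c ≠ 0 := by rintro rfl; simp at hc
  rw [proj_val hy, proj_val (smul_ne_zero hc0 hy), norm_smul, hc, one_mul, smul_comm]

variable [FiniteDimensional ℂ E] [MeasurableSpace E] [BorelSpace E] [Nontrivial E]

/-- A holomorphic function that is bounded on the Stolz regions with vertices in a closed set `K`
has radial limits almost everywhere on `K`. -/
theorem ae_exists_radialLimit (hf : DifferentiableOn ℂ f (ball 0 1)) (hK : IsClosed K)
    {α M : ℝ} (hα : 1 < α)
    (hb : ∀ Q ∈ K, ∀ z, ‖z‖ < 1 → ‖z - Q‖ < α * (1 - ‖z‖) → ‖f z‖ ≤ M) :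
    ∀ᵐ P ∂(coneMeasure E), P.1 ∈ K →
      ∃ l, Tendsto (fun ρ : ℝ => f ((ρ : ℂ) • P.1)) (𝓝[<] 1) (𝓝 l) := by
  have hprop : ProperSpace E := FiniteDimensional.proper ℂ E
  set G : Set (AnisoSphere E) := {P | P.1 ∈ K →
      ∃ l, Tendsto (fun ρ : ℝ => f ((ρ : ℂ) • P.1)) (𝓝[<] 1) (𝓝 l)} with hG
  have hGm : MeasurableSet G := by
    have h1 : MeasurableSet {P : AnisoSphere E | P.1 ∈ K} :=
      (hK.preimage AnisoSphere.continuous_val).measurableSet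
    exact h1.imp (measurableSet_exists_radialLimit hf.continuousOn)
  change ∀ᵐ P ∂(coneMeasure E), P ∈ G
  refine (ae_map_iff (p := fun P => P ∈ G) AnisoSphere.measurable_proj.aemeasurable hGm).2 ?_
  refine ae_restrict_of_ae ?_
  have hm : Measurable fun p : E × ℝ => AnisoSphere.proj (circleMap 0 1 p.2 • p.1) := by
    refine AnisoSphere.measurable_proj.comp ?_
    have : Continuous fun p : E × ℝ => circleMap 0 1 p.2 • p.1 :=
      ((continuous_circleMap 0 1).comp continuous_snd).smul continuous_fst
    exact this.measurable
  have hne : ∀ᵐ y ∂(haarVol E), y ≠ 0 := by simp [ae_iff]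
  -- The disc theorem is applied on the complex line through each `y ≠ 0`.
  have h1 : ∀ᵐ y ∂(haarVol E), ∀ᵐ θ ∂(volume.restrict (Set.Ioo 0 (2 * π))),
      AnisoSphere.proj (circleMap 0 1 θ • y) ∈ G := by
    filter_upwards [hne] with y hy
    set P := AnisoSphere.proj y with hP
    have hcirc : ∀ θ : ℝ, ‖circleMap 0 1 θ‖ = 1 := fun θ => by simp
    have h2 := ae_exists_radialLimit_disc (g := fun l => f (l • P.1))
      (K := {l | l • P.1 ∈ K} ∩ sphere 0 1) ?_ ?_ Set.inter_subset_right hα (M := M) ?_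
    · filter_upwards [h2] with θ hθ hθK
      rw [AnisoSphere.proj_smul_val (hcirc θ) hy] at hθK ⊢
      obtain ⟨l, hl⟩ := hθ ⟨hθK, by simp⟩
      refine ⟨l, hl.congr fun ρ => ?_⟩
      simp only [smul_smul, circleMap]
      simp [hP]
    · refine hf.comp (by fun_prop) fun l hl => ?_
      rw [mem_ball_zero_iff, norm_smul, P.2, mul_one]
      simpa using hl
    · exact (hK.preimage (by fun_prop)).inter isClosed_sphere
    · rintro ζ ⟨hζK, -⟩ z hz hzζ
      have hn : ‖z • P.1‖ = ‖z‖ := by rw [norm_smul, P.2, mul_one]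
      refine hb _ hζK _ (by rwa [hn]) ?_
      rw [hn, ← sub_smul, norm_smul, P.2, mul_one]
      exact hzζ
  rw [Measure.ae_ae_comm (p := fun y θ => AnisoSphere.proj (circleMap 0 1 θ • y) ∈ G)
    (hm hGm)] at h1
  have hnb : NeBot (ae (volume.restrict (Set.Ioo 0 (2 * π)))) := by
    rw [ae_neBot, Ne, Measure.restrict_eq_zero]
    simp [Real.pi_pos]
  -- After the exchange of quantifiers one good angle suffices, since rotation by it preserves the
  -- volume.
  obtain ⟨θ, hθ⟩ := h1.exists
  have hmp := measurePreserving_smul_of_norm_eq_one (E := E) (c := circleMap 0 1 θ) (by simp)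
  rw [← hmp.map_eq]
  exact (ae_map_iff (p := fun y => AnisoSphere.proj y ∈ G) hmp.measurable.aemeasurable
    (AnisoSphere.measurable_proj hGm)).2 hθ

/-- A holomorphic function that is bounded on the Stolz regions with vertices in a closed set `K`
has admissible limits almost everywhere on `K`, with respect to the cone measure. -/
theorem ae_exists_admissibleLimit (hf : DifferentiableOn ℂ f (ball 0 1)) (hK : IsClosed K)
    (hKs : K ⊆ sphere 0 1) {α M : ℝ} (hα : 1 < α)
    (hb : ∀ Q ∈ K, ∀ z, ‖z‖ < 1 → ‖z - Q‖ < α * (1 - ‖z‖) → ‖f z‖ ≤ M) :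
    ∀ᵐ P ∂(coneMeasure E), P.1 ∈ K → ∃ l, ∀ β, 4 ≤ β →
      Tendsto f (𝓝[{z | ‖z‖ < 1 ∧ ‖1 - inner ℂ P.1 z‖ < β * (1 - ‖z‖)}] P.1) (𝓝 l) := by
  -- Centres from a dense sequence and rational tolerances make the family countable, so almost
  -- every point is a density point of every member containing it.
  set L : ℕ → ℕ → ℕ → Set E := fun i k N => {Q | Q ∈ K ∧ ∀ ρ : ℝ, 1 - 1 / ((N : ℝ) + 1) < ρ → ρ < 1 →
    ‖f ((ρ : ℂ) • Q) - TopologicalSpace.denseSeq ℂ i‖ ≤ 1 / ((k : ℝ) + 1)} with hL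
  have hLc : ∀ i k N, IsClosed (L i k N) := by
    intro i k N
    have : L i k N = K ∩ ⋂ ρ : ℝ, ⋂ (_ : 1 - 1 / ((N : ℝ) + 1) < ρ), ⋂ (_ : ρ < 1),
        K ∩ (fun Q => f ((ρ : ℂ) • Q)) ⁻¹'
          closedBall (TopologicalSpace.denseSeq ℂ i) (1 / ((k : ℝ) + 1)) := by
      ext Q
      simp only [hL, Set.mem_ofPred_eq, Set.mem_inter_iff, Set.mem_iInter, Set.mem_preimage,
        mem_closedBall, dist_eq_norm]
      exact ⟨fun h => ⟨h.1, fun ρ h1 h2 => ⟨h.1, h.2 ρ h1 h2⟩⟩,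
        fun h => ⟨h.1, fun ρ h1 h2 => (h.2 ρ h1 h2).2⟩⟩
    rw [this]
    refine hK.inter (isClosed_iInter fun ρ => isClosed_iInter fun h1 => isClosed_iInter fun h2 => ?_)
    exact ((continuousOn_comp_smul_sphere hf.continuousOn (abs_lt_one_of_mem h1 h2)).mono
      hKs).preimage_isClosed_of_isClosed hK isClosed_closedBall
  have hLd : ∀ᵐ P ∂(coneMeasure E), ∀ i k N, P.1 ∈ L i k N → IsAnisoDensityPt (L i k N) P.1 := by
    simp only [ae_all_iff]
    exact fun i k N => ae_isAnisoDensityPt (hLc i k N)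
  filter_upwards [ae_exists_radialLimit hf hK hα hb, ae_isAnisoDensityPt hK, hLd]
    with P hPr hPd hPL hPK
  obtain ⟨l, hl⟩ := hPr hPK
  refine ⟨l, fun β hβ => ?_⟩
  obtain ⟨M', hM'⟩ := exists_bound_admissible hf hK hKs hα hb P.2 (hPd hPK)
    (by linarith : 4 ≤ 2 * β + 2)
  rw [Metric.tendsto_nhdsWithin_nhds]
  intro ε hε
  obtain ⟨k, hk⟩ := exists_nat_one_div_lt (show 0 < ε / 3 by positivity)
  have hk0 : (0 : ℝ) < 1 / ((k : ℝ) + 1) := by positivity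
  obtain ⟨i, hi⟩ := (TopologicalSpace.denseRange_denseSeq ℂ).exists_dist_lt l
    (show 0 < 1 / ((k : ℝ) + 1) / 2 by positivity)
  have hev := hl.eventually (ball_mem_nhds l (show 0 < 1 / ((k : ℝ) + 1) / 2 by positivity))
  obtain ⟨s, hs1, hs⟩ := mem_nhdsLT_iff_exists_Ioo_subset.1 hev
  have hs1' : s < 1 := hs1
  obtain ⟨N, hN⟩ := exists_nat_one_div_lt (show 0 < 1 - s by linarith)
  have hPLm : P.1 ∈ L i k N := by
    refine ⟨hPK, fun ρ h1 h2 => ?_⟩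
    have h3 : f ((ρ : ℂ) • P.1) ∈ ball l (1 / ((k : ℝ) + 1) / 2) :=
      hs ⟨by linarith, h2⟩
    rw [mem_ball] at h3
    rw [← dist_eq_norm]
    have := dist_triangle (f ((ρ : ℂ) • P.1)) l (TopologicalSpace.denseSeq ℂ i)
    linarith
  have hN0 : (0 : ℝ) < 1 / ((N : ℝ) + 1) := by positivity
  -- This gives `2 / (k + 1)` as distance from `f z` to the centre; the centre is within half of `1
  -- / (k + 1)` of `l`, so the total stays below `3 / (k + 1) < ε`.
  obtain ⟨t₀, ht₀, ht⟩ := exists_forall_norm_sub_le hf (hLc i k N) hk0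
    (by linarith : 1 - 1 / ((N : ℝ) + 1) < 1) (fun Q hQ => hQ.2) P.2 (hPL i k N hPLm) hβ hM'
  refine ⟨t₀, ht₀, fun z hz hzP => ?_⟩
  have hz2 : 1 - ‖z‖ < t₀ := by
    rw [dist_eq_norm] at hzP
    have := norm_le_norm_add_norm_sub z P.1
    rw [P.2] at this
    linarith
  have h1 := ht z hz.1 hz.2 hz2
  rw [← dist_eq_norm] at h1
  have h2 := dist_triangle_right (f z) l (TopologicalSpace.denseSeq ℂ i)
  linarith

end Radial

/-! ### From null cones to Hausdorff null sets on the sphere. -/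

section Hausdorff

variable {F : Type*} [NormedAddCommGroup F]

lemma norm_normalize_sub_normalize_le [NormedSpace ℝ F] {x : ℝ} (hx : 0 < x) {z w : F}
    (hz : x ≤ ‖z‖) (hw : x ≤ ‖w‖) : ‖‖z‖⁻¹ • z - ‖w‖⁻¹ • w‖ ≤ 2 / x * ‖z - w‖ := by
  have hz0 : 0 < ‖z‖ := hx.trans_le hz
  have hw0 : 0 < ‖w‖ := hx.trans_le hw
  have h1 : ‖z‖⁻¹ • z - ‖w‖⁻¹ • w = ‖z‖⁻¹ • (z - w) + (‖z‖⁻¹ - ‖w‖⁻¹) • w := by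
    rw [smul_sub, sub_smul]; abel
  have h2 : ‖(‖z‖⁻¹ - ‖w‖⁻¹) • w‖ ≤ ‖z‖⁻¹ * ‖z - w‖ := by
    have h3 : ‖z‖⁻¹ - ‖w‖⁻¹ = (‖w‖ - ‖z‖) * ‖z‖⁻¹ * ‖w‖⁻¹ := by field_simp
    rw [norm_smul, h3, norm_mul, norm_mul, norm_inv, norm_inv, norm_norm, norm_norm, mul_assoc,
      inv_mul_cancel₀ hw0.ne', mul_one, mul_comm]
    gcongr
    rw [norm_sub_rev z w]
    exact abs_norm_sub_norm_le w z
  rw [h1]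
  refine (norm_add_le _ _).trans ?_
  rw [norm_smul, norm_inv, norm_norm]
  have h4 : ‖z‖⁻¹ ≤ x⁻¹ := inv_anti₀ hx hz
  have h5 : ‖z‖⁻¹ * ‖z - w‖ ≤ x⁻¹ * ‖z - w‖ := by gcongr
  rw [div_eq_mul_inv]
  linarith

variable [InnerProductSpace ℝ F] [FiniteDimensional ℝ F] [MeasurableSpace F] [BorelSpace F]

open Module

/-- Part of a set on the unit sphere that lies in a cap is null if the cone over the set is. -/
lemma hausdorffMeasure_inter_cap_eq_zero {N : Set F} (hN : N ⊆ sphere 0 1)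
    (hcone : Measure.hausdorffMeasure (finrank ℝ F) {y : F | ‖y‖ < 1 ∧ ‖y‖⁻¹ • y ∈ N} = 0)
    {v : F} (hv : ‖v‖ = 1) :
    Measure.hausdorffMeasure ((finrank ℝ F : ℝ) - 1) (N ∩ {Q | 1 / 2 < inner ℝ v Q}) = 0 := by
  have hprop : ProperSpace F := FiniteDimensional.proper ℝ F
  set H : Submodule ℝ F := (Submodule.span ℝ {v})ᗮ with hH
  have hv0 : v ≠ 0 := by rintro rfl; simp at hv
  have hdim : (finrank ℝ F : ℝ) - 1 = finrank ℝ H := by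
    have h1 := Submodule.finrank_add_finrank_orthogonal (Submodule.span ℝ {v})
    rw [finrank_span_singleton hv0] at h1
    rw [← h1]; push_cast; ring
  have hvH : ∀ y : H, inner ℝ v (y : F) = 0 := fun y =>
    Submodule.mem_orthogonal_singleton_iff_inner_right.1 y.2
  have hvv : inner ℝ v v = (1 : ℝ) := by rw [real_inner_self_eq_norm_sq, hv, one_pow]
  let L₀ : (ℝ × H) →ₗ[ℝ] F := (LinearMap.toSpanSingleton ℝ F v).coprod H.subtype
  have hL₀ : ∀ x y, L₀ (x, y) = x • v + (y : F) := fun x y => by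
    simp [L₀, LinearMap.toSpanSingleton_apply]
  have hbij : Function.Bijective L₀ := by
    constructor
    · rw [injective_iff_map_eq_zero]
      rintro ⟨x, y⟩ hxy
      rw [hL₀] at hxy
      have h1 := congrArg (inner ℝ v) hxy
      rw [inner_add_right, inner_smul_right, hvv, hvH, inner_zero_right, mul_one, add_zero] at h1
      rw [h1, zero_smul, zero_add] at hxy
      rw [h1, Prod.mk_eq_zero]
      exact ⟨rfl, Subtype.ext hxy⟩
    · intro w
      refine ⟨(inner ℝ v w, ⟨w - (inner ℝ v w : ℝ) • v, ?_⟩), ?_⟩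
      · rw [hH, Submodule.mem_orthogonal_singleton_iff_inner_right, inner_sub_right,
          inner_smul_right, hvv]
        simp
      · rw [hL₀]; simp
  let L : (ℝ × H) ≃L[ℝ] F := (LinearEquiv.ofBijective L₀ hbij).toContinuousLinearEquiv
  have hL : ∀ x y, L (x, y) = x • v + (y : F) := hL₀
  set ν : Measure H := Measure.hausdorffMeasure (finrank ℝ H) with hν
  -- Both are Haar measures on `F`, so Fubini in the coordinates `x • v + y` applies to the null
  -- cone.
  have hac : ((volume : Measure ℝ).prod ν).map L ≪ Measure.hausdorffMeasure (finrank ℝ F) :=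
    Measure.absolutelyContinuous_isAddHaarMeasure _ _
  have h1 := hac hcone
  rw [measure_eq_zero_iff_ae_notMem] at h1
  have h2 := Measure.ae_ae_of_ae_prod (ae_of_ae_map L.continuous.measurable.aemeasurable h1)
  have h3 := ae_restrict_of_ae (s := Set.Ioo (0 : ℝ) (1 / 2)) h2
  have hnb : NeBot (ae ((volume : Measure ℝ).restrict (Set.Ioo (0 : ℝ) (1 / 2)))) := by
    rw [ae_neBot, Ne, Measure.restrict_eq_zero]
    simp
  -- A height whose hyperplane slice of the cone is null. Positivity makes the radial projection
  -- Lipschitz on the slice; `x < 1 / 2` keeps the points over the cap inside the unit ball.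
  obtain ⟨x, hx, hx0, hx2⟩ := (h3.and (ae_restrict_mem measurableSet_Ioo)).exists
  have hx' : ν {y : H | L (x, y) ∈ {y : F | ‖y‖ < 1 ∧ ‖y‖⁻¹ • y ∈ N}} = 0 :=
    measure_eq_zero_iff_ae_notMem.2 hx
  have hnorm : ∀ y : H, x ≤ ‖x • v + (y : F)‖ := fun y => by
    have h4 := real_inner_le_norm v (x • v + (y : F))
    rwa [inner_add_right, inner_smul_right, hvv, hvH, mul_one, add_zero, hv, one_mul] at h4
  have hlip : LipschitzWith (2 / x).toNNReal
      fun y : H => ‖x • v + (y : F)‖⁻¹ • (x • v + (y : F)) := by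
    refine LipschitzWith.of_dist_le_mul fun y z => ?_
    rw [Real.coe_toNNReal _ (by positivity), dist_eq_norm, dist_eq_norm]
    refine (norm_normalize_sub_normalize_le hx0 (hnorm y) (hnorm z)).trans_eq ?_
    rw [add_sub_add_left_eq_sub]
    rfl
  have h5 := hlip.hausdorffMeasure_image_le (Nat.cast_nonneg (finrank ℝ H))
    {y : H | L (x, y) ∈ {y : F | ‖y‖ < 1 ∧ ‖y‖⁻¹ • y ∈ N}}
  rw [← hν, hx', mul_zero, ← hdim, nonpos_iff_eq_zero] at h5
  -- Each `Q` in the cap is the projection of `(x / a) • Q`, which lies in the slice and has norm `x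
  -- / a < 1`.
  refine measure_mono_null ?_ h5
  rintro Q ⟨hQN, hQv⟩
  have hQ1 := mem_sphere_zero_iff_norm.1 (hN hQN)
  have ha : 1 / 2 < inner ℝ v Q := hQv
  set a := inner ℝ v Q with ha'
  have ha0 : 0 < a := by linarith
  have hyH : (x / a) • Q - x • v ∈ H := by
    rw [hH, Submodule.mem_orthogonal_singleton_iff_inner_right, inner_sub_right,
      inner_smul_right, inner_smul_right, hvv, ← ha']
    field_simp
    ring
  have hxa : 0 < x / a := by positivity
  have hLQ : x • v + ((⟨_, hyH⟩ : H) : F) = (x / a) • Q := by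
    simp
  have hn : ‖(x / a) • Q‖ = x / a := by
    rw [norm_smul, hQ1, mul_one, Real.norm_of_nonneg hxa.le]
  have hnQ : ‖(x / a) • Q‖⁻¹ • ((x / a) • Q) = Q := by
    rw [hn, smul_smul, inv_mul_cancel₀ hxa.ne', one_smul]
  refine ⟨⟨_, hyH⟩, ?_, ?_⟩
  · change ‖L (x, _)‖ < 1 ∧ ‖L (x, _)‖⁻¹ • L (x, _) ∈ N
    rw [hL, hLQ, hnQ, hn, div_lt_one ha0]
    exact ⟨by linarith, hQN⟩
  · change ‖x • v + ((⟨_, hyH⟩ : H) : F)‖⁻¹ • (x • v + ((⟨_, hyH⟩ : H) : F)) = Q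
    rw [hLQ, hnQ]

/-- A subset of the unit sphere is null for the Hausdorff measure if the cone over it is null. -/
theorem hausdorffMeasure_eq_zero_of_cone {N : Set F} (hN : N ⊆ sphere 0 1)
    (hcone : Measure.hausdorffMeasure (finrank ℝ F) {y : F | ‖y‖ < 1 ∧ ‖y‖⁻¹ • y ∈ N} = 0) :
    Measure.hausdorffMeasure ((finrank ℝ F : ℝ) - 1) N = 0 := by
  have hprop : ProperSpace F := FiniteDimensional.proper ℝ F
  refine measure_null_of_locally_null N fun v hv => ?_
  have hv1 := mem_sphere_zero_iff_norm.1 (hN hv)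
  refine ⟨N ∩ {Q | 1 / 2 < inner ℝ v Q}, ?_, hausdorffMeasure_inter_cap_eq_zero hN hcone hv1⟩
  refine inter_mem_nhdsWithin _ (IsOpen.mem_nhds (isOpen_lt (by fun_prop) (by fun_prop)) ?_)
  change 1 / 2 < inner ℝ v v
  rw [real_inner_self_eq_norm_sq, hv1]; norm_num

end Hausdorff

/-! ### Exhaustion by closed sets and conclusion. -/

/-- The set of points of the sphere at which `f` is bounded by `M` on the Stolz region of aperture
`α`. -/
def stolzBoundedSet {E : Type*} [NormedAddCommGroup E] (f : E → ℂ) (α M : ℝ) : Set E :=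
  {Q | Q ∈ sphere 0 1 ∧ ∀ z, ‖z‖ < 1 → ‖z - Q‖ < α * (1 - ‖z‖) → ‖f z‖ ≤ M}

/-- For fixed `z`, membership of `z` in the Stolz region is an open condition on the vertex, so the
implication is closed whatever `f` is. -/
lemma isClosed_stolzBoundedSet {E : Type*} [NormedAddCommGroup E] (f : E → ℂ) (α M : ℝ) : IsClosed (stolzBoundedSet f α M) := by
  refine IsClosed.and isClosed_sphere ?_
  simp only [Set.ofPred_forall]
  refine isClosed_iInter fun z => isClosed_iInter fun hz => ?_
  exact isClosed_imp (isOpen_lt (by fun_prop) continuous_const) isClosed_const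

section Sphere

variable {E : Type*} [NormedAddCommGroup E] [InnerProductSpace ℂ E] [FiniteDimensional ℂ E]
  [MeasurableSpace E] [BorelSpace E] [Nontrivial E]

open Module

lemma hausdorffMeasure_eq_zero_of_coneMeasure {N : Set E} (hN : N ⊆ sphere 0 1)
    (hcone : ∀ᵐ P ∂(coneMeasure E), P.1 ∉ N) :
    Measure.hausdorffMeasure ((finrank ℝ E : ℝ) - 1) N = 0 := by
  have key := @hausdorffMeasure_eq_zero_of_cone E _ InnerProductSpace.complexToReal
    (FiniteDimensional.complexToReal E) _ _ N hN
  refine key ?_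
  have h1 : ∀ᵐ y ∂(haarVol E), y ∈ ball (0 : E) 1 → (AnisoSphere.proj y).1 ∉ N :=
    (ae_restrict_iff' measurableSet_ball).1
      (ae_of_ae_map AnisoSphere.measurable_proj.aemeasurable hcone)
  have hne : ∀ᵐ y ∂(haarVol E), y ≠ 0 := by simp [ae_iff]
  rw [measure_eq_zero_iff_ae_notMem]
  filter_upwards [h1, hne] with y hy hy0 hyN
  refine hy (mem_ball_zero_iff.2 hyN.1) ?_
  rw [AnisoSphere.proj_val hy0]
  exact hyN.2

/-- Admissible limits at almost every point of the sphere at which `f` is bounded on some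
Stolz region. -/
theorem ae_hausdorff_admissibleLimit {f : E → ℂ} (hf : DifferentiableOn ℂ f (ball 0 1)) :
    ∀ᵐ P ∂(Measure.hausdorffMeasure ((finrank ℝ E : ℝ) - 1) : Measure E), ‖P‖ = 1 →
      (∃ α > 1, ∃ M, ∀ z, ‖z‖ < 1 → ‖z - P‖ < α * (1 - ‖z‖) → ‖f z‖ ≤ M) →
      ∃ l, ∀ β, 4 ≤ β →
        Tendsto f (𝓝[{z | ‖z‖ < 1 ∧ ‖1 - inner ℂ P z‖ < β * (1 - ‖z‖)}] P) (𝓝 l) := by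
  -- Apertures `1 + 1 / (j + 1)` and integer bounds suffice: shrinking the aperture and raising the
  -- bound only weakens the requirement.
  have h : ∀ j m : ℕ, ∀ᵐ P ∂(Measure.hausdorffMeasure ((finrank ℝ E : ℝ) - 1) : Measure E),
      P ∈ stolzBoundedSet f (1 + 1 / ((j : ℝ) + 1)) m → ∃ l, ∀ β, 4 ≤ β →
        Tendsto f (𝓝[{z | ‖z‖ < 1 ∧ ‖1 - inner ℂ P z‖ < β * (1 - ‖z‖)}] P) (𝓝 l) := by
    intro j m
    have hj : (0 : ℝ) < 1 / ((j : ℝ) + 1) := by positivity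
    have h1 := ae_exists_admissibleLimit hf
      (isClosed_stolzBoundedSet f (1 + 1 / ((j : ℝ) + 1)) m) (fun Q hQ => hQ.1)
      (by linarith) (fun Q hQ => hQ.2)
    rw [ae_iff]
    refine hausdorffMeasure_eq_zero_of_coneMeasure (fun Q hQ => ?_) ?_
    · by_contra hcon
      exact hQ fun hQ' => absurd hQ'.1 hcon
    · filter_upwards [h1] with P hP hPN
      exact hPN hP
  simp only [← ae_all_iff] at h
  filter_upwards [h] with P hP hP1 hex
  obtain ⟨α, hα, M, hM⟩ := hex
  obtain ⟨j, hj⟩ := exists_nat_one_div_lt (show 0 < α - 1 by linarith)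
  obtain ⟨m, hm⟩ := exists_nat_ge M
  refine hP j m ⟨mem_sphere_zero_iff_norm.2 hP1, fun z hz hzP => (hM z hz (hzP.trans_le ?_)).trans hm⟩
  gcongr
  linarith

end Sphere

lemma dotConj_eq_inner {n : ℕ} (z P : EuclideanSpace ℂ (Fin n)) : dotConj z P = inner ℂ P z := by
  simp [dotConj, PiLp.inner_apply]

end BallApproach

theorem corollary6 (n : ℕ) (hn : 1 < n) (f : EuclideanSpace ℂ (Fin n) → ℂ)
    (hf : DifferentiableOn ℂ f (BallApproach.unitBall n))
    (E : Set (EuclideanSpace ℂ (Fin n))) (hE : E ⊆ BallApproach.unitSphere n)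
    (hpos : 0 < BallApproach.areaMeasure n E)
    (hbdd : ∀ᵐ P ∂(BallApproach.areaMeasure n),
      P ∈ E → BallApproach.NontangentiallyBoundedAt f P) :
    ∀ᵐ P ∂(BallApproach.areaMeasure n),
      P ∈ E → BallApproach.HasAdmissibleLimitAt f P := by
  have : Nonempty (Fin n) := ⟨⟨0, by omega⟩⟩
  have hdim : (Module.finrank ℝ (EuclideanSpace ℂ (Fin n)) : ℝ) - 1 = 2 * (n : ℝ) - 1 := by
    rw [finrank_real_of_complex]; simp
  have h := BallApproach.ae_hausdorff_admissibleLimit hf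
  rw [hdim] at h
  filter_upwards [hbdd, h] with P hPb hP hPE α hα
  obtain ⟨a, ha, M, hM⟩ := hPb hPE
  obtain ⟨l, hl⟩ := hP (mem_sphere_zero_iff_norm.1 (hE hPE))
    ⟨a, ha, M, fun z hz hzP => hM z ⟨mem_ball_zero_iff.2 hz, hzP⟩⟩
  -- Admissible regions grow with the aperture, so apertures below `4` are covered by aperture `4`.
  refine ⟨l, (hl (max α 4) (le_max_right _ _)).mono_left (nhdsWithin_mono _ ?_)⟩
  rintro z ⟨hz, hzA⟩
  rw [BallApproach.dotConj_eq_inner] at hzA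
  have hz1 : ‖z‖ < 1 := mem_ball_zero_iff.1 hz
  refine ⟨hz1, hzA.trans_le ?_⟩
  have : 0 ≤ 1 - ‖z‖ := by linarith
  gcongr
  exact le_max_left _ _
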